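/- **Definitions.** For $s>0$ let $\rho_s(x)=e^{-\pi\|x/s\|^2}$ on $\mathbb R^n$ and $\rho_s(A)=\sum_{x\in A}\rho_s(x)$. For a full-rank lattice $L\subset\mathbb R^n$ with dual $L^*$ let $D_{L,r}$ be the distribution on $L$ with $D_{L,r}(x)=\rho_r(x)/\rho_r(L)$; let $\eta_\varepsilon(L)$ be the smallest $s>0$ with $\rho_{1/s}(L^*\setminus\{0\})\le\varepsilon$; and let $\lambda_n(L)$ be the smallest $t$ such that $L$ contains $n$ linearly independent vectors of norm at most $t$. Input lattices ($n \ge 1$) are given by an arbitrary basis with rational coordinates, and lattice vectors are represented by their integer coefficient vectors in that basis. Let $\varphi$ be a real-valued function on lattices. * $\mathrm{GIVP}^{\varphi}_{\gamma}$: given an $n$-dimensional lattice $L$, output $n$ linearly independent vectors of $L$ of norm at most $\gamma(n)\varphi(L)$. $\mathrm{SIVP}_\gamma$ is the case $\varphi=\lambda_n$. An algorithm solves the problem with error $\delta(n)$ if it fails with probability at most $\delta(n)$ on every $n$-dimensional instance. * $\mathrm{DGS}_\varphi$: given an $n$-dimensional lattice $L$ and a rational $r>0$ with $r>\varphi(L)$,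 output a sample from $D_{L,r}$. An algorithm solves it with error $\delta(n)$ if on every $n$-dimensional instance its output distribution $p$ satisfies $\sum_x|p(x)-D_{L,r}(x)|\le\delta(n)$. A polynomial-time reduction from $P$ to $Q$ is an oracle program $M$, with running time (bit operations, up to polynomial factors: a random access machine with logarithmic cost that pays for, and receives, only a chosen number of bits of each oracle answer) bounded by a polynomial in the bit length of the instance of $P$, for every oracle, such that for every $\delta(n)\le 2^{-\Omega(n)}$ there is $\delta'(n)\le2^{-\Omega(n)}$ such that $M$ with any oracle solving $Q$ with error $\delta$ solves $P$ with error $\delta'$. Here every oracle call returns a fresh independent sample, and the oracle is arbitrary on inputs that are not instances of $Q$. **Theorem.** 1. Let $0<\varepsilon(n)\le\frac1{10}$ and let $\varphi$ satisfy $\varphi(L)\ge\sqrt2\,\eta_{\varepsilon(n)}(L)$ for every $n\ge1$ and every $n$-dimensional lattice $L$. Then there is a polynomial-time reduction from $\mathrm{GIVP}^{\varphi}_{2\sqrt n}$ to $\mathrm{DGS}_{\varphi}$. 2. Let $0<\varepsilon(n)\le\frac1{10}$ and $0<\alpha(n)<1$. Then there is a polynomial-time reduction from $\mathrm{SIVP}_\gamma$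 with $$\gamma(n)=\frac{2\sqrt2\,n}{\alpha(n)}\sqrt{\frac{\ln\bigl(2n(1+1/\varepsilon(n))\bigr)}{\pi}}$$ to $\mathrm{DGS}_{\sqrt{2n}\,\eta_\varepsilon(L)/\alpha}$. 3. In particular, there are a negligible function $\varepsilon$ with $0<\varepsilon(n)\le\frac1{10}$ and constants $C,k$ such that for every $\alpha$ with $0<\alpha(n)<1$ there is $\gamma$ with $1\le\gamma(n)\le C\,\frac{n}{\alpha(n)}\,\ln(n+1)^k$ for all $n\ge1$ (so $\gamma=\tilde O(n/\alpha)$) for which $\mathrm{SIVP}_\gamma$ reduces in polynomial time to $\mathrm{DGS}_{\sqrt{2n}\,\eta_\varepsilon(L)/\alpha}$. 4. For every full-rank lattice $L\subset\mathbb R^n$, $0<\varepsilon\le\frac1{10}$, $r\ge\sqrt2\,\eta_\varepsilon(L)$ and every subspace $H$ of $\mathbb R^n$ of dimension at most $n-1$, a sample from $D_{L,r}$ lies outside $H$ with probability at least $\frac1{10}$. -/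

import Mathlib

open scoped ENNReal

noncomputable section

/-! ### Lattices, Gaussian measures and lattice parameters -/

/-- `n`-dimensional Euclidean space. -/
abbrev Euc (n : ℕ) : Type := EuclideanSpace ℝ (Fin n)

/-- A real-valued function on lattices; only its values at full-rank lattices matter. -/
abbrev LatticeFun : Type := (n : ℕ) → Submodule ℤ (Euc n) → ℝ

/-- The Gaussian function `ρ_s(x) = exp(-π ‖x / s‖²)`. -/
def gaussian {n : ℕ} (s : ℝ) (x : Euc n) : ℝ :=
  Real.exp (-Real.pi * ‖s⁻¹ • x‖ ^ 2)

/-- `ρ_s(A) = ∑_{x ∈ A} ρ_s(x)`. -/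
def gaussianMass {n : ℕ} (s : ℝ) (A : Set (Euc n)) : ℝ :=
  ∑' x : A, gaussian s (x : Euc n)

/-- The dual lattice: all `y` with `⟪y, x⟫ ∈ ℤ` for every `x ∈ L`. -/
def dualLattice {n : ℕ} (L : Submodule ℤ (Euc n)) : Submodule ℤ (Euc n) :=
  LinearMap.BilinForm.dualSubmodule (innerₗ (Euc n)) L

/-- The smoothing parameter `η_ε(L)`: the least `s > 0` with `ρ_{1/s}(L* \ {0}) ≤ ε`. -/
def smoothingParameter {n : ℕ} (ε : ℝ) (L : Submodule ℤ (Euc n)) : ℝ :=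
  sInf {s : ℝ | 0 < s ∧ gaussianMass (1 / s) ((dualLattice L : Set (Euc n)) \ {0}) ≤ ε}

open Classical in
/-- The probability mass function of the discrete Gaussian distribution `D_{L,r}`. -/
def discreteGaussian {n : ℕ} (L : Submodule ℤ (Euc n)) (r : ℝ) (x : Euc n) : ℝ :=
  if x ∈ L then gaussian r x / gaussianMass r (L : Set (Euc n)) else 0

/-- `λ_n(L)`: the least `t` such that `L` contains `n` linearly independent vectors of norm at
most `t`. -/
def lambdaN (n : ℕ) (L : Submodule ℤ (Euc n)) : ℝ :=
  sInf {t : ℝ | ∃ v : Fin n → Euc n,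
    (∀ i, v i ∈ L) ∧ LinearIndependent ℝ v ∧ ∀ i, ‖v i‖ ≤ t}

/-! ### Polynomial-time oracle programs

The machine model is a random access machine with logarithmic cost: finitely many integer arrays
(those named in the program), computed indices, and every operation is charged the number of bits
of all the integers it handles. -/

/-- The number of bits of an integer, with its sign. -/
def bitLen (z : ℤ) : ℕ := Nat.size z.natAbs + 1

/-- The number of bits of a list of integers. -/
def listSize (l : List ℤ) : ℕ := (l.map bitLen).sum

/-- The memory: array `k` has a cell for every integer index. -/
abbrev Memory : Type := ℕ → ℤ → ℤ

/-- Integer expressions. -/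
inductive Expr : Type
  | lit (z : ℤ)
  | get (k : ℕ) (i : Expr)
  | add (a b : Expr)
  | sub (a b : Expr)
  | mul (a b : Expr)
  | div (a b : Expr)

/-- The value of an expression; `get k i` is cell number `i` of array `k`. -/
def Expr.eval (m : Memory) : Expr → ℤ
  | .lit z => z
  | .get k i => m k (i.eval m)
  | .add a b => a.eval m + b.eval m
  | .sub a b => a.eval m - b.eval m
  | .mul a b => a.eval m * b.eval m
  | .div a b => a.eval m / b.eval m

/-- The cost of evaluating an expression: the total bit length of all intermediate values. -/
def Expr.cost (m : Memory) : Expr → ℕ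
  | .lit z => bitLen z
  | .get k i => i.cost m + bitLen (m k (i.eval m))
  | .add a b => a.cost m + b.cost m + bitLen (a.eval m + b.eval m)
  | .sub a b => a.cost m + b.cost m + bitLen (a.eval m - b.eval m)
  | .mul a b => a.cost m + b.cost m + bitLen (a.eval m * b.eval m)
  | .div a b => a.cost m + b.cost m + bitLen (a.eval m / b.eval m)

/-- Programs with oracle access.
* `assign k i e` stores the value of `e` in cell `i` of array `k`.
* `ite e p q` runs `p` if `0 < e`, and `q` otherwise.
* `loop e p` runs `p` as long as `0 < e`.
* `query k k' b` sends the list held in array `k` to the oracle and stores the answer in array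
  `k'`, provided that the answer has at most `b` bits. -/
inductive Prog : Type
  | skip
  | assign (k : ℕ) (i e : Expr)
  | seq (p q : Prog)
  | ite (e : Expr) (p q : Prog)
  | loop (e : Expr) (p : Prog)
  | query (k k' : ℕ) (b : Expr)

/-- A list is held in an array with its length in cell `0` and its entries in cells `1, 2, …`. -/
def storeList (l : List ℤ) : ℤ → ℤ := fun i =>
  if i = 0 then l.length else if 0 < i then l.getD (i.toNat - 1) 0 else 0

/-- The list held in an array. -/
def readList (f : ℤ → ℤ) : List ℤ :=
  (List.range (f 0).toNat).map fun j : ℕ => f ((j : ℤ) + 1)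

/-- What a query leaves in the answer array: the answer, if it has at most `b` bits, and otherwise
the mark `-1` in cell `0`. So no more than `b` bits of an answer are ever received, however long
it is. -/
def receive (b : ℕ) (l : List ℤ) : ℤ → ℤ :=
  if listSize l ≤ b then storeList l else fun i => if i = 0 then -1 else 0

/-- A randomized oracle (or a randomized algorithm seen from outside): every call on a given
input returns a fresh sample from the distribution attached to this input. -/
abbrev Oracle : Type := List ℤ → PMF (List ℤ)

/-- The contents of the memory and the time spent so far. -/
structure Config : Type where
  mem : Memory
  time : ℕ

/-- Spend `t` units of time. -/
def Config.tick (c : Config) (t : ℕ) : Config := ⟨c.mem, c.time + t⟩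

/-- `while 0 < e do body`, with at most `F` iterations (`none` if this is exceeded). -/
def iterateLoop (e : Expr) (body : Config → PMF (Option Config)) :
    ℕ → Config → PMF (Option Config)
  | 0, _ => PMF.pure none
  | F + 1, c =>
    if 0 < e.eval c.mem then
      (body (c.tick (1 + e.cost c.mem))).bind fun r =>
        r.elim (PMF.pure none) (iterateLoop e body F)
    else PMF.pure (some (c.tick (1 + e.cost c.mem)))

/-- The distribution of the final configuration of a program, where the randomness comes from the
oracle's answers, or `none` if some loop needs more than `F` rounds. As each round takes at least
one unit of time, the cap `F` does not affect runs that take time less than `F`. -/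
def Prog.exec (O : Oracle) (F : ℕ) : Prog → Config → PMF (Option Config)
  | .skip, c => PMF.pure (some (c.tick 1))
  | .assign k i e, c =>
    PMF.pure (some ⟨Function.update c.mem k
        (Function.update (c.mem k) (i.eval c.mem) (e.eval c.mem)),
      c.time + (1 + i.cost c.mem + e.cost c.mem)⟩)
  | .seq p q, c =>
    (p.exec O F c).bind fun r => r.elim (PMF.pure none) (q.exec O F)
  | .ite e p q, c =>
    if 0 < e.eval c.mem then p.exec O F (c.tick (1 + e.cost c.mem))
    else q.exec O F (c.tick (1 + e.cost c.mem))
  | .loop e p, c => iterateLoop e (p.exec O F) F c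
  | .query k k' b, c =>
    (O (readList (c.mem k))).map fun a =>
      some ⟨Function.update c.mem k' (receive (b.eval c.mem).toNat a),
        c.time + (1 + b.cost c.mem + (b.eval c.mem).toNat + listSize (readList (c.mem k)))⟩

/-- The start: the input is held in array `0`, and all other cells are `0`. -/
def startConfig (x : List ℤ) : Config :=
  ⟨fun k => if k = 0 then storeList x else fun _ => 0, 0⟩

/-- The output is the list held in array `1` at the end. -/
def Config.output (c : Config) : List ℤ := readList (c.mem 1)

/-- The distribution of the output of `M` with oracle `O` on input `x`. -/
def Prog.outputDist (M : Prog) (O : Oracle) (F : ℕ) (x : List ℤ) : PMF (List ℤ) :=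
  (M.exec O F (startConfig x)).map fun r => r.elim [] Config.output

/-! ### Problems and reductions -/

/-- A computational problem: instances with their encoding and dimension, and for every instance
the error of a (random) output. -/
structure LatticeProblem : Type 1 where
  Inst : Type
  encode : Inst → List ℤ
  dim : Inst → ℕ
  err : Inst → PMF (List ℤ) → ℝ≥0∞

/-- `δ(n) ≤ 2^{-Ω(n)}`. -/
def ExpSmall (δ : ℕ → ℝ≥0∞) : Prop :=
  ∃ c : ℝ, 0 < c ∧ ∀ᶠ n : ℕ in Filter.atTop, δ n ≤ ENNReal.ofReal (2 ^ (-(c * n)))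

/-- `O` solves `Q` with error at most `δ(n)` on the instances of dimension `n`. Nothing is said
about what `O` does on lists that do not encode an instance. -/
def Oracle.Solves (O : Oracle) (Q : LatticeProblem) (δ : ℕ → ℝ≥0∞) : Prop :=
  ∀ y : Q.Inst, Q.err y (O (Q.encode y)) ≤ δ (Q.dim y)

/-- `M` runs in time at most `T` (of the input length) on the instances of `P`, whatever the
oracle is and whatever it answers; writing down the output is counted. -/
def Prog.RunsInTime (M : Prog) (P : LatticeProblem) (T : ℕ → ℕ) : Prop :=
  ∀ (O : Oracle) (x : P.Inst),
    ∀ r ∈ (M.exec O (T (listSize (P.encode x))) (startConfig (P.encode x))).support,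
      ∃ c : Config, r = some c ∧
        c.time + listSize c.output ≤ T (listSize (P.encode x))

/-- A polynomial-time reduction from `P` to `Q`: a polynomial-time oracle program that solves `P`
with exponentially small error given any oracle that solves `Q` exactly or with exponentially small
error. -/
def PolyTimeReducible (P Q : LatticeProblem) : Prop :=
  ∃ (M : Prog) (T : Polynomial ℕ),
    M.RunsInTime P (fun s => T.eval s) ∧
    ∀ δ : ℕ → ℝ≥0∞, ExpSmall δ → ∃ δ' : ℕ → ℝ≥0∞, ExpSmall δ' ∧
      ∀ O : Oracle, O.Solves Q δ →
        ∀ x : P.Inst,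
          P.err x (M.outputDist O (T.eval (listSize (P.encode x))) (P.encode x))
            ≤ δ' (P.dim x)

/-! ### The lattice problems -/

/-- An integer matrix, row by row. -/
def encodeMatrix {n : ℕ} (A : Matrix (Fin n) (Fin n) ℤ) : List ℤ :=
  (List.ofFn fun i => List.ofFn (A i)).flatten

/-- A basis of a full-rank lattice with rational coordinates: the `i`-th basis vector is the
`i`-th row of `mat`, divided by `den`. -/
structure LatticeBasis : Type where
  n : ℕ
  n_pos : 0 < n
  den : ℕ
  den_pos : 0 < den
  mat : Matrix (Fin n) (Fin n) ℤ
  det_ne_zero : mat.det ≠ 0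

namespace LatticeBasis

variable (B : LatticeBasis)

/-- The basis vectors. -/
def vec (i : Fin B.n) : Euc B.n := WithLp.toLp 2 fun j => (B.mat i j : ℝ) / (B.den : ℝ)

/-- The lattice generated by the basis. -/
def lattice : Submodule ℤ (Euc B.n) := Submodule.span ℤ (Set.range B.vec)

/-- The lattice vector with coefficient vector `z`. -/
def point (z : Fin B.n → ℤ) : Euc B.n := ∑ i, z i • B.vec i

/-- The encoding of the basis as a list of integers. -/
def encode : List ℤ := (B.n : ℤ) :: (B.den : ℤ) :: encodeMatrix B.mat

/-- `a` lists the coefficient vectors of `n` linearly independent lattice vectors of norm at most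
`t`. -/
def IsShortSet (t : ℝ) (a : List ℤ) : Prop :=
  ∃ z : Matrix (Fin B.n) (Fin B.n) ℤ, a = encodeMatrix z ∧
    LinearIndependent ℝ (fun i => B.point (z i)) ∧ ∀ i, ‖B.point (z i)‖ ≤ t

end LatticeBasis

/-- The generalized independent vectors problem `GIVP^φ_γ`: given a lattice `L`, output `n`
linearly independent lattice vectors of norm at most `γ(n) φ(L)`. The error is the probability of
failure. -/
def GIVP (γ : ℕ → ℝ) (φ : LatticeFun) : LatticeProblem where
  Inst := LatticeBasis
  encode B := B.encode
  dim B := B.n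
  err B p := p.toOuterMeasure {a | ¬ B.IsShortSet (γ B.n * φ B.n B.lattice) a}

/-- The shortest independent vectors problem `SIVP_γ`. -/
def SIVP (γ : ℕ → ℝ) : LatticeProblem := GIVP γ lambdaN

/-- An instance of `DGS_φ`: a lattice `L` and a (rational) number `r > φ(L)`. -/
structure DGSInstance (φ : LatticeFun) : Type extends LatticeBasis where
  r : ℚ
  r_pos : 0 < r
  lt_r : φ n toLatticeBasis.lattice < (r : ℝ)

open Classical in
/-- The distribution `D_{L,r}`, where a lattice vector is encoded by its coefficient vector. -/
def DGSInstance.target {φ : LatticeFun} (I : DGSInstance φ) (a : List ℤ) : ℝ :=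
  if a.length = I.n then
    discreteGaussian I.lattice (I.r : ℝ) (I.point fun i => a.getD (i : ℕ) 0)
  else 0

/-- The discrete Gaussian sampling problem `DGS_φ`: given a lattice `L` and `r > φ(L)`, output a
sample from `D_{L,r}`. The error is the statistical distance from `D_{L,r}`. -/
def DGS (φ : LatticeFun) : LatticeProblem where
  Inst := DGSInstance φ
  encode I := I.encode ++ [I.r.num, (I.r.den : ℤ)]
  dim I := I.n
  err I p := ∑' a : List ℤ, ENNReal.ofReal |(p a).toReal - I.target a|

end

/-! The reduction improves a basis of a sublattice step by step. The state is an integer matrix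
whose rows are coefficient vectors of n independent lattice vectors; it starts as the identity, that
is, as the given basis. With K = `logSize`, the program runs through the scales r = 2^j / 2^K for j
from 2K down to 0 and asks for 100n samples at each of them. A sample of norm at most √n r replaces
rows that were not yet replaced at this scale, as long as the matrix stays nonsingular. The program
cannot know φ(L), so it cannot tell which queries are instances; it need not, because independence
and lengths are checked and all later replacements obey a smaller length bound.

If φ(L) < 2^K, some scale satisfies φ(L) < r ≤ 2φ(L) (`exists_scale`; the lower end of the range
suffices by `two_pow_neg_le`). There the oracle must be nearly correct. For n ≥ 5 and small δ a
sample is, with probability at least 1/20, short and outside the span of the rows already replaced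
at this scale (`tsum_discreteGaussian_notMem_ge` and the tail bound `tsum_gaussian_tail_le`). By
Cramer's rule (`det_smul_eq_sum`) it then replaces a further row. With u rows missing and k samples
to come, 2^u (39/40)^k does not grow in expectation (`potential_step`), so all rows have norm at
most √n r ≤ 2√n φ(L) at the end of this scale, up to probability 2^n (39/40)^(100n). If φ(L) ≥ 2^K,
the given basis is short enough already.

The analysis rests on Poisson summation for a Gaussian composed with a self-adjoint map
(`lattice_poisson`). Let u be a unit normal of H. Stretching by √2 along u does not change the
Gaussian on H but divides the constant in Poisson's formula by √2, which gives ρ_r(L ∩ H) ≤ (1 +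
ε)/√2 · ρ_r(L) with factor below 9/10. For SIVP one needs η_ε(L) ≤ λ_n(L) √(ln(2n(1 + 1/ε))/π). For
this, L* is cut into layers by the integer values of ⟪y, v⟫, with v running through n short
independent vectors of L. A layer off the origin is a translate of a shifted copy of the central one
and has much smaller mass (`tsum_inner_ne_zero_le`).

On the machine, determinants are tested by the Faddeev–LeVerrier recursion, whose divisions are
exact, so that all integers keep polynomially many bits. `Runs` describes deterministic pieces of
the program. `Wp` bounds the expectation of a function of the final memory, where a run that fails
or is late counts as ∞. Thus one statement, `wp_reduction`, yields both the running time (with a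
constant potential) and the error bound. -/

noncomputable section

/-! ### The Faddeev–LeVerrier algorithm -/

open Polynomial in
-- Jacobi's formula. By the product rule, differentiating the Leibniz expansion replaces one column
-- of `X - A` at a time by a unit vector, and the result is the expansion of a diagonal entry of the
-- adjugate.
theorem Matrix.derivative_charpoly_eq_trace_adjugate {n : ℕ} (A : Matrix (Fin n) (Fin n) ℤ) :
    derivative A.charpoly = (Matrix.charmatrix A).adjugate.trace := by
  classical
  rw [Matrix.charpoly, Matrix.det_apply, derivative_sum, ← Matrix.trace_transpose,
    Matrix.adjugate_transpose, Matrix.trace]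
  have h1 : ∀ σ : Equiv.Perm (Fin n),
      derivative (Equiv.Perm.sign σ • ∏ i, A.charmatrix (σ i) i) =
        ∑ j, Equiv.Perm.sign σ • ∏ i, (A.charmatrix.updateCol j (Pi.single j 1)) (σ i) i := by
    intro σ
    rw [Units.smul_def, derivative_smul, derivative_prod_finset, Finset.smul_sum]
    refine Finset.sum_congr rfl fun j _ => ?_
    congr 1
    rw [← Finset.prod_erase_mul _ _ (Finset.mem_univ j)]
    congr 1
    · refine Finset.prod_congr rfl fun i hi => ?_
      rw [Matrix.updateCol_ne (Finset.ne_of_mem_erase hi)]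
    · rw [Matrix.updateCol_self, Matrix.charmatrix_apply]
      by_cases h : σ j = j
      · simp [h]
      · simp [h]
  simp_rw [h1]
  rw [Finset.sum_comm]
  refine Finset.sum_congr rfl fun j _ => ?_
  rw [Matrix.diag_apply, Matrix.adjugate_apply, Matrix.updateRow_transpose,
    Matrix.det_transpose, Matrix.det_apply]

/-- The state after `k` rounds of the Faddeev–LeVerrier algorithm: a matrix and the coefficient of
`X ^ (n - k)` in the characteristic polynomial. -/
def faddeevLeVerrier {n : ℕ} (A : Matrix (Fin n) (Fin n) ℤ) : ℕ → Matrix (Fin n) (Fin n) ℤ × ℤ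
  | 0 => (0, 1)
  | k + 1 =>
    let Y := A * ((faddeevLeVerrier A k).1 + (faddeevLeVerrier A k).2 • 1)
    (Y, -Y.trace / ((k : ℤ) + 1))

open Polynomial in
-- Write the adjugate of X - A as a polynomial B with matrix coefficients. Comparing coefficients in
-- (X - A) B = χ · 1 gives the recursion for the matrices. Since the trace of B is χ', the trace of
-- the new matrix is -(k + 1) times the next coefficient of χ, so the integer division is exact.
theorem faddeevLeVerrier_eq {n : ℕ} (A : Matrix (Fin n) (Fin n) ℤ) (k : ℕ) (hk : k ≤ n) :
    (faddeevLeVerrier A k).1 = A * (matPolyEquiv (Matrix.charmatrix A).adjugate).coeff (n - k) ∧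
    (faddeevLeVerrier A k).2 = A.charpoly.coeff (n - k) := by
  set B := matPolyEquiv (Matrix.charmatrix A).adjugate with hB
  have hmul : (X - C A) * B = matPolyEquiv (A.charpoly • 1) := by
    rw [hB, ← Matrix.matPolyEquiv_charmatrix, ← map_mul, Matrix.mul_adjugate, Matrix.charpoly]
  have hrec : ∀ i, B.coeff i = A * B.coeff (i + 1) + A.charpoly.coeff (i + 1) • 1 := by
    intro i
    have := congrArg (fun q => q.coeff (i + 1)) hmul
    simp only [sub_mul, coeff_sub, coeff_X_mul, coeff_C_mul, matPolyEquiv_smul_one, coeff_map] at this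
    rw [sub_eq_iff_eq_add] at this
    rw [this, add_comm]
    congr 1
    ext a b
    simp [Matrix.algebraMap_matrix_apply, Matrix.one_apply]
  have htr : ∀ i, (B.coeff i).trace = A.charpoly.coeff (i + 1) * ((i : ℤ) + 1) := by
    intro i
    rw [← coeff_derivative, Matrix.derivative_charpoly_eq_trace_adjugate]
    simp [Matrix.trace, hB, matPolyEquiv_coeff_apply]
  -- From index n on the recursion reads b_j = A b_{j+1}, so a leading coefficient there would equal
  -- A · 0.
  have hdeg : ∀ i, n ≤ i → B.coeff i = 0 := by
    by_contra! hcon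
    obtain ⟨i, hi, hne⟩ := hcon
    have hz : ∀ j, n ≤ j → B.coeff j = A * B.coeff (j + 1) := by
      intro j hj
      have h0 : A.charpoly.coeff (j + 1) = 0 := by
        refine coeff_eq_zero_of_natDegree_lt ?_
        rw [Matrix.charpoly_natDegree_eq_dim, Fintype.card_fin]; omega
      rw [hrec j, h0, zero_smul, add_zero]
    have hB0 : B ≠ 0 := by rintro h; simp [h] at hne
    have hle : i ≤ B.natDegree := le_natDegree_of_ne_zero hne
    have := hz B.natDegree (hi.trans hle)
    rw [coeff_eq_zero_of_natDegree_lt (Nat.lt_succ_self _), mul_zero] at this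
    exact hB0 (leadingCoeff_eq_zero.mp this)
  induction k with
  | zero =>
    refine ⟨by simp [faddeevLeVerrier, hdeg], ?_⟩
    have := A.charpoly_monic.coeff_natDegree
    rw [Matrix.charpoly_natDegree_eq_dim, Fintype.card_fin] at this
    simp [faddeevLeVerrier, this]
  | succ k ih =>
    obtain ⟨h1, h2⟩ := ih (by omega)
    have hn : n - k = n - (k + 1) + 1 := by omega
    have hY : (faddeevLeVerrier A (k + 1)).1 = A * B.coeff (n - (k + 1)) := by
      simp only [faddeevLeVerrier, h1, h2]
      rw [hrec (n - (k + 1)), ← hn]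
    refine ⟨hY, ?_⟩
    have h3 : (faddeevLeVerrier A (k + 1)).2 =
      -(faddeevLeVerrier A (k + 1)).1.trace / ((k : ℤ) + 1) := rfl
    rw [h3, hY]
    have h4 : (A * B.coeff (n - (k + 1))).trace = -(A.charpoly.coeff (n - (k + 1)) * ((k : ℤ) + 1)) := by
      -- At index 0 there is no lower coefficient of `B` to take a trace of. The constant terms give
      -- A b₀ = -χ₀ · 1, of trace -n χ₀, and here k + 1 = n.
      rcases Nat.eq_zero_or_pos (n - (k + 1)) with h0 | hpos
      · have := congrArg (fun q => q.coeff 0) hmul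
        simp only [sub_mul, coeff_sub, matPolyEquiv_smul_one, coeff_map,
          mul_coeff_zero, coeff_C_zero, coeff_X_zero, zero_mul, zero_sub] at this
        rw [h0, neg_eq_iff_eq_neg.mp this, Matrix.trace_neg,
          Algebra.algebraMap_eq_smul_one, Matrix.trace_smul, Matrix.trace_one, Fintype.card_fin]
        have hk' : ((k : ℤ) + 1) = n := by omega
        simp [hk']
      · obtain ⟨i, hi⟩ : ∃ i, n - (k + 1) = i + 1 := ⟨_, (Nat.succ_pred_eq_of_pos hpos).symm⟩
        have h5 := htr i
        rw [hrec i, Matrix.trace_add, Matrix.trace_smul, Matrix.trace_one, Fintype.card_fin] at h5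
        rw [hi]
        have : (n : ℤ) = i + 1 + (k + 1) := by omega
        simp only [smul_eq_mul, this] at h5
        linarith
    rw [h4, neg_neg, Int.mul_ediv_cancel _ (by omega)]

/-- One round multiplies `A` by a sum of two bounded matrices, at the price of a factor 2nz, and the
trace costs another n. The division does not increase absolute values. -/
theorem abs_faddeevLeVerrier_le {n : ℕ} (hn : 0 < n) (A : Matrix (Fin n) (Fin n) ℤ) {z : ℤ}
    (hz : ∀ i j, |A i j| ≤ z) (k : ℕ) :
    (∀ i j, |(faddeevLeVerrier A k).1 i j| ≤ (2 * n ^ 2 * z) ^ k) ∧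
      |(faddeevLeVerrier A k).2| ≤ (2 * n ^ 2 * z) ^ k := by
  have hz0 : 0 ≤ z := (abs_nonneg _).trans (hz ⟨0, hn⟩ ⟨0, hn⟩)
  have hn1 : (1 : ℤ) ≤ n := by omega
  induction k with
  | zero => simp [faddeevLeVerrier]
  | succ k ih =>
    obtain ⟨h1, h2⟩ := ih
    set H := (2 * (n : ℤ) ^ 2 * z) ^ k with hH
    have hH0 : 0 ≤ H := by positivity
    have hY : ∀ i j, |(faddeevLeVerrier A (k + 1)).1 i j| ≤ n * (z * (2 * H)) := by
      intro i j
      simp only [faddeevLeVerrier, Matrix.mul_apply]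
      refine (Finset.abs_sum_le_sum_abs _ _).trans ?_
      refine (Finset.sum_le_card_nsmul _ _ (z * (2 * H)) fun l _ => ?_).trans (by simp)
      rw [abs_mul]
      refine mul_le_mul (hz _ _) ?_ (abs_nonneg _) hz0
      rw [Matrix.add_apply, Matrix.smul_apply, Matrix.one_apply]
      refine (abs_add_le _ _).trans ?_
      have := h1 l j
      split_ifs <;> simp <;> linarith
    have hs : (2 * (n : ℤ) ^ 2 * z) ^ (k + 1) = n * (n * (z * (2 * H))) := by rw [pow_succ, hH]; ring
    rw [hs]
    have hnn : 0 ≤ n * (z * (2 * H)) := by positivity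
    refine ⟨fun i j => (hY i j).trans (le_mul_of_one_le_left hnn hn1), ?_⟩
    have h3 : (faddeevLeVerrier A (k + 1)).2 =
      -(faddeevLeVerrier A (k + 1)).1.trace / ((k : ℤ) + 1) := rfl
    rw [h3]
    refine (Int.abs_ediv_le_abs _ _).trans ?_
    rw [abs_neg, Matrix.trace]
    refine (Finset.abs_sum_le_sum_abs _ _).trans ?_
    exact (Finset.sum_le_card_nsmul _ _ _ fun l _ => hY l l).trans (by simp)

theorem faddeevLeVerrier_ne_zero_iff {n : ℕ} (A : Matrix (Fin n) (Fin n) ℤ) :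
    (faddeevLeVerrier A n).2 ≠ 0 ↔ A.det ≠ 0 := by
  rw [(faddeevLeVerrier_eq A n le_rfl).2, Nat.sub_self, Matrix.det_eq_sign_charpoly_coeff]
  simp

end

noncomputable section

/-! ### Summability of Gaussians over discrete subgroups -/

/-- This uses ‖x + c‖ ≥ |‖x‖ - ‖c‖| and 2‖x‖‖c‖ ≤ θ‖x‖² + ‖c‖²/θ. For θ < 1 a shift of a Gaussian is
absorbed by a constant and a wider Gaussian, uniformly for bounded `c`. -/
theorem exp_neg_norm_add_sq_le {E : Type*} [NormedAddCommGroup E] {a θ : ℝ} (ha : 0 < a) (hθ : 0 < θ) (x c : E) :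
    Real.exp (-a * ‖x + c‖ ^ 2) ≤
      Real.exp (a * (1 / θ - 1) * ‖c‖ ^ 2) * Real.exp (-(a * (1 - θ)) * ‖x‖ ^ 2) := by
  rw [← Real.exp_add, Real.exp_le_exp]
  have h1 : |‖x‖ - ‖c‖| ≤ ‖x + c‖ := by
    simpa using abs_norm_sub_norm_le x (-c)
  have h2 : (‖x‖ - ‖c‖) ^ 2 ≤ ‖x + c‖ ^ 2 := 
    sq_le_sq' (by linarith [neg_abs_le (‖x‖ - ‖c‖)]) ((le_abs_self _).trans h1)
  have h3 : 2 * ‖x‖ * ‖c‖ ≤ θ * ‖x‖ ^ 2 + 1 / θ * ‖c‖ ^ 2 := by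
    have : 0 ≤ (θ * ‖x‖ - ‖c‖) ^ 2 / θ := by positivity
    have h4 : (θ * ‖x‖ - ‖c‖) ^ 2 / θ = θ * ‖x‖ ^ 2 + 1 / θ * ‖c‖ ^ 2 - 2 * ‖x‖ * ‖c‖ := by
      field_simp; ring
    linarith
  nlinarith

section Summability

variable {E : Type*} [NormedAddCommGroup E] [NormedSpace ℝ E] [FiniteDimensional ℝ E]

/-- The inequality exp y ≥ y^k / k! bounds the Gaussian by the inverse power 2k of the norm, and 2k
exceeds the rank. -/
theorem summable_exp_neg_norm_sq (L : Submodule ℤ E) [DiscreteTopology L] {a : ℝ} (ha : 0 < a) :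
    Summable fun x : L => Real.exp (-a * ‖(x : E)‖ ^ 2) := by
  set k := Module.finrank ℤ L + 1
  have h := (ZLattice.summable_norm_pow_inv L (2 * k) (by omega)).mul_left ((k.factorial : ℝ) / a ^ k)
  refine Summable.of_norm_bounded_eventually h ?_
  have hfin : ({0} : Set L).Finite := Set.finite_singleton 0
  filter_upwards [hfin.compl_mem_cofinite] with x hx
  have hx0 : 0 < ‖(x : E)‖ := norm_pos_iff.mpr fun h => hx (Subtype.ext h)
  have hy : 0 < a * ‖(x : E)‖ ^ 2 := by positivity
  have h1 := Real.pow_div_factorial_le_exp _ hy.le k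
  rw [Real.norm_eq_abs, Real.abs_exp, neg_mul, Real.exp_neg]
  refine (inv_anti₀ (by positivity) h1).trans (le_of_eq ?_)
  rw [Submodule.norm_coe]
  rw [mul_pow, ← pow_mul, inv_div, inv_pow]
  field_simp

theorem summable_exp_neg_norm_add_sq (L : Submodule ℤ E) [DiscreteTopology L] {a : ℝ} (ha : 0 < a)
    (c : E) : Summable fun x : L => Real.exp (-a * ‖(x : E) + c‖ ^ 2) := by
  refine Summable.of_nonneg_of_le (fun _ => (Real.exp_pos _).le)
    (fun x => exp_neg_norm_add_sq_le ha (θ := 1 / 2) (by norm_num) (x : E) c)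
    ((summable_exp_neg_norm_sq L (by linarith)).mul_left _)

end Summability

/-! ### The Poisson summation formula for Gaussians -/

section Poisson

open MeasureTheory

variable {E : Type*} [NormedAddCommGroup E] [InnerProductSpace ℝ E] [FiniteDimensional ℝ E]
  [MeasurableSpace E] [BorelSpace E] {ι : Type*} [Fintype ι]

/-- The standard lattice in `ι → ℝ`. -/
abbrev stdLattice (ι : Type*) [Fintype ι] : Submodule ℤ (ι → ℝ) :=
  Submodule.span ℤ (Set.range (Pi.basisFun ℝ ι))

theorem mem_stdLattice (x : ι → ℝ) : x ∈ stdLattice ι ↔ ∀ i, ∃ z : ℤ, (z : ℝ) = x i := by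
  classical
  rw [Module.Basis.mem_span_iff_repr_mem]
  simp

/-- The character `x ↦ exp (2 π i ∑ mᵢ xᵢ)`. -/
def cubeChar (m : ι → ℤ) (x : ι → ℝ) : ℂ :=
  Complex.exp (((2 * Real.pi * ∑ i, m i * x i : ℝ) : ℂ) * Complex.I)

theorem norm_cubeChar (m : ι → ℤ) (x : ι → ℝ) : ‖cubeChar m x‖ = 1 :=
  Complex.norm_exp_ofReal_mul_I _

theorem cubeChar_add (m : ι → ℤ) (x y : ι → ℝ) :
    cubeChar m (x + y) = cubeChar m x * cubeChar m y := by
  rw [cubeChar, cubeChar, cubeChar, ← Complex.exp_add]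
  congr 1
  push_cast
  simp only [Pi.add_apply, mul_add, Finset.sum_add_distrib, Complex.ofReal_add]
  ring

theorem cubeChar_of_mem (m : ι → ℤ) {x : ι → ℝ} (hx : x ∈ stdLattice ι) : cubeChar m x = 1 := by
  choose z hz using (mem_stdLattice x).mp hx
  rw [cubeChar, Complex.exp_eq_one_iff]
  refine ⟨∑ i, m i * z i, ?_⟩
  simp_rw [← hz]
  push_cast
  ring

theorem mFourier_coe (m : ι → ℤ) (x : ι → ℝ) :
    UnitAddTorus.mFourier m (fun i => (x i : UnitAddCircle)) = cubeChar m x := by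
  simp only [UnitAddTorus.mFourier, ContinuousMap.coe_mk, fourier_coe_apply, cubeChar]
  rw [← Complex.exp_sum]
  congr 1
  push_cast
  rw [Finset.mul_sum, Finset.sum_mul]
  refine Finset.sum_congr rfl fun i _ => ?_
  ring

theorem continuous_cubeChar (m : ι → ℤ) : Continuous (cubeChar m) := by
  unfold cubeChar; fun_prop

/-- The Fourier transform of a Gaussian in linear coordinates. -/
theorem integral_cubeChar_mul_gaussian (T : (ι → ℝ) ≃L[ℝ] E) {c : ℝ} (hc : 0 < c)
    (hT : Measure.map T volume = ENNReal.ofReal c • (volume : Measure E)) (m : ι → ℤ) (w : E)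
    (hw : ∀ x, inner ℝ w (T x) = ∑ i, m i * x i) :
    Integrable (fun x : ι → ℝ => cubeChar (-m) x * (Real.exp (-Real.pi * ‖T x‖ ^ 2) : ℂ)) ∧
    ∫ x : ι → ℝ, cubeChar (-m) x * (Real.exp (-Real.pi * ‖T x‖ ^ 2) : ℂ) =
      (c * Real.exp (-Real.pi * ‖w‖ ^ 2) : ℝ) := by
  -- Transported to `E`, the character becomes a character of v ↦ ⟪v, w⟫, and the integral is the
  -- Fourier transform at `w` of the Gaussian that is its own transform.
  set e : (ι → ℝ) ≃ᵐ E := T.toHomeomorph.toMeasurableEquiv with he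
  have heT : ∀ x, e x = T x := fun _ => rfl
  set G : E → ℂ := fun v => Complex.exp (((-2 * Real.pi * inner ℝ v w : ℝ) : ℂ) * Complex.I) •
    Complex.exp (-(Real.pi : ℂ) * (‖v‖ : ℂ) ^ 2) with hG
  have hfun : (fun x : ι → ℝ => cubeChar (-m) x * (Real.exp (-Real.pi * ‖T x‖ ^ 2) : ℂ)) =
      fun x => G (e x) := by
    funext x
    simp only [hG, heT, cubeChar, smul_eq_mul, real_inner_comm w (T x)]
    rw [hw]
    push_cast
    simp only [Pi.neg_apply, Int.cast_neg, neg_mul, Finset.sum_neg_distrib,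
      mul_neg]
  have hGint : Integrable G := by
    have := GaussianFourier.integrable_cexp_neg_mul_sq_norm_add (V := E) (b := (Real.pi : ℂ))
      (by simpa using Real.pi_pos) (-2 * Real.pi * Complex.I) w
    refine this.congr (Filter.Eventually.of_forall fun v => ?_)
    simp only [hG, smul_eq_mul, ← Complex.exp_add, real_inner_comm w v]
    congr 1
    push_cast
    ring
  rw [hfun]
  have hmap : Measure.map e volume = ENNReal.ofReal c • (volume : Measure E) := hT
  constructor
  · have := (integrable_map_equiv (μ := volume) e G).mp
    rw [hmap] at this
    exact this (hGint.smul_measure ENNReal.ofReal_ne_top)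
  · rw [← integral_map_equiv e G, hmap, integral_smul_measure, hG, ← Real.fourier_eq',
      fourier_gaussian_innerProductSpace (by simpa using Real.pi_pos)]
    rw [div_self (by exact_mod_cast Real.pi_ne_zero), Complex.one_cpow, one_mul,
      ENNReal.toReal_ofReal hc.le]
    rw [Complex.real_smul]
    push_cast
    congr 2
    field_simp

theorem exists_norm_le_mul_norm {E : Type*} [NormedAddCommGroup E] [InnerProductSpace ℝ E]
    (T : (ι → ℝ) ≃L[ℝ] E) :
    ∃ κ : ℝ, 0 < κ ∧ ∀ x, κ * ‖x‖ ^ 2 ≤ ‖T x‖ ^ 2 := by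
  set C := ‖(T.symm : E →L[ℝ] (ι → ℝ))‖ + 1
  have hC : 0 < C := by positivity
  refine ⟨(C ^ 2)⁻¹, by positivity, fun x => ?_⟩
  have h1 : ‖x‖ ≤ C * ‖T x‖ := by
    have := (T.symm : E →L[ℝ] (ι → ℝ)).le_opNorm (T x)
    simp only [ContinuousLinearEquiv.coe_coe, ContinuousLinearEquiv.symm_apply_apply] at this
    refine this.trans (mul_le_mul_of_nonneg_right (by simp [C]) (norm_nonneg _))
  rw [inv_mul_le_iff₀ (by positivity), ← mul_pow]
  exact pow_le_pow_left₀ (norm_nonneg _) h1 2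

/-- The periodized Gaussian is a continuous function on the torus. Its Fourier coefficients are
values of the Fourier transform of the Gaussian; they are summable, so the Fourier series converges
to the function at every point. -/
theorem gaussian_poisson (T : (ι → ℝ) ≃L[ℝ] E) {c : ℝ} (hc : 0 < c)
    (hT : Measure.map T volume = ENNReal.ofReal c • (volume : Measure E)) (w : (ι → ℤ) → E)
    (hw : ∀ m x, inner ℝ (w m) (T x) = ∑ i, m i * x i)
    (hsum : Summable fun m => Real.exp (-Real.pi * ‖w m‖ ^ 2)) (x : ι → ℝ) :
    HasSum (fun m : ι → ℤ => ((c * Real.exp (-Real.pi * ‖w m‖ ^ 2) : ℝ) : ℂ) * cubeChar m x)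
      ((∑' z : stdLattice ι, Real.exp (-Real.pi * ‖T (z + x)‖ ^ 2) : ℝ) : ℂ) := by
  obtain ⟨κ, hκ, hκT⟩ := exists_norm_le_mul_norm T
  set g : (ι → ℝ) → ℝ := fun y => Real.exp (-Real.pi * ‖T y‖ ^ 2) with hg
  have hgle : ∀ y, g y ≤ Real.exp (-(Real.pi * κ) * ‖y‖ ^ 2) := fun y => by
    rw [hg, Real.exp_le_exp]
    nlinarith [hκT y, Real.pi_pos]
  have hπκ : 0 < Real.pi * κ := mul_pos Real.pi_pos hκ
  -- uniform bounds on bounded sets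
  set u : ℝ → stdLattice ι → ℝ := fun R z =>
    Real.exp (Real.pi * κ * R ^ 2) * Real.exp (-(Real.pi * κ / 2) * ‖(z : ι → ℝ)‖ ^ 2) with hu
  have husum : ∀ R, Summable (u R) := fun R =>
    (summable_exp_neg_norm_sq _ (by positivity)).mul_left _
  have hule : ∀ R (z : stdLattice ι) y, ‖y‖ ≤ R → g (z + y) ≤ u R z := by
    intro R z y hy
    refine (hgle _).trans ((exp_neg_norm_add_sq_le hπκ (θ := 1 / 2) (by norm_num) _ _).trans ?_)
    rw [hu]
    refine mul_le_mul (Real.exp_le_exp.mpr ?_) (le_of_eq ?_) (Real.exp_pos _).le (Real.exp_pos _).le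
    · have : ‖y‖ ^ 2 ≤ R ^ 2 := pow_le_pow_left₀ (norm_nonneg _) hy 2
      nlinarith
    · ring_nf
  set F : (ι → ℝ) → ℝ := fun y => ∑' z : stdLattice ι, g (z + y) with hF
  have hgc : Continuous g := by rw [hg]; fun_prop
  have hFc : Continuous F := by
    rw [continuous_iff_continuousAt]
    intro y
    have : ContinuousOn F (Metric.ball 0 (‖y‖ + 1)) := by
      refine continuousOn_tsum (fun z => (hgc.comp (by fun_prop)).continuousOn)
        (husum (‖y‖ + 1)) fun z v hv => ?_
      rw [Real.norm_of_nonneg (Real.exp_pos _).le]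
      exact hule _ _ _ (by simpa using (Metric.mem_ball.mp hv).le)
    exact this.continuousAt (Metric.isOpen_ball.mem_nhds (by simp))
  have hFper : ∀ (z : stdLattice ι) y, F (z + y) = F y := by
    intro z y
    rw [hF]
    simp only
    rw [← (Equiv.addRight z).tsum_eq (fun z' : stdLattice ι => g (z' + y))]
    refine tsum_congr fun z' => ?_
    simp [add_assoc]
  -- the function on the torus
  have hq : IsOpenQuotientMap (fun (y : ι → ℝ) (i : ι) => (y i : UnitAddCircle)) :=
    IsOpenQuotientMap.piMap fun _ => QuotientAddGroup.isOpenQuotientMap_mk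
  choose lift hlift using hq.surjective
  -- Any section of the quotient map will do, as `F` is periodic.
  have hFlift : ∀ y, F (lift fun i => (y i : UnitAddCircle)) = F y := by
    intro y
    have h1 : lift (fun i => (y i : UnitAddCircle)) - y ∈ stdLattice ι := by
      rw [mem_stdLattice]
      intro i
      have h2 := congrFun (hlift fun i => (y i : UnitAddCircle)) i
      simp only at h2
      obtain ⟨k, hk⟩ := (QuotientAddGroup.eq.mp h2.symm)
      refine ⟨k, ?_⟩
      simp only [zsmul_eq_mul, mul_one] at hk
      rw [Pi.sub_apply, hk]
      ring
    have := hFper ⟨_, h1⟩ y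
    simpa using this
  set Ft : C(UnitAddTorus ι, ℂ) := ⟨fun p => (F (lift p) : ℂ), by
    rw [hq.isQuotientMap.continuous_iff]
    have : ((fun p => (F (lift p) : ℂ)) ∘ fun (y : ι → ℝ) (i : ι) => (y i : UnitAddCircle)) =
        fun y => (F y : ℂ) := by
      funext y; simp only [Function.comp_apply, hFlift]
    rw [this]
    exact Complex.continuous_ofReal.comp hFc⟩ with hFt
  have hcoef : ∀ m, UnitAddTorus.mFourierCoeff Ft m =
      ((c * Real.exp (-Real.pi * ‖w m‖ ^ 2) : ℝ) : ℂ) := by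
    intro m
    obtain ⟨hint, hval⟩ := integral_cubeChar_mul_gaussian T hc hT m (w m) (hw m)
    rw [← hval, UnitAddTorus.mFourierCoeff_eq_integral _ _ (fun _ => 0)]
    set FD := ZSpan.fundamentalDomain (Pi.basisFun ℝ ι) with hFD
    have hset : {x : ι → ℝ | ∀ i, x i ∈ Set.Ioc ((fun _ => 0 : ι → ℝ) i) ((fun _ => 0 : ι → ℝ) i + 1)}
        =ᵐ[volume] FD := by
      rw [hFD, ZSpan.fundamentalDomain_pi_basisFun]
      have h1 := Measure.univ_pi_Ico_ae_eq_Icc (μ := fun _ : ι => (volume : Measure ℝ))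
        (f := fun _ => 0) (g := fun _ => 1)
      have h2 := Measure.univ_pi_Ioc_ae_eq_Icc (μ := fun _ : ι => (volume : Measure ℝ))
        (f := fun _ => 0) (g := fun _ => 1)
      have h3 := h2.trans h1.symm
      have h4 : {x : ι → ℝ | ∀ i, x i ∈ Set.Ioc ((fun _ => 0 : ι → ℝ) i) ((fun _ => 0 : ι → ℝ) i + 1)}
          = Set.univ.pi fun _ => Set.Ioc (0 : ℝ) 1 := by
        ext x; simp [Set.mem_pi]
      rw [h4]
      exact h3
    have : VAddInvariantMeasure (stdLattice ι) (ι → ℝ) volume :=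
      inferInstanceAs (VAddInvariantMeasure (stdLattice ι).toAddSubgroup (ι → ℝ) volume)
    -- Unfolding: the integral over the whole space is the sum over the lattice of integrals over
    -- the unit cube, and the characters are 1 on the lattice.
    rw [setIntegral_congr_set hset,
      (ZSpan.isAddFundamentalDomain (Pi.basisFun ℝ ι) volume).integral_eq_tsum'' _ hint]
    set H : stdLattice ι → (ι → ℝ) → ℂ := fun z y => cubeChar (-m) y * (g (z + y) : ℂ) with hH
    have hHn : ∀ z y, ‖H z y‖ = g (z + y) := by
      intro z y
      rw [hH, norm_mul, norm_cubeChar, one_mul, Complex.norm_real,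
        Real.norm_of_nonneg (Real.exp_pos _).le]
    have h1 : ∀ (z : stdLattice ι) y, cubeChar (-m) (z +ᵥ y) *
        (Real.exp (-Real.pi * ‖T (z +ᵥ y)‖ ^ 2) : ℂ) = H z y := by
      intro z y
      have : z +ᵥ y = (z : ι → ℝ) + y := rfl
      rw [this, cubeChar_add, cubeChar_of_mem _ z.2, one_mul]
    simp_rw [h1]
    have h2 : ∀ y : ι → ℝ, UnitAddTorus.mFourier (-m) (fun i => (y i : UnitAddCircle)) •
        Ft (fun i => (y i : UnitAddCircle)) = ∑' z, H z y := by
      intro y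
      rw [mFourier_coe, hFt, ContinuousMap.coe_mk, hFlift, smul_eq_mul, hF, hH, tsum_mul_left,
        Complex.ofReal_tsum]
    simp_rw [h2]
    have hFDm : MeasurableSet FD := ZSpan.fundamentalDomain_measurableSet _
    have hFDv : volume FD = 1 := by
      rw [hFD, ZSpan.fundamentalDomain_pi_basisFun, Real.volume_pi_Ico]
      simp
    have hFDb : ∀ y ∈ FD, ‖y‖ ≤ 1 := by
      intro y hy
      rw [hFD, ZSpan.fundamentalDomain_pi_basisFun] at hy
      rw [pi_norm_le_iff_of_nonneg zero_le_one]
      intro i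
      have := hy i (Set.mem_univ i)
      rw [Real.norm_of_nonneg this.1]
      exact this.2.le
    have : IsFiniteMeasure (volume.restrict FD) := ⟨by simp [hFDv]⟩
    have hHb : ∀ z, ∀ᵐ y ∂(volume.restrict FD), ‖H z y‖ ≤ u 1 z := by
      intro z
      refine (ae_restrict_iff' hFDm).mpr (Filter.Eventually.of_forall fun y hy => ?_)
      rw [hHn]
      exact hule 1 z y (hFDb y hy)
    have hHi : ∀ z, Integrable (H z) (volume.restrict FD) := by
      intro z
      refine Integrable.of_bound (C := u 1 z) ?_ (hHb z)
      refine Continuous.aestronglyMeasurable ?_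
      rw [hH]
      exact (continuous_cubeChar _).mul (Complex.continuous_ofReal.comp (hgc.comp (by fun_prop)))
    refine (hasSum_integral_of_summable_integral_norm hHi ?_).tsum_eq.symm
    refine Summable.of_nonneg_of_le (fun z => integral_nonneg fun _ => norm_nonneg _)
      (fun z => ?_) (husum 1)
    refine (integral_mono_ae (hHi z).norm (integrable_const (u 1 z)) (hHb z)).trans ?_
    simp [Measure.real, hFDv]
  have hs : Summable (UnitAddTorus.mFourierCoeff Ft) := by
    rw [funext hcoef]
    exact (Complex.hasSum_ofReal (f := fun m => c * Real.exp (-Real.pi * ‖w m‖ ^ 2)).mpr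
      (hsum.mul_left c).hasSum).summable
  have := UnitAddTorus.hasSum_mFourier_series_apply_of_summable hs (fun i => (x i : UnitAddCircle))
  simp only [hcoef, mFourier_coe, smul_eq_mul] at this
  convert this using 1
  rw [hFt, ContinuousMap.coe_mk, hFlift]

end Poisson

end

noncomputable section

/-! ### Poisson summation over lattices in inner product spaces -/

section LatticePoisson

open MeasureTheory

variable {E : Type*} [NormedAddCommGroup E] [InnerProductSpace ℝ E]

theorem nondegenerate_innerₗ : (innerₗ E : LinearMap.BilinForm ℝ E).Nondegenerate := by
  refine ⟨fun x hx => ?_, fun x hx => ?_⟩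
  · have := hx x; simpa using this
  · have := hx x; simpa using this

/-- The dual of a lattice in an inner product space. -/
abbrev innerDual (L : Submodule ℤ E) : Submodule ℤ E :=
  LinearMap.BilinForm.dualSubmodule (innerₗ E) L

theorem mem_innerDual {L : Submodule ℤ E} {y : E} :
    y ∈ innerDual L ↔ ∀ x ∈ L, ∃ k : ℤ, (k : ℝ) = inner ℝ y x := by
  rw [LinearMap.BilinForm.mem_dualSubmodule]
  refine forall₂_congr fun x _ => ?_
  rw [Submodule.mem_one]
  simp

variable [FiniteDimensional ℝ E] (L : Submodule ℤ E) [DiscreteTopology L]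

/-- An invertible map is bounded below, so the sum is dominated by one for a round Gaussian. -/
theorem gaussian_summable_comp (S : E ≃ₗ[ℝ] E) (v : E) :
    Summable fun x : L => Real.exp (-Real.pi * ‖S (x + v)‖ ^ 2) := by
  have h1 : ∃ κ : ℝ, 0 < κ ∧ ∀ x, κ * ‖x‖ ^ 2 ≤ ‖S x‖ ^ 2 := by
    set C := ‖(S.symm.toContinuousLinearEquiv : E →L[ℝ] E)‖ + 1
    have hC : 0 < C := by positivity
    refine ⟨(C ^ 2)⁻¹, by positivity, fun x => ?_⟩
    have h1 : ‖x‖ ≤ C * ‖S x‖ := by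
      have := (S.symm.toContinuousLinearEquiv : E →L[ℝ] E).le_opNorm (S x)
      simp only [ContinuousLinearEquiv.coe_coe, LinearEquiv.coe_toContinuousLinearEquiv',
        LinearEquiv.symm_apply_apply] at this
      refine this.trans (mul_le_mul_of_nonneg_right (by simp [C]) (norm_nonneg _))
    rw [inv_mul_le_iff₀ (by positivity), ← mul_pow]
    exact pow_le_pow_left₀ (norm_nonneg _) h1 2
  obtain ⟨κ, hκ, hκS⟩ := h1
  refine Summable.of_nonneg_of_le (fun _ => (Real.exp_pos _).le) (fun x => ?_)
    (summable_exp_neg_norm_add_sq L (mul_pos Real.pi_pos hκ) v)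
  rw [Real.exp_le_exp]
  nlinarith [hκS (x + v), Real.pi_pos]

variable [IsZLattice ℝ L]

theorem exists_basis_innerDual : ∃ (n : ℕ) (b d : Module.Basis (Fin n) ℝ E),
    L = Submodule.span ℤ (Set.range b) ∧ innerDual L = Submodule.span ℤ (Set.range d) ∧
    ∀ i j, inner ℝ (d i) (b j) = if j = i then 1 else 0 := by
  classical
  set b₀ := Module.finBasis ℤ L
  set b := b₀.ofZLatticeBasis ℝ L with hb
  have hL : Submodule.span ℤ (Set.range b) = L := b₀.ofZLatticeBasis_span ℝ
  refine ⟨_, b, LinearMap.BilinForm.dualBasis (innerₗ E) nondegenerate_innerₗ b, hL.symm, ?_,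
    fun i j => ?_⟩
  · have := LinearMap.BilinForm.dualSubmodule_span_of_basis (R := ℤ) (innerₗ E)
      nondegenerate_innerₗ b
    rw [← this, hL]
  · have := LinearMap.BilinForm.apply_dualBasis_left (hB := nondegenerate_innerₗ (E := E)) b i j
    rw [← this]; rfl

instance instDiscreteTopologyInnerDual : DiscreteTopology (innerDual L) := by
  obtain ⟨n, b, d, -, hd, -⟩ := exists_basis_innerDual L
  rw [hd]; infer_instance

/-- **Poisson summation** for a Gaussian over a lattice, in the shape given by a self-adjoint
linear map. -/
theorem lattice_poisson : ∃ c : ℝ, 0 < c ∧ ∀ S : E ≃ₗ[ℝ] E,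
    (∀ x y, inner ℝ (S x) y = inner ℝ x (S y)) → ∀ v : E,
    HasSum (fun y : innerDual L => c / |LinearMap.det (S : E →ₗ[ℝ] E)| *
        Real.exp (-Real.pi * ‖S.symm y‖ ^ 2) * Real.cos (2 * Real.pi * inner ℝ (y : E) v))
      (∑' x : L, Real.exp (-Real.pi * ‖S (x + v)‖ ^ 2)) := by
  classical
  borelize E
  obtain ⟨n, b, d, hL, hd, hdb⟩ := exists_basis_innerDual L
  set T₀ : (Fin n → ℝ) ≃L[ℝ] E := b.equivFunL.symm with hT₀
  have hT₀a : ∀ x, T₀ x = ∑ i, x i • b i := fun x => by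
    exact b.equivFun_symm_apply x
  obtain ⟨c, hc, hcT⟩ : ∃ c : ℝ, 0 < c ∧
      Measure.map T₀ volume = ENNReal.ofReal c • (volume : Measure E) := by
    have := T₀.isAddHaarMeasure_map (volume : Measure (Fin n → ℝ))
    have h1 := Measure.isAddLeftInvariant_eq_smul (Measure.map T₀ volume) (volume : Measure E)
    refine ⟨Measure.addHaarScalarFactor (Measure.map T₀ volume) (volume : Measure E), ?_, ?_⟩
    · exact_mod_cast Measure.addHaarScalarFactor_pos_of_isAddHaarMeasure _ _
    · rw [ENNReal.ofReal_coe_nnreal]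
      exact h1
  -- The constant is the inverse covolume of `L`. It is fixed before `S`, so that sums for different
  -- maps can be compared.
  refine ⟨c, hc, fun S hS v => ?_⟩
  have hdet : LinearMap.det (S : E →ₗ[ℝ] E) ≠ 0 := S.isUnit_det'.ne_zero
  set T : (Fin n → ℝ) ≃L[ℝ] E := T₀.trans S.toContinuousLinearEquiv with hT
  have hTa : ∀ x, T x = S (T₀ x) := fun x => rfl
  have hcT' : Measure.map T volume =
      ENNReal.ofReal (c / |LinearMap.det (S : E →ₗ[ℝ] E)|) • (volume : Measure E) := by
    have h1 : (T : (Fin n → ℝ) → E) = (S : E →ₗ[ℝ] E) ∘ T₀ := rfl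
    rw [h1, ← Measure.map_map, hcT, Measure.map_smul,
      Measure.map_linearMap_addHaar_eq_smul_addHaar _ hdet, smul_smul, ← ENNReal.ofReal_mul hc.le,
      abs_inv, div_eq_mul_inv]
    · exact (LinearMap.continuous_of_finiteDimensional _).measurable
    · exact T₀.continuous.measurable
  set w : (Fin n → ℤ) → E := fun m => ∑ i, m i • d i with hw
  have hwin : ∀ m x, inner ℝ (w m) (T₀ x) = ∑ i, m i * x i := by
    intro m x
    rw [hT₀a, hw, sum_inner]
    refine Finset.sum_congr rfl fun i _ => ?_
    rw [inner_sum, ← Int.cast_smul_eq_zsmul ℝ, Finset.sum_eq_single i]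
    · rw [inner_smul_left, inner_smul_right, hdb, if_pos rfl]; simp
    · intro j _ hj
      rw [inner_smul_left, inner_smul_right, hdb, if_neg hj]; simp
    · simp
  -- reindexing of the two lattices
  have hwbij : Function.Bijective (fun m => (⟨w m, by
      rw [hd]
      exact Submodule.sum_mem _ fun i _ => Submodule.smul_mem _ _
        (Submodule.subset_span ⟨i, rfl⟩)⟩ : innerDual L)) := by
    constructor
    · intro m m' h
      have h1 : w m = w m' := congrArg Subtype.val h
      funext i
      have h2 := hwin m (Pi.single i 1)
      rw [h1, hwin] at h2
      simp only [Pi.single_apply, mul_ite, mul_one, mul_zero, Finset.sum_ite_eq', Finset.mem_univ, if_true] at h2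
      exact_mod_cast h2.symm
    · rintro ⟨y, hy⟩
      rw [hd, Module.Basis.mem_span_iff_repr_mem] at hy
      choose m hm using hy
      refine ⟨m, Subtype.ext ?_⟩
      simp only [hw]
      conv_rhs => rw [← d.sum_repr y]
      refine Finset.sum_congr rfl fun i _ => ?_
      rw [← hm, ← Int.cast_smul_eq_zsmul ℝ]
      rfl
  have hTmem : ∀ x : Fin n → ℝ, x ∈ stdLattice (Fin n) ↔ T₀ x ∈ L := by
    intro x
    rw [mem_stdLattice]
    rw [hL, Module.Basis.mem_span_iff_repr_mem]
    refine forall_congr' fun i => ?_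
    have : b.repr (T₀ x) i = x i := by
      have := congrFun (b.equivFunL.apply_symm_apply x) i
      exact this
    rw [this]; rfl
  set eL : stdLattice (Fin n) ≃ L := T₀.toEquiv.subtypeEquiv hTmem with heL
  set eD := Equiv.ofBijective _ hwbij with heD
  have hsum : Summable fun m => Real.exp (-Real.pi * ‖S.symm (w m)‖ ^ 2) := by
    have := gaussian_summable_comp (innerDual L) S.symm 0
    simp only [add_zero] at this
    exact eD.summable_iff.mpr this
  -- Self-adjointness enters here: the dual vectors that belong to `T` arise from those of `T₀` by
  -- the inverse of `S`.
  have key := gaussian_poisson T (c := c / |LinearMap.det (S : E →ₗ[ℝ] E)|) (by positivity) hcT'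
    (fun m => S.symm (w m)) (fun m x => by
      rw [hTa, ← hS, LinearEquiv.apply_symm_apply, hwin]) hsum (T₀.symm v)
  have key2 := Complex.reCLM.hasSum key
  simp only [Complex.reCLM_apply, Complex.ofReal_re] at key2
  rw [← eD.hasSum_iff]
  convert key2 using 1
  · funext m
    simp only [Function.comp_apply, Complex.re_ofReal_mul, cubeChar, Complex.exp_ofReal_mul_I_re]
    rw [← hwin m (T₀.symm v), ContinuousLinearEquiv.apply_symm_apply]
    rfl
  · rw [← eL.tsum_eq]
    refine tsum_congr fun z => ?_
    rw [hTa, map_add T₀, ContinuousLinearEquiv.apply_symm_apply]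
    rfl

/-- Translating a lattice does not increase its Gaussian mass. -/
theorem tsum_gaussian_add_le (S : E ≃ₗ[ℝ] E) (hS : ∀ x y, inner ℝ (S x) y = inner ℝ x (S y))
    (v : E) : ∑' x : L, Real.exp (-Real.pi * ‖S (x + v)‖ ^ 2) ≤
      ∑' x : L, Real.exp (-Real.pi * ‖S x‖ ^ 2) := by
  obtain ⟨c, hc, h⟩ := lattice_poisson L
  have h0 := h S hS 0
  simp only [add_zero, inner_zero_right, mul_zero, Real.cos_zero, mul_one] at h0
  -- The coefficients of the dual series are nonnegative, and a translation only inserts cosines.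
  refine hasSum_le (fun y => ?_) (h S hS v) h0
  exact mul_le_of_le_one_right (by positivity) (Real.cos_le_one _)

end LatticePoisson

end

noncomputable section

/-! ### Cosets of discrete subgroups -/

section Coset

variable {E : Type*} [NormedAddCommGroup E] [InnerProductSpace ℝ E] [FiniteDimensional ℝ E]

/-- Translating a discrete subgroup does not increase its Gaussian mass. -/
theorem tsum_exp_neg_norm_add_sq_le (L : Submodule ℤ E) [DiscreteTopology L] {a : ℝ} (ha : 0 < a)
    (p : E) : ∑' x : L, Real.exp (-a * ‖(x : E) + p‖ ^ 2) ≤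
      ∑' x : L, Real.exp (-a * ‖(x : E)‖ ^ 2) := by
  -- In its real span the subgroup is a full lattice. The vector `p` may be replaced by its
  -- projection to the span, because orthogonal projection shortens x + p.
  set F := Submodule.span ℝ (L : Set E) with hF
  set L₀ : Submodule ℤ F := L.comap (F.subtype.restrictScalars ℤ) with hL₀
  have hdisc : DiscreteTopology L₀ :=
    DiscreteTopology.preimage_of_continuous_injective (L : Set E)
      (LinearMap.continuous_of_finiteDimensional F.subtype) (Submodule.injective_subtype _)
  have h_img : F.subtype '' L₀ = L := by
    rw [← LinearMap.coe_restrictScalars ℤ F.subtype, ← Submodule.map_coe (F.subtype.restrictScalars ℤ),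
      Submodule.map_comap_eq_self]
    exact fun x hx ↦ LinearMap.mem_range.mpr ⟨⟨x, Submodule.subset_span hx⟩, rfl⟩
  have hlat : IsZLattice ℝ L₀ := ⟨by
    rw [← (Submodule.map_injective_of_injective (Submodule.injective_subtype F)).eq_iff,
      Submodule.map_span, Submodule.map_top, Submodule.range_subtype, h_img]⟩
  set e : L₀ ≃ L := ⟨fun x => ⟨x.1, x.2⟩, fun x => ⟨⟨x.1, Submodule.subset_span x.2⟩, x.2⟩,
    fun _ => rfl, fun _ => rfl⟩ with he
  have hpi : (0 : ℝ) < a / Real.pi := div_pos ha Real.pi_pos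
  set t := √(a / Real.pi) with ht
  have ht2 : Real.pi * t ^ 2 = a := by
    rw [ht, Real.sq_sqrt hpi.le]; field_simp
  have ht0 : t ≠ 0 := (Real.sqrt_pos.mpr hpi).ne'
  set S : F ≃ₗ[ℝ] F := LinearEquiv.smulOfNeZero ℝ F t ht0
  have hS : ∀ x, Real.exp (-Real.pi * ‖S x‖ ^ 2) = Real.exp (-a * ‖(x : E)‖ ^ 2) := by
    intro x
    have : S x = t • x := rfl
    rw [this, norm_smul, mul_pow, Real.norm_eq_abs, sq_abs, ← ht2]
    congr 1
    simp only [Submodule.coe_norm]; ring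
  have key := tsum_gaussian_add_le L₀ S (fun x y => by
    have : ∀ x, S x = t • x := fun _ => rfl
    rw [this, this, inner_smul_left, inner_smul_right]; rfl) (F.orthogonalProjectionOnto p)
  simp only [hS] at key
  rw [← e.tsum_eq, ← e.tsum_eq]
  refine le_trans ?_ key
  refine Summable.tsum_le_tsum (fun x => ?_) ?_ ?_
  · rw [Real.exp_le_exp]
    have h1 : ‖((x : F) + F.orthogonalProjectionOnto p : F)‖ ≤ ‖((x : F) : E) + p‖ := by
      have h2 : (x : F) + F.orthogonalProjectionOnto p = F.orthogonalProjectionOnto (((x : F) : E) + p) := by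
        rw [map_add, Submodule.orthogonalProjectionOnto_mem_subspace_eq_self]
      rw [h2]
      exact F.norm_orthogonalProjectionOnto_apply_le _
    have h3 := pow_le_pow_left₀ (norm_nonneg _) h1 2
    simp only [he, Equiv.coe_fn_mk]
    rw [Submodule.coe_norm] at h3
    nlinarith
  · exact (e.summable_iff (f := fun x : L => Real.exp (-a * ‖(x : E) + p‖ ^ 2))).mpr
      (summable_exp_neg_norm_add_sq L ha p)
  · exact summable_exp_neg_norm_add_sq L₀ ha (F.orthogonalProjectionOnto p)

/-- The part of a Gaussian sum over the points with `⟪y, v⟫ ≠ 0` is small. -/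
theorem tsum_inner_ne_zero_le (L : Submodule ℤ E) [DiscreteTopology L] {a : ℝ} (ha : 0 < a)
    {v : E} (hv : v ≠ 0) (hint : ∀ y ∈ L, ∃ k : ℤ, (k : ℝ) = inner ℝ y v) :
    ∑' y : {y : L // inner ℝ (y : E) v ≠ 0}, Real.exp (-a * ‖((y : L) : E)‖ ^ 2) ≤
      2 * Real.exp (-a / ‖v‖ ^ 2) * ∑' y : L, Real.exp (-a * ‖(y : E)‖ ^ 2) := by
  classical
  have hv0 : 0 < ‖v‖ := norm_pos_iff.mpr hv
  choose h hh using fun y : L => hint y y.2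
  set g : L → ℝ := fun y => Real.exp (-a * ‖(y : E)‖ ^ 2) with hg
  have hgs : Summable g := summable_exp_neg_norm_sq L ha
  set q := Real.exp (-a / ‖v‖ ^ 2) with hq
  have hq0 : 0 < q := Real.exp_pos _
  have hq1 : q < 1 := by
    rw [hq, Real.exp_lt_one_iff]
    exact div_neg_of_neg_of_pos (by linarith) (by positivity)
  have hhadd : ∀ y z : L, h (y + z) = h y + h z := by
    intro y z
    have : ((h (y + z) : ℤ) : ℝ) = h y + h z := by
      rw [hh, hh, hh, Submodule.coe_add, inner_add_left]
    exact_mod_cast this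
  set s : ℤ → ℝ := fun j => ∑' y : {y : L // h y = j}, g y with hs
  have hs0 : ∀ j, 0 ≤ s j := fun j => tsum_nonneg fun _ => (Real.exp_pos _).le
  -- slices
  have hslice : ∀ j, s j ≤ q ^ (j.natAbs) * s 0 := by
    intro j
    by_cases hne : ∃ y, h y = j
    · obtain ⟨y₀, hy₀⟩ := hne
      set L₁ : Submodule ℤ E :=
        { carrier := {y | y ∈ L ∧ inner ℝ y v = 0}
          add_mem' := fun {x y} hx hy => ⟨L.add_mem hx.1 hy.1, by rw [inner_add_left, hx.2, hy.2, add_zero]⟩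
          zero_mem' := ⟨L.zero_mem, inner_zero_left _⟩
          smul_mem' := fun c x hx => ⟨L.smul_mem c hx.1, by
            rw [← Int.cast_smul_eq_zsmul ℝ, inner_smul_left, hx.2, mul_zero]⟩ } with hL₁
      have hdisc : DiscreteTopology L₁ := by
        have hle : L₁ ≤ L := fun x hx => hx.1
        exact DiscreteTopology.of_subset (s := (L : Set E)) (t := (L₁ : Set E)) inferInstance hle
      have hL₁h : ∀ y : L, h y = 0 ↔ (y : E) ∈ L₁ := by
        intro y
        have : (y : E) ∈ L₁ ↔ (y : E) ∈ L ∧ inner ℝ (y : E) v = 0 := Iff.rfl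
        rw [this, ← hh y]
        simp
      set e0 : L₁ ≃ {y : L // h y = 0} :=
        ⟨fun x => ⟨⟨x.1, x.2.1⟩, (hL₁h _).mpr x.2⟩, fun y => ⟨y.1.1, (hL₁h _).mp y.2⟩,
          fun _ => rfl, fun _ => rfl⟩ with he0
      set ej : {y : L // h y = 0} ≃ {y : L // h y = j} :=
        ⟨fun y => ⟨y.1 + y₀, by rw [hhadd, y.2, hy₀, zero_add]⟩,
          fun y => ⟨y.1 - y₀, by
            have := hhadd (y.1 - y₀) y₀
            rw [sub_add_cancel, y.2, hy₀] at this
            linarith⟩,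
          fun y => by simp, fun y => by simp⟩ with hej
      -- `p` is the component of `y₀` orthogonal to `v`. Slice j is slice 0 shifted by `p` within
      -- the hyperplane and then moved by |j| / ‖v‖ in the direction of `v`.
      set p : E := (y₀ : E) - ((j : ℝ) / ‖v‖ ^ 2) • v with hp
      have hpv : inner ℝ p v = 0 := by
        rw [hp, inner_sub_left, inner_smul_left, ← hh, hy₀, real_inner_self_eq_norm_sq]
        simp only [conj_trivial]
        field_simp
        ring
      have hnorm : ∀ x : L₁, ‖(x : E) + y₀‖ ^ 2 = ‖(x : E) + p‖ ^ 2 + (j : ℝ) ^ 2 / ‖v‖ ^ 2 := by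
        intro x
        have h1 : (x : E) + y₀ = ((x : E) + p) + ((j : ℝ) / ‖v‖ ^ 2) • v := by rw [hp]; abel
        have h2 : inner ℝ ((x : E) + p) (((j : ℝ) / ‖v‖ ^ 2) • v) = 0 := by
          rw [inner_smul_right, inner_add_left, x.2.2, hpv]; simp
        rw [h1, sq, norm_add_sq_eq_norm_sq_add_norm_sq_of_inner_eq_zero _ _ h2, ← sq, ← sq,
          norm_smul, mul_pow, Real.norm_eq_abs, sq_abs]
        congr 1
        field_simp
      have h1 : s j = Real.exp (-a / ‖v‖ ^ 2 * (j : ℝ) ^ 2) *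
          ∑' x : L₁, Real.exp (-a * ‖(x : E) + p‖ ^ 2) := by
        rw [hs, ← tsum_mul_left]
        simp only
        rw [← ej.tsum_eq, ← e0.tsum_eq]
        refine tsum_congr fun x => ?_
        have : g ((ej (e0 x) : {y : L // h y = j}) : L) = Real.exp (-a * ‖(x : E) + y₀‖ ^ 2) := rfl
        rw [this, hnorm, ← Real.exp_add]
        congr 1
        ring
      have h2 : s 0 = ∑' x : L₁, Real.exp (-a * ‖(x : E)‖ ^ 2) := by
        rw [hs]
        simp only
        rw [← e0.tsum_eq]
        rfl
      rw [h1, h2]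
      refine mul_le_mul ?_ (tsum_exp_neg_norm_add_sq_le L₁ ha p)
        (tsum_nonneg fun _ => (Real.exp_pos _).le) (by positivity)
      rw [hq, ← Real.exp_nat_mul, Real.exp_le_exp]
      -- Weakening j² to |j| leaves a geometric series, which is all that is needed.
      have h3 : (j.natAbs : ℝ) ≤ (j : ℝ) ^ 2 := by
        have : ((j.natAbs : ℤ) : ℝ) ≤ ((j ^ 2 : ℤ) : ℝ) := by
          rw [Int.cast_le, ← Int.natAbs_sq j, sq]
          exact_mod_cast Nat.le_mul_self _
        simpa using this
      have h4 : 0 ≤ a / ‖v‖ ^ 2 := by positivity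
      have h5 : -a / ‖v‖ ^ 2 = -(a / ‖v‖ ^ 2) := neg_div _ _
      rw [h5]
      nlinarith
    · have : IsEmpty {y : L // h y = j} := ⟨fun y => hne ⟨y.1, y.2⟩⟩
      have h1 : s j = 0 := by rw [hs]; exact tsum_empty
      rw [h1]
      exact mul_nonneg (by positivity) (hs0 0)
  have htot : HasSum s (∑' y, g y) := by
    have h1 : HasSum (fun x : Σ j, {y : L // h y = j} => g x.2) (∑' y, g y) :=
      (Equiv.sigmaFiberEquiv h).hasSum_iff.mpr hgs.hasSum
    exact h1.sigma fun j => (hgs.subtype {y | h y = j}).hasSum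
  -- the part outside the slice `0`
  set X := ∑' y : {y : L // inner ℝ (y : E) v ≠ 0}, g y with hX
  have hsplit : s 0 + X = ∑' y, g y := by
    have h1 := Summable.tsum_add_tsum_compl (s := {y : L | h y = 0}) (f := g) (hgs.subtype _)
      (hgs.subtype _)
    rw [← h1]
    congr 1
    have h2 : {y : L | h y = 0}ᶜ = {y : L | inner ℝ (y : E) v ≠ 0} := by
      ext y
      simp [← hh]
    rw [h2]
    rfl
  have hgeo : HasSum (fun j : ℤ => if j = 0 then 0 else q ^ j.natAbs * s 0)
      (2 * (q / (1 - q)) * s 0) := by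
    have h1 : HasSum (fun n : ℕ => q ^ (n + 1) * s 0) (q / (1 - q) * s 0) := by
      have := (hasSum_geometric_of_lt_one hq0.le hq1).mul_left q
      simp_rw [← pow_succ'] at this
      rw [← div_eq_mul_inv] at this
      exact this.mul_right _
    have h2 : HasSum (fun n : ℕ => if (n : ℤ) = 0 then 0 else q ^ (n : ℤ).natAbs * s 0)
        (q / (1 - q) * s 0) := by
      rw [← hasSum_nat_add_iff' 1]
      have e1 : ∀ n : ℕ, (n : ℤ) + 1 ≠ 0 := fun n => by omega
      have e2 : ∀ n : ℕ, ((n : ℤ) + 1).natAbs = n + 1 := fun n => by omega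
      simpa [e1, e2] using h1
    have h3 := HasSum.of_nat_of_neg_add_one (f := fun j : ℤ => if j = 0 then 0 else q ^ j.natAbs * s 0)
      h2 (m' := q / (1 - q) * s 0) (by
        convert h1 using 2 with n
        have e1 : -((n : ℤ) + 1) ≠ 0 := by omega
        have e2 : (-((n : ℤ) + 1)).natAbs = n + 1 := by omega
        rw [if_neg e1, e2])
    convert h3 using 1
    ring
  have hle : (∑' y, g y) - s 0 ≤ 2 * (q / (1 - q)) * s 0 := by
    refine hasSum_le (fun j => ?_) (hasSum_ite_sub_hasSum htot 0) hgeo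
    by_cases hj : j = 0
    · simp [hj]
    · simpa [hj] using hslice j
  have h1q : 0 < 1 - q := by linarith
  -- This gives X ≤ 2q s₀ + qX ≤ 2q (s₀ + X), so the denominator 1 - q disappears from the final
  -- bound.
  have hX : X * (1 - q) ≤ 2 * q * s 0 := by
    have : X ≤ 2 * (q / (1 - q)) * s 0 := by linarith
    calc X * (1 - q) ≤ 2 * (q / (1 - q)) * s 0 * (1 - q) := by gcongr
      _ = 2 * q * s 0 := by field_simp
  have hX0 : 0 ≤ X := tsum_nonneg fun _ => (Real.exp_pos _).le
  change X ≤ 2 * q * ∑' y, g y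
  nlinarith

end Coset

end

noncomputable section

/-! ### Gaussian masses and the smoothing parameter -/

section Smoothing

variable {n : ℕ}

theorem gaussian_eq (s : ℝ) (x : Euc n) : gaussian s x = Real.exp (-(Real.pi / s ^ 2) * ‖x‖ ^ 2) := by
  rw [gaussian, norm_smul, mul_pow, norm_inv, inv_pow, Real.norm_eq_abs, sq_abs]
  congr 1
  ring

theorem gaussian_pos (s : ℝ) (x : Euc n) : 0 < gaussian s x := Real.exp_pos _

theorem gaussian_zero (s : ℝ) : gaussian s (0 : Euc n) = 1 := by simp [gaussian]

theorem gaussian_mono {s t : ℝ} (hs : 0 < s) (hst : s ≤ t) (x : Euc n) :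
    gaussian s x ≤ gaussian t x := by
  rw [gaussian_eq, gaussian_eq, Real.exp_le_exp]
  have : Real.pi / t ^ 2 ≤ Real.pi / s ^ 2 :=
    div_le_div_of_nonneg_left Real.pi_pos.le (by positivity) (by gcongr)
  nlinarith [sq_nonneg ‖x‖]

attribute [local irreducible] gaussian

variable (L : Submodule ℤ (Euc n)) [DiscreteTopology L]

theorem summable_gaussian {s : ℝ} (hs : 0 < s) : Summable fun x : L => gaussian s (x : Euc n) := by
  simp_rw [gaussian_eq]
  exact summable_exp_neg_norm_sq L (div_pos Real.pi_pos (by positivity))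

theorem gaussianMass_pos {s : ℝ} (hs : 0 < s) : 0 < gaussianMass s (L : Set (Euc n)) :=
  (summable_gaussian L hs).tsum_pos (fun _ => (gaussian_pos _ _).le) 0 (gaussian_pos _ _)

theorem summable_gaussian_diff {s : ℝ} (hs : 0 < s) :
    Summable fun x : ((L : Set (Euc n)) \ {0} : Set (Euc n)) => gaussian s (x : Euc n) := by
  have hinj : Function.Injective
      (fun x : ((L : Set (Euc n)) \ {0} : Set (Euc n)) => (⟨x.1, x.2.1⟩ : L)) :=
    fun x y h => Subtype.ext (congrArg (fun z : L => (z : Euc n)) h)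
  exact (summable_gaussian L hs).comp_injective hinj

theorem gaussianMass_eq_one_add {s : ℝ} (hs : 0 < s) : gaussianMass s (L : Set (Euc n)) =
    1 + gaussianMass s ((L : Set (Euc n)) \ {0}) := by
  have h1 := (summable_gaussian L hs).tsum_eq_add_tsum_ite 0
  rw [gaussianMass, gaussianMass]
  refine h1.trans ?_
  rw [ZeroMemClass.coe_zero, gaussian_zero]
  congr 1
  have hinj : Function.Injective
      (fun x : ((L : Set (Euc n)) \ {0} : Set (Euc n)) => (⟨x.1, x.2.1⟩ : L)) :=
    fun x y h => Subtype.ext (congrArg (fun z : L => (z : Euc n)) h)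
  rw [← hinj.tsum_eq]
  · refine tsum_congr fun x => ?_
    rw [if_neg]
    intro h
    exact x.2.2 (congrArg (fun z : L => (z : Euc n)) h)
  · intro x hx
    have hx0 : x ≠ 0 := by
      rintro rfl; simp at hx
    exact ⟨⟨x, x.2, fun h => hx0 (Subtype.ext h)⟩, rfl⟩

theorem gaussianMass_diff_nonneg (s : ℝ) (A : Set (Euc n)) : 0 ≤ gaussianMass s A :=
  tsum_nonneg fun _ => (gaussian_pos _ _).le

theorem gaussianMass_diff_mono {s t : ℝ} (hs : 0 < s) (hst : s ≤ t) :
    gaussianMass s ((L : Set (Euc n)) \ {0}) ≤ gaussianMass t ((L : Set (Euc n)) \ {0}) :=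
  (summable_gaussian_diff L hs).tsum_le_tsum (fun x => gaussian_mono hs hst (x : Euc n))
    (summable_gaussian_diff L (hs.trans_le hst))

/-- Scaling by `r⁻¹`, followed by stretching by `t` in the direction of the unit vector `u`. -/
theorem exists_stretch (u : Euc n) (hu : ‖u‖ = 1) {r t : ℝ} (hr : r ≠ 0) (ht : t ≠ 0) :
    ∃ S : Euc n ≃ₗ[ℝ] Euc n, (∀ x y, inner ℝ (S x) y = inner ℝ x (S y)) ∧
      LinearMap.det (S : Euc n →ₗ[ℝ] Euc n) = (r⁻¹) ^ n * t ∧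
      (∀ x, ‖S x‖ ^ 2 = (r⁻¹) ^ 2 * (‖x‖ ^ 2 + (t ^ 2 - 1) * (inner ℝ u x) ^ 2)) ∧
      (∀ x, ‖S.symm x‖ ^ 2 = r ^ 2 * (‖x‖ ^ 2 + (t⁻¹ ^ 2 - 1) * (inner ℝ u x) ^ 2)) := by
  have huu : inner ℝ u u = 1 := by rw [real_inner_self_eq_norm_sq, hu, one_pow]
  -- `A c` multiplies the direction `u` by `c` and fixes its orthogonal complement. Written as a
  -- transvection, its determinant is immediate.
  set A : ℝ → Euc n →ₗ[ℝ] Euc n := fun c => LinearMap.transvection (innerₗ (Euc n) u) ((c - 1) • u)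
  have hA : ∀ c x, A c x = x + inner ℝ u x • (c - 1) • u := fun c x => rfl
  have hAA : ∀ c, c ≠ 0 → ∀ x, A c (A c⁻¹ x) = x := by
    intro c hc x
    rw [hA, hA, inner_add_right, inner_smul_right, inner_smul_right, huu, add_assoc, smul_smul,
      smul_smul, ← add_smul]
    have : inner ℝ u x * (c⁻¹ - 1) + (inner ℝ u x + inner ℝ u x * ((c⁻¹ - 1) * 1)) * (c - 1) = 0 := by
      field_simp; ring
    rw [this, zero_smul, add_zero]
  have hn : ∀ c x, ‖A c x‖ ^ 2 = ‖x‖ ^ 2 + (c ^ 2 - 1) * (inner ℝ u x) ^ 2 := by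
    intro c x
    rw [hA, norm_add_sq_real, smul_smul, inner_smul_right, norm_smul, hu, mul_one,
      Real.norm_eq_abs, sq_abs, real_inner_comm]
    ring
  set f : Euc n →ₗ[ℝ] Euc n := r⁻¹ • A t with hf
  set g : Euc n →ₗ[ℝ] Euc n := r • A t⁻¹ with hg
  refine ⟨LinearEquiv.ofLinearMap f g ?_ ?_, ?_, ?_, ?_, ?_⟩
  · ext1 x
    simp only [hf, hg, LinearMap.comp_apply, LinearMap.smul_apply, map_smul, LinearMap.id_apply]
    rw [hAA t ht, smul_smul, mul_inv_cancel₀ hr, one_smul]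
  · ext1 x
    simp only [hf, hg, LinearMap.comp_apply, LinearMap.smul_apply, map_smul, LinearMap.id_apply]
    have := hAA t⁻¹ (inv_ne_zero ht) x
    rw [inv_inv] at this
    rw [this, smul_smul, inv_mul_cancel₀ hr, one_smul]
  · intro x y
    change inner ℝ (r⁻¹ • A t x) y = inner ℝ x (r⁻¹ • A t y)
    rw [inner_smul_left, inner_smul_right, hA, hA, inner_add_left, inner_add_right,
      inner_smul_left, inner_smul_left, inner_smul_right, inner_smul_right, real_inner_comm u x]
    simp only [conj_trivial]
    ring
  · change LinearMap.det (r⁻¹ • A t) = _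
    rw [LinearMap.det_smul, LinearMap.transvection.det]
    have : (innerₗ (Euc n)) u ((t - 1) • u) = t - 1 := by
      change inner ℝ u ((t - 1) • u) = _
      rw [inner_smul_right, huu, mul_one]
    rw [this, finrank_euclideanSpace_fin]
    ring
  · intro x
    change ‖r⁻¹ • A t x‖ ^ 2 = _
    rw [norm_smul, mul_pow, hn, Real.norm_eq_abs, sq_abs]
  · intro x
    change ‖r • A t⁻¹ x‖ ^ 2 = _
    rw [norm_smul, mul_pow, hn, Real.norm_eq_abs, sq_abs]

variable [IsZLattice ℝ L]

instance : DiscreteTopology (dualLattice L) := instDiscreteTopologyInnerDual L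

/-- Poisson summation for `ρ_r` and for its stretch along a unit vector. -/
theorem exists_gaussianMass_eq (hn : 0 < n) : ∃ c : ℝ, 0 < c ∧
    (∀ r, 0 < r → gaussianMass r (L : Set (Euc n)) =
      c * r ^ n * gaussianMass (1 / r) (dualLattice L : Set (Euc n))) ∧
    (∀ r, 0 < r → ∀ u : Euc n, ‖u‖ = 1 →
      ∑' x : {x : L // inner ℝ u (x : Euc n) = 0}, gaussian r (x : Euc n) ≤
        c * r ^ n / √2 * gaussianMass (1 / (r / √2)) (dualLattice L : Set (Euc n))) := by
  obtain ⟨c, hc, h⟩ := lattice_poisson L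
  have h2 : (0 : ℝ) < √2 := by positivity
  have h22 : √2 ^ 2 = (2 : ℝ) := Real.sq_sqrt zero_le_two
  refine ⟨c, hc, fun r hr => ?_, fun r hr u hu => ?_⟩
  · set u : Euc n := EuclideanSpace.single ⟨0, hn⟩ 1 with hu
    -- With stretch factor 1 the map is the scaling by r⁻¹, and the choice of `u` is immaterial.
    obtain ⟨S, hS, hdet, hn1, hn2⟩ := exists_stretch u (by simp [hu]) hr.ne' one_ne_zero
    have h1 := h S hS 0
    simp only [inner_zero_right, mul_zero, Real.cos_zero, mul_one, add_zero, hn1, hn2, hdet] at h1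
    have h3 := h1.tsum_eq
    rw [tsum_mul_left] at h3
    rw [gaussianMass, gaussianMass]
    convert h3.symm using 1
    · refine tsum_congr fun x => ?_
      rw [gaussian_eq]
      congr 1
      field_simp
      ring
    · congr 1
      · rw [abs_of_pos (by positivity), inv_pow]
        field_simp
      · refine tsum_congr fun x => ?_
        rw [gaussian_eq]
        congr 1
        field_simp
        ring
  -- With factor √2 the stretched Gaussian is ρ_r(x) exp(-π⟪u, x⟫²/r²), which agrees with ρ_r on the
  -- hyperplane. The gain 1/√2 comes from the determinant.
  · obtain ⟨S, hS, hdet, hn1, hn2⟩ := exists_stretch u hu hr.ne' h2.ne'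
    have h1 := h S hS 0
    simp only [inner_zero_right, mul_zero, Real.cos_zero, mul_one, add_zero, hdet] at h1
    have h3 := h1.tsum_eq
    rw [tsum_mul_left, abs_of_pos (by positivity)] at h3
    have hSs := gaussian_summable_comp L S 0
    simp only [add_zero] at hSs
    have hle : ∑' x : {x : L // inner ℝ u (x : Euc n) = 0}, gaussian r (x : Euc n) ≤
        ∑' x : L, Real.exp (-Real.pi * ‖S x‖ ^ 2) := by
      refine le_trans (le_of_eq ?_) (Summable.tsum_subtype_le _ {x : L | inner ℝ u (x : Euc n) = 0}
        (fun _ => (Real.exp_pos _).le) hSs)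
      refine tsum_congr fun x => ?_
      have hx : inner ℝ u ((x : L) : Euc n) = 0 := x.2
      rw [gaussian_eq, hn1, hx]
      congr 1
      field_simp
      ring
    refine hle.trans ?_
    rw [← h3]
    have e1 : c / ((r⁻¹) ^ n * √2) = c * r ^ n / √2 := by rw [inv_pow]; field_simp
    rw [e1]
    refine mul_le_mul_of_nonneg_left ?_ (by positivity)
    have hs' := gaussian_summable_comp (dualLattice L) S.symm 0
    simp only [add_zero] at hs'
    refine Summable.tsum_le_tsum (fun y => ?_) hs' (summable_gaussian (dualLattice L) (by positivity))
    rw [gaussian_eq, Real.exp_le_exp, hn2]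
    -- On the dual side only the direction `u` is contracted. Contracting all directions by 1/√2
    -- gives a round Gaussian as an upper bound.
    have h4 : (inner ℝ u (y : Euc n)) ^ 2 ≤ ‖(y : Euc n)‖ ^ 2 := by
      have := abs_real_inner_le_norm u (y : Euc n)
      rw [hu, one_mul] at this
      rw [← sq_abs]
      exact pow_le_pow_left₀ (abs_nonneg _) this 2
    have e2 : Real.pi / (1 / (r / √2)) ^ 2 = Real.pi * r ^ 2 / 2 := by
      rw [one_div, inv_pow, div_pow, h22]; field_simp
    rw [e2, inv_pow, h22]
    have : 0 < Real.pi * r ^ 2 := by positivity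
    nlinarith

/-- In ρ_r(L) = c r^n ρ_{1/r}(L*) a larger r enlarges the power and shrinks the dual mass. -/
theorem gaussianMass_scale_le (hn : 0 < n) {r t : ℝ} (hr : 0 < r) (ht : 1 ≤ t) :
    gaussianMass (t * r) (L : Set (Euc n)) ≤ t ^ n * gaussianMass r (L : Set (Euc n)) := by
  obtain ⟨c, hc, h, -⟩ := exists_gaussianMass_eq L hn
  rw [h _ hr, h _ (by positivity)]
  have h1 : gaussianMass (1 / (t * r)) (dualLattice L : Set (Euc n)) ≤
      gaussianMass (1 / r) (dualLattice L : Set (Euc n)) := by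
    refine Summable.tsum_le_tsum (fun y => gaussian_mono (by positivity) ?_ _)
      (summable_gaussian (dualLattice L) (by positivity))
      (summable_gaussian (dualLattice L) (by positivity))
    refine one_div_le_one_div_of_le hr ?_
    nlinarith
  calc _ ≤ c * (t * r) ^ n * gaussianMass (1 / r) (dualLattice L : Set (Euc n)) := by gcongr
    _ = _ := by rw [mul_pow]; ring

/-- **Banaszczyk's tail bound** (in a weak form). -/
theorem tsum_gaussian_tail_le (hn : 0 < n) {r : ℝ} (hr : 0 < r) :
    ∑' x : {x : L // √n * r < ‖(x : Euc n)‖}, gaussian r (x : Euc n) ≤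
      (1 / 2) ^ n * gaussianMass r (L : Set (Euc n)) := by
  have h2r : (0 : ℝ) < 2 * r := by positivity
  have hpi : Real.exp (-(Real.pi * (3 / 4))) ≤ 1 / 4 := by
    rw [Real.exp_neg]
    have h1 : (4 : ℝ) ≤ Real.exp (Real.pi * (3 / 4)) := by
      have h3 : (2 : ℝ) ≤ Real.pi * (3 / 4) := by linarith [Real.pi_gt_three]
      refine le_trans ?_ (Real.exp_le_exp.mpr h3)
      have := Real.quadratic_le_exp_of_nonneg (x := 2) (by norm_num)
      linarith
    rw [one_div]
    exact inv_anti₀ (by norm_num) h1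
  -- Outside the ball, ρ_r is at most exp(-3π/4)^n ≤ 4^(-n) times ρ_{2r}, whereas passing from r to
  -- 2r multiplies the mass of the lattice by at most 2^n.
  have hpt : ∀ x : {x : L // √n * r < ‖(x : Euc n)‖},
      gaussian r (x : Euc n) ≤ (1 / 4) ^ n * gaussian (2 * r) (x : Euc n) := by
    intro x
    have hx : (n : ℝ) * r ^ 2 ≤ ‖((x : L) : Euc n)‖ ^ 2 := by
      have h1 := pow_le_pow_left₀ (by positivity) x.2.le 2
      rwa [mul_pow, Real.sq_sqrt (Nat.cast_nonneg n)] at h1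
    calc gaussian r (x : Euc n)
        ≤ Real.exp (n * (-(Real.pi * (3 / 4)))) * gaussian (2 * r) (x : Euc n) := by
          rw [gaussian_eq, gaussian_eq, ← Real.exp_add, Real.exp_le_exp]
          have e1 : Real.pi / (2 * r) ^ 2 = Real.pi / r ^ 2 / 4 := by field_simp; norm_num
          rw [e1]
          have e2 : Real.pi * n ≤ Real.pi / r ^ 2 * ‖((x : L) : Euc n)‖ ^ 2 := by
            rw [div_mul_eq_mul_div, le_div_iff₀ (by positivity)]
            nlinarith [Real.pi_pos]
          linarith
      _ ≤ _ := by
          rw [Real.exp_nat_mul]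
          gcongr
          exact (gaussian_pos _ _).le
  have hs := (summable_gaussian L h2r)
  have hs1 : Summable fun x : {x : L // √n * r < ‖(x : Euc n)‖} => gaussian r (x : Euc n) :=
    (summable_gaussian L hr).subtype {x : L | √n * r < ‖(x : Euc n)‖}
  have hs2 : Summable fun x : {x : L // √n * r < ‖(x : Euc n)‖} => gaussian (2 * r) (x : Euc n) :=
    hs.subtype {x : L | √n * r < ‖(x : Euc n)‖}
  calc _ ≤ ∑' x : {x : L // √n * r < ‖(x : Euc n)‖}, (1 / 4) ^ n * gaussian (2 * r) (x : Euc n) :=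
        hs1.tsum_le_tsum hpt (hs2.mul_left _)
    _ = (1 / 4) ^ n * ∑' x : {x : L // √n * r < ‖(x : Euc n)‖}, gaussian (2 * r) (x : Euc n) :=
        tsum_mul_left
    _ ≤ (1 / 4) ^ n * gaussianMass (2 * r) (L : Set (Euc n)) := by
        gcongr
        exact Summable.tsum_subtype_le _ {x : L | √n * r < ‖(x : Euc n)‖}
          (fun _ => (gaussian_pos _ _).le) hs
    _ ≤ (1 / 4) ^ n * (2 ^ n * gaussianMass r (L : Set (Euc n))) := by
        gcongr
        exact gaussianMass_scale_le L hn hr one_le_two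
    _ = _ := by rw [← mul_assoc, ← mul_pow]; norm_num

/-- `n` independent lattice vectors of norm at most `t` bound the smoothing parameter. -/
theorem gaussianMass_dual_le (hn : 0 < n) {ε t : ℝ} (hε : 0 < ε) {v : Fin n → Euc n}
    (hvL : ∀ i, v i ∈ L) (hv : LinearIndependent ℝ v) (hvt : ∀ i, ‖v i‖ ≤ t) :
    0 < t * √(Real.log (2 * n * (1 + 1 / ε)) / Real.pi) ∧
    gaussianMass (1 / (t * √(Real.log (2 * n * (1 + 1 / ε)) / Real.pi)))
      ((dualLattice L : Set (Euc n)) \ {0}) ≤ ε := by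
  have hn1 : (1 : ℝ) ≤ n := by exact_mod_cast hn
  obtain ⟨Q, hQ⟩ : ∃ Q, Q = 2 * (n : ℝ) * (1 + 1 / ε) := ⟨_, rfl⟩
  rw [← hQ]
  have hQ1 : 1 < Q := by
    have : 0 < 2 * (n : ℝ) * (1 / ε) := by positivity
    rw [hQ, mul_add]; linarith
  have hlog : 0 < Real.log Q := Real.log_pos hQ1
  have hv0 : ∀ i, 0 < ‖v i‖ := fun i => norm_pos_iff.mpr (hv.ne_zero i)
  have ht : 0 < t := lt_of_lt_of_le (hv0 ⟨0, hn⟩) (hvt ⟨0, hn⟩)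
  obtain ⟨s, hs⟩ : ∃ s, s = t * √(Real.log Q / Real.pi) := ⟨_, rfl⟩
  rw [← hs]
  have hs0 : 0 < s := hs ▸ mul_pos ht (Real.sqrt_pos.mpr (div_pos hlog Real.pi_pos))
  refine ⟨hs0, ?_⟩
  have hs2 : Real.pi * s ^ 2 = t ^ 2 * Real.log Q := by
    rw [hs, mul_pow, Real.sq_sqrt (by positivity)]
    field_simp
  set g : dualLattice L → ℝ := fun y => gaussian (1 / s) (y : Euc n) with hg
  have hgs : Summable g := summable_gaussian (dualLattice L) (by positivity)
  set tot := ∑' y, g y with htot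
  have htot0 : 0 ≤ tot := tsum_nonneg fun _ => (gaussian_pos _ _).le
  have hge : ∀ y : dualLattice L, g y = Real.exp (-(Real.pi * s ^ 2) * ‖(y : Euc n)‖ ^ 2) := by
    intro y
    simp only [hg]
    rw [gaussian_eq]
    congr 2
    field_simp
  -- `s` is chosen to make exp(-π s² / ‖v i‖²) at most 1/Q for every i.
  have hpart : ∀ i, ∑' y : {y : dualLattice L // inner ℝ (y : Euc n) (v i) ≠ 0}, g y ≤
      2 / Q * tot := by
    intro i
    have hvi := hv0 i
    have h1 := tsum_inner_ne_zero_le (dualLattice L) (a := Real.pi * s ^ 2) (by positivity)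
      (hv.ne_zero i) (fun y hy => mem_innerDual.mp hy _ (hvL i))
    simp_rw [← hge] at h1
    refine h1.trans ?_
    refine mul_le_mul_of_nonneg_right ?_ htot0
    rw [div_eq_mul_inv 2 Q]
    refine mul_le_mul_of_nonneg_left ?_ zero_le_two
    rw [hs2, ← Real.exp_log (zero_lt_one.trans hQ1), ← Real.exp_neg, Real.exp_le_exp,
      Real.log_exp, neg_div, neg_le_neg_iff, le_div_iff₀ (by positivity)]
    have : ‖v i‖ ^ 2 ≤ t ^ 2 := pow_le_pow_left₀ hvi.le (hvt i) 2
    nlinarith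
  have htot1 : tot = 1 + gaussianMass (1 / s) ((dualLattice L : Set (Euc n)) \ {0}) :=
    gaussianMass_eq_one_add (dualLattice L) (by positivity)
  set X := gaussianMass (1 / s) ((dualLattice L : Set (Euc n)) \ {0}) with hX
  have hXle : X ≤ n * (2 / Q * tot) := by
    have hspan : Submodule.span ℝ (Set.range v) = ⊤ := by
      refine hv.span_eq_top_of_card_eq_finrank' ?_
      simp
    -- The vectors span the space, so each nonzero dual vector is counted for at least one i.
    have hex : ∀ y : Euc n, y ≠ 0 → ∃ i, inner ℝ y (v i) ≠ 0 := by
      intro y hy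
      by_contra! hcon
      have h1 : Submodule.span ℝ (Set.range v) ≤ LinearMap.ker (innerₗ (Euc n) y) := by
        rw [Submodule.span_le]
        rintro _ ⟨i, rfl⟩
        exact hcon i
      rw [hspan] at h1
      have h2 : inner ℝ y y = 0 := h1 (Submodule.mem_top (x := y))
      exact hy (inner_self_eq_zero.mp h2)
    have hite : ∀ i, Summable fun y : dualLattice L =>
        Set.indicator {y : dualLattice L | inner ℝ (y : Euc n) (v i) ≠ 0} g y :=
      fun i => hgs.indicator _
    have h1 : X = ∑' y : dualLattice L, if y = 0 then 0 else g y := by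
      have h2 := hgs.tsum_eq_add_tsum_ite 0
      have h3 : g 0 = 1 := gaussian_zero _
      rw [← htot, htot1, h3] at h2
      linarith
    rw [h1]
    calc (∑' y : dualLattice L, if y = 0 then 0 else g y)
        ≤ ∑' y : dualLattice L, ∑ i,
          Set.indicator {y : dualLattice L | inner ℝ (y : Euc n) (v i) ≠ 0} g y := by
          refine Summable.tsum_le_tsum (fun y => ?_) ?_ (summable_sum fun i _ => hite i)
          · have hnn : ∀ i, 0 ≤ Set.indicator
                {y : dualLattice L | inner ℝ (y : Euc n) (v i) ≠ 0} g y :=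
              fun i => Set.indicator_nonneg (fun _ _ => (gaussian_pos _ _).le) _
            split_ifs with h0
            · exact Finset.sum_nonneg fun i _ => hnn i
            · obtain ⟨i, hi⟩ := hex y (fun h => h0 (Subtype.ext h))
              refine le_trans (le_of_eq ?_)
                (Finset.single_le_sum (fun i _ => hnn i) (Finset.mem_univ i))
              rw [Set.indicator_of_mem]
              exact hi
          · refine Summable.of_nonneg_of_le (fun y => ?_) (fun y => ?_) hgs
            · split_ifs
              exacts [le_rfl, (gaussian_pos _ _).le]
            · split_ifs
              exacts [(gaussian_pos _ _).le, le_rfl]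
      _ = ∑ i, ∑' y : dualLattice L,
          Set.indicator {y : dualLattice L | inner ℝ (y : Euc n) (v i) ≠ 0} g y :=
          Summable.tsum_finsetSum fun i _ => hite i
      _ ≤ ∑ _i : Fin n, 2 / Q * tot := by
          refine Finset.sum_le_sum fun i _ => ?_
          rw [← tsum_subtype]
          exact hpart i
      _ = _ := by simp
  -- The value of `Q` is made for this: X ≤ ε/(1 + ε) · (1 + X) is the same as X ≤ ε.
  have h1 : n * (2 / Q * tot) = ε / (1 + ε) * tot := by
    rw [hQ]; field_simp; ring
  rw [h1, htot1, div_mul_eq_mul_div, le_div_iff₀ (by positivity)] at hXle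
  linarith

/-- Without this the `sInf` in `smoothingParameter` could be the default value 0 of the empty set.
-/
theorem exists_smoothing_set (hn : 0 < n) {ε : ℝ} (hε : 0 < ε) :
    ∃ s, 0 < s ∧ gaussianMass (1 / s) ((dualLattice L : Set (Euc n)) \ {0}) ≤ ε := by
  obtain ⟨m, b, d, hL, -, -⟩ := exists_basis_innerDual L
  have hm : m = n := by
    have := Module.finrank_eq_card_basis b
    simpa using this.symm
  subst hm
  exact ⟨_, gaussianMass_dual_le L hn hε (v := b) (t := ∑ i, ‖b i‖)
    (fun i => by rw [hL]; exact Submodule.subset_span ⟨i, rfl⟩) b.linearIndependent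
    (fun i => Finset.single_le_sum (fun i _ => norm_nonneg (b i)) (Finset.mem_univ i))⟩

omit [DiscreteTopology L] [IsZLattice ℝ L] in
theorem bddBelow_smoothing_set (ε : ℝ) : BddBelow
    {s : ℝ | 0 < s ∧ gaussianMass (1 / s) ((dualLattice L : Set (Euc n)) \ {0}) ≤ ε} :=
  ⟨0, fun _ hs => hs.1.le⟩

/-- Each `t` admitted in the definition of λ_n yields an admissible `s` by `gaussianMass_dual_le`;
then take the infimum over `t`. -/
theorem smoothingParameter_le_lambdaN (hn : 0 < n) {ε : ℝ} (hε : 0 < ε) :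
    smoothingParameter ε L ≤ lambdaN n L * √(Real.log (2 * n * (1 + 1 / ε)) / Real.pi) := by
  obtain ⟨m, b, d, hL, -, -⟩ := exists_basis_innerDual L
  have hm : m = n := by
    have := Module.finrank_eq_card_basis b
    simpa using this.symm
  subst hm
  set c := √(Real.log (2 * m * (1 + 1 / ε)) / Real.pi) with hc
  have hn1 : (1 : ℝ) ≤ m := by exact_mod_cast hn
  have hc0 : 0 < c := by
    refine Real.sqrt_pos.mpr (div_pos (Real.log_pos ?_) Real.pi_pos)
    have : 0 < 1 / ε := by positivity
    nlinarith
  rw [← div_le_iff₀ hc0, lambdaN]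
  refine le_csInf ⟨∑ i, ‖b i‖, b, fun i => by rw [hL]; exact Submodule.subset_span ⟨i, rfl⟩,
    b.linearIndependent,
    fun i => Finset.single_le_sum (fun i _ => norm_nonneg (b i)) (Finset.mem_univ i)⟩ ?_
  rintro t ⟨v, hvL, hv, hvt⟩
  rw [div_le_iff₀ hc0]
  exact csInf_le (bddBelow_smoothing_set L ε) (gaussianMass_dual_le L hn hε hvL hv hvt)

/-- A single dual vector contributes exp(-π s²‖y‖²) to the mass. If s‖y‖ < 1/√2, this exceeds
exp(-2) > 1/10, because π < 4. The bound keeps η away from 0 and limits the scales that must be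
tried. -/
theorem one_le_smoothingParameter_mul_norm (hn : 0 < n) {ε : ℝ} (hε : 0 < ε) (hε1 : ε ≤ 1 / 10)
    {y : Euc n} (hy : y ∈ dualLattice L) (hy0 : y ≠ 0) :
    1 ≤ √2 * smoothingParameter ε L * ‖y‖ := by
  have hyn : 0 < ‖y‖ := norm_pos_iff.mpr hy0
  have h2 : (0 : ℝ) < √2 := by positivity
  have h22 : √2 ^ 2 = (2 : ℝ) := Real.sq_sqrt zero_le_two
  have key : 1 / (√2 * ‖y‖) ≤ smoothingParameter ε L := by
    refine le_csInf (exists_smoothing_set L hn hε) ?_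
    rintro s ⟨hs, hmass⟩
    have h1 : gaussian (1 / s) y ≤ 1 / 10 := by
      refine le_trans ?_ (hmass.trans hε1)
      exact (summable_gaussian_diff (dualLattice L) (by positivity)).le_tsum
        (⟨y, hy, hy0⟩ : ((dualLattice L : Set (Euc n)) \ {0} : Set (Euc n)))
        (fun _ _ => (gaussian_pos _ _).le)
    rw [gaussian_eq] at h1
    by_contra! hcon
    rw [lt_div_iff₀ (by positivity)] at hcon
    have h3 : (s * (√2 * ‖y‖)) ^ 2 < 1 := by
      rw [sq_lt_one_iff₀ (by positivity)]; exact hcon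
    have h4 : s ^ 2 * ‖y‖ ^ 2 < 1 / 2 := by
      have : (s * (√2 * ‖y‖)) ^ 2 = s ^ 2 * ‖y‖ ^ 2 * √2 ^ 2 := by ring
      rw [this, h22] at h3
      linarith
    have h5 : (-2 : ℝ) ≤ -(Real.pi / (1 / s) ^ 2) * ‖y‖ ^ 2 := by
      have : Real.pi / (1 / s) ^ 2 * ‖y‖ ^ 2 = Real.pi * (s ^ 2 * ‖y‖ ^ 2) := by field_simp
      rw [neg_mul, this]
      nlinarith [Real.pi_lt_four, Real.pi_pos]
    have h6 := (Real.exp_le_exp.mpr h5).trans h1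
    have h7 : Real.exp 2 < 10 := by
      have h8 : Real.exp 2 = Real.exp 1 ^ 2 := by rw [← Real.exp_nat_mul]; norm_num
      rw [h8]
      have := Real.exp_one_lt_d9
      nlinarith [Real.exp_pos 1]
    rw [Real.exp_neg, inv_le_comm₀ (Real.exp_pos _) (by norm_num)] at h6
    norm_num at h6
    linarith
  rw [div_le_iff₀ (by positivity)] at key
  linarith

theorem smoothingParameter_pos (hn : 0 < n) {ε : ℝ} (hε : 0 < ε) (hε1 : ε ≤ 1 / 10) :
    0 < smoothingParameter ε L := by
  obtain ⟨m, b, d, -, hd, -⟩ := exists_basis_innerDual L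
  have hm : m = n := by
    have := Module.finrank_eq_card_basis b
    simpa using this.symm
  subst hm
  have h1 := one_le_smoothingParameter_mul_norm L hn hε hε1 (y := d ⟨0, hn⟩)
    (by
      change _ ∈ innerDual L
      rw [hd]
      exact Submodule.subset_span ⟨_, rfl⟩) (d.ne_zero _)
  by_contra! hcon
  have : √2 * smoothingParameter ε L * ‖d ⟨0, hn⟩‖ ≤ 0 :=
    mul_nonpos_of_nonpos_of_nonneg (mul_nonpos_of_nonneg_of_nonpos (by positivity) hcon)
      (norm_nonneg _)
  linarith

/-- The infimum is attained: every finite partial sum is continuous in `s` and at most ε to the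
right of it. -/
theorem gaussianMass_le_of_smoothingParameter_le (hn : 0 < n) {ε s : ℝ} (hε : 0 < ε) (hs : 0 < s)
    (hη : smoothingParameter ε L ≤ s) :
    gaussianMass (1 / s) ((dualLattice L : Set (Euc n)) \ {0}) ≤ ε := by
  have hgt : ∀ s', s < s' → gaussianMass (1 / s') ((dualLattice L : Set (Euc n)) \ {0}) ≤ ε := by
    intro s' hs'
    obtain ⟨s'', ⟨h1, h2⟩, h3⟩ := exists_lt_of_csInf_lt (exists_smoothing_set L hn hε)
      (lt_of_le_of_lt hη hs')
    exact (gaussianMass_diff_mono (dualLattice L) (by have := hs.trans hs'; positivity)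
      (one_div_le_one_div_of_le h1 h3.le)).trans h2
  refine Real.tsum_le_of_sum_le (fun _ => (gaussian_pos _ _).le) fun F => ?_
  have hcont : ContinuousWithinAt (fun s' : ℝ => ∑ y ∈ F, gaussian (1 / s') (y : Euc n)) (Set.Ioi s) s := by
    refine ContinuousAt.continuousWithinAt ?_
    simp_rw [gaussian_eq]
    have : (1 / s)  ≠ 0 := by positivity
    fun_prop (disch := positivity)
  refine le_of_tendsto hcont ?_
  filter_upwards [self_mem_nhdsWithin] with s' hs'
  refine le_trans ?_ (hgt s' hs')
  exact (summable_gaussian_diff (dualLattice L) (by have := hs.trans hs'; positivity)).sum_le_tsum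
    F (fun _ _ => (gaussian_pos _ _).le)

/-- The discrete Gaussian leaves every proper subspace with probability at least `1 / 10`. -/
theorem tsum_discreteGaussian_notMem_ge {ε r : ℝ} (hε : 0 < ε) (hε1 : ε ≤ 1 / 10)
    (hr : √2 * smoothingParameter ε L ≤ r) (H : Submodule ℝ (Euc n))
    (hH : Module.finrank ℝ H < n) :
    1 / 10 ≤ ∑' x : {x : Euc n // x ∈ L ∧ x ∉ H}, discreteGaussian L r x := by
  have hn : 0 < n := by omega
  have h2 : (0 : ℝ) < √2 := by positivity
  have h22 : √2 ^ 2 = (2 : ℝ) := Real.sq_sqrt zero_le_two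
  have hη := smoothingParameter_pos L hn hε hε1
  have hr0 : 0 < r := (mul_pos h2 hη).trans_le hr
  obtain ⟨u, hu, huH⟩ : ∃ u : Euc n, ‖u‖ = 1 ∧ ∀ x ∈ H, inner ℝ u x = 0 := by
    have hne : H ≠ ⊤ := by
      rintro rfl
      simp at hH
    have hne2 : Hᗮ ≠ ⊥ := fun h => hne (Submodule.orthogonal_eq_bot_iff.mp h)
    obtain ⟨w, hw, hw0⟩ := Submodule.exists_mem_ne_zero_of_ne_bot hne2
    refine ⟨‖w‖⁻¹ • w, ?_, fun x hx => ?_⟩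
    · rw [norm_smul, norm_inv, norm_norm, inv_mul_cancel₀ (norm_ne_zero_iff.mpr hw0)]
    · rw [inner_smul_left, Submodule.inner_left_of_mem_orthogonal hx hw, mul_zero]
  obtain ⟨c, hc, hm, hstr⟩ := exists_gaussianMass_eq L hn
  set m := gaussianMass r (L : Set (Euc n)) with hmdef
  have hm0 : 0 < m := gaussianMass_pos L hr0
  have hcr : 0 < c * r ^ n := by positivity
  have hmge : c * r ^ n ≤ m := by
    rw [hmdef, hm r hr0, gaussianMass_eq_one_add (dualLattice L) (by positivity)]
    have := gaussianMass_diff_nonneg (1 / r) ((dualLattice L : Set (Euc n)) \ {0})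
    nlinarith
  have hin := hstr r hr0 u hu
  rw [gaussianMass_eq_one_add (dualLattice L) (by positivity)] at hin
  -- Here the factor √2 in the hypothesis on `r` is spent, since the stretched sum involves the dual
  -- mass for r/√2 instead of r.
  have hd := gaussianMass_le_of_smoothingParameter_le L hn hε (s := r / √2) (by positivity)
    (by rw [le_div_iff₀ h2]; linarith)
  have hin2 : ∑' x : {x : L // inner ℝ u (x : Euc n) = 0}, gaussian r (x : Euc n) ≤ 9 / 10 * m := by
    refine hin.trans ?_
    -- This is the bound (1 + ε)/√2 for the probability of H, at the largest ε allowed.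
    have h3 : 11 / 10 / √2 ≤ 9 / 10 := by
      rw [div_le_iff₀ h2]
      nlinarith
    calc _ ≤ c * r ^ n / √2 * (11 / 10) := by gcongr; linarith
      _ = (11 / 10 / √2) * (c * r ^ n) := by ring
      _ ≤ 9 / 10 * m := by gcongr
  have hs := summable_gaussian L hr0
  have hsplit := Summable.tsum_add_tsum_compl (s := {x : L | inner ℝ u (x : Euc n) = 0})
    (f := fun x : L => gaussian r (x : Euc n)) (hs.subtype _) (hs.subtype _)
  have hcompl : m / 10 ≤ ∑' x : ({x : L | inner ℝ u (x : Euc n) = 0}ᶜ : Set L), gaussian r (x : Euc n) := by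
    have h4 : (∑' x : L, gaussian r (x : Euc n)) = m := rfl
    rw [h4] at hsplit
    have h5 : ∑' x : ({x : L | inner ℝ u (x : Euc n) = 0} : Set L), gaussian r (x : Euc n) ≤
      9 / 10 * m := hin2
    linarith
  -- transfer to the subtype of the statement
  set φ : ({x : L | inner ℝ u (x : Euc n) = 0}ᶜ : Set L) → {x : Euc n // x ∈ L ∧ x ∉ H} :=
    fun x => ⟨x.1, x.1.2, fun h => x.2 (huH _ h)⟩ with hφ
  have hφi : Function.Injective φ := fun x y h =>
    Subtype.ext (Subtype.ext (congrArg (fun z : {x : Euc n // x ∈ L ∧ x ∉ H} => (z : Euc n)) h))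
  have hDs : Summable fun x : {x : Euc n // x ∈ L ∧ x ∉ H} => discreteGaussian L r x := by
    have hinj : Function.Injective
        (fun x : {x : Euc n // x ∈ L ∧ x ∉ H} => (⟨x.1, x.2.1⟩ : L)) :=
      fun x y h => Subtype.ext (congrArg (fun z : L => (z : Euc n)) h)
    refine ((hs.div_const m).comp_injective hinj).congr fun x => ?_
    simp only [Function.comp_apply, discreteGaussian, if_pos x.2.1]
    rfl
  have hle : ∑' x : ({x : L | inner ℝ u (x : Euc n) = 0}ᶜ : Set L), gaussian r (x : Euc n) / m ≤
      ∑' x : {x : Euc n // x ∈ L ∧ x ∉ H}, discreteGaussian L r x := by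
    refine Summable.tsum_le_tsum_of_inj φ hφi (fun x _ => ?_) (fun x => ?_) ?_ hDs
    · rw [discreteGaussian, if_pos x.2.1]
      exact div_nonneg (gaussian_pos _ _).le hm0.le
    · rw [discreteGaussian, if_pos (φ x).2.1]
    · exact (hs.subtype _).div_const m
  refine le_trans ?_ hle
  rw [tsum_div_const, le_div_iff₀ hm0]
  linarith

end Smoothing

end

noncomputable section

/-! ### Cost and time bounds for programs -/

theorem bitLen_pos (z : ℤ) : 1 ≤ bitLen z := by unfold bitLen; omega

theorem bitLen_le_iff {z : ℤ} {B : ℕ} : bitLen z ≤ B + 1 ↔ |z| < 2 ^ B := by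
  rw [bitLen, Nat.add_le_add_iff_right, Nat.size_le, Int.abs_eq_natAbs]
  exact_mod_cast Iff.rfl

theorem bitLen_add_le (a b : ℤ) : bitLen (a + b) ≤ bitLen a + bitLen b := by
  obtain ⟨x, hx⟩ := Nat.exists_eq_add_of_le' (bitLen_pos a)
  obtain ⟨y, hy⟩ := Nat.exists_eq_add_of_le' (bitLen_pos b)
  have h1 := bitLen_le_iff.mp hx.le
  have h2 := bitLen_le_iff.mp hy.le
  have : bitLen (a + b) ≤ (x + y + 1) + 1 := by
    rw [bitLen_le_iff]
    refine (abs_add_le a b).trans_lt ?_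
    have e1 : (2 : ℤ) ^ x ≤ 2 ^ (x + y) := pow_le_pow_right₀ (by norm_num) (by omega)
    have e2 : (2 : ℤ) ^ y ≤ 2 ^ (x + y) := pow_le_pow_right₀ (by norm_num) (by omega)
    rw [pow_succ]
    linarith
  omega

theorem bitLen_neg (a : ℤ) : bitLen (-a) = bitLen a := by simp [bitLen]

theorem bitLen_sub_le (a b : ℤ) : bitLen (a - b) ≤ bitLen a + bitLen b := by
  rw [sub_eq_add_neg, ← bitLen_neg b]; exact bitLen_add_le _ _

theorem bitLen_mul_le (a b : ℤ) : bitLen (a * b) ≤ bitLen a + bitLen b := by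
  obtain ⟨x, hx⟩ := Nat.exists_eq_add_of_le' (bitLen_pos a)
  obtain ⟨y, hy⟩ := Nat.exists_eq_add_of_le' (bitLen_pos b)
  have h1 := bitLen_le_iff.mp hx.le
  have h2 := bitLen_le_iff.mp hy.le
  have : bitLen (a * b) ≤ (x + y) + 1 := by
    rw [bitLen_le_iff, abs_mul, pow_add]
    exact mul_lt_mul'' h1 h2 (abs_nonneg _) (abs_nonneg _)
  omega

theorem bitLen_mono {a b : ℤ} (h : |a| ≤ |b|) : bitLen a ≤ bitLen b := by
  obtain ⟨y, hy⟩ := Nat.exists_eq_add_of_le' (bitLen_pos b)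
  rw [hy, bitLen_le_iff]
  exact h.trans_lt (bitLen_le_iff.mp hy.le)

namespace Expr

instance : Add Expr := ⟨Expr.add⟩
instance : Sub Expr := ⟨Expr.sub⟩
instance : Mul Expr := ⟨Expr.mul⟩
instance : Div Expr := ⟨Expr.div⟩
instance (n : ℕ) [n.AtLeastTwo] : OfNat Expr n := ⟨Expr.lit n⟩
instance : Zero Expr := ⟨Expr.lit 0⟩
instance : One Expr := ⟨Expr.lit 1⟩

variable (m : Memory) (a b : Expr)

@[simp] theorem eval_add : (a + b).eval m = a.eval m + b.eval m := rfl
@[simp] theorem eval_sub : (a - b).eval m = a.eval m - b.eval m := rfl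
@[simp] theorem eval_mul : (a * b).eval m = a.eval m * b.eval m := rfl
@[simp] theorem eval_div : (a / b).eval m = a.eval m / b.eval m := rfl
@[simp] theorem eval_get (k : ℕ) (i : Expr) : (Expr.get k i).eval m = m k (i.eval m) := rfl
@[simp] theorem eval_zero : (0 : Expr).eval m = 0 := rfl
@[simp] theorem eval_one : (1 : Expr).eval m = 1 := rfl
@[simp] theorem eval_ofNat (n : ℕ) [n.AtLeastTwo] :
    (ofNat(n) : Expr).eval m = ofNat(n) := rfl

/-- A bound for the bit length of the value, in multiples of the bit length of memory cells. -/
def wt : Expr → ℕ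
  | .lit z => bitLen z
  | .get _ _ => 1
  | .add a b => a.wt + b.wt
  | .sub a b => a.wt + b.wt
  | .mul a b => a.wt + b.wt
  | .div a b => a.wt + b.wt

/-- A bound for the cost, in multiples of the bit length of memory cells. -/
def costWt : Expr → ℕ
  | .lit z => bitLen z
  | .get _ i => i.costWt + 1
  | .add a b => a.costWt + b.costWt + (a.wt + b.wt)
  | .sub a b => a.costWt + b.costWt + (a.wt + b.wt)
  | .mul a b => a.costWt + b.costWt + (a.wt + b.wt)
  | .div a b => a.costWt + b.costWt + (a.wt + b.wt)

end Expr

/-- All memory cells have at most `B` bits. -/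
def Memory.Bdd (B : ℕ) (m : Memory) : Prop := ∀ k i, |m k i| < 2 ^ B

/-- Each operation yields at most the sum of the bit lengths of its operands. Since the expression
is fixed, values and costs are linear in the bit length of the cells. -/
theorem Expr.bitLen_eval_le {B : ℕ} {m : Memory} (hm : m.Bdd B) (e : Expr) :
    bitLen (e.eval m) ≤ e.wt * (B + 1) := by
  induction e with
  | lit z => exact Nat.le_mul_of_pos_right _ (by omega)
  | get k i => simpa [Expr.wt] using bitLen_le_iff.mpr (hm k (i.eval m))
  | add a b ha hb => rw [Expr.wt, add_mul]; exact (bitLen_add_le _ _).trans (add_le_add ha hb)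
  | sub a b ha hb => rw [Expr.wt, add_mul]; exact (bitLen_sub_le _ _).trans (add_le_add ha hb)
  | mul a b ha hb => rw [Expr.wt, add_mul]; exact (bitLen_mul_le _ _).trans (add_le_add ha hb)
  | div a b ha hb =>
    rw [Expr.wt, add_mul]
    exact (bitLen_mono (Int.abs_ediv_le_abs _ _)).trans (ha.trans (Nat.le_add_right _ _))

theorem Expr.cost_le {B : ℕ} {m : Memory} (hm : m.Bdd B) (e : Expr) :
    e.cost m ≤ e.costWt * (B + 1) := by
  have key : ∀ e : Expr, bitLen (e.eval m) ≤ e.wt * (B + 1) := Expr.bitLen_eval_le hm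
  induction e with
  | lit z => exact Nat.le_mul_of_pos_right _ (by omega)
  | get k i hi =>
    have := key (.get k i)
    simp only [Expr.wt, one_mul, Expr.eval] at this
    rw [Expr.costWt, Expr.cost, add_mul, one_mul]
    omega
  | add a b ha hb =>
    have := key (.add a b)
    simp only [Expr.wt, Expr.eval] at this
    simp only [Expr.costWt, Expr.cost, add_mul] at *
    omega
  | sub a b ha hb =>
    have := key (.sub a b)
    simp only [Expr.wt, Expr.eval] at this
    simp only [Expr.costWt, Expr.cost, add_mul] at *
    omega
  | mul a b ha hb =>
    have := key (.mul a b)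
    simp only [Expr.wt, Expr.eval] at this
    simp only [Expr.costWt, Expr.cost, add_mul] at *
    omega
  | div a b ha hb =>
    have := key (.div a b)
    simp only [Expr.wt, Expr.eval] at this
    simp only [Expr.costWt, Expr.cost, add_mul] at *
    omega

/-- A time bound for programs whose memory cells have at most `B` bits, whose loops take at most
`B` rounds, and whose queries ask for at most `B` bits. -/
def Prog.tm (B : ℕ) : Prog → ℕ
  | .skip => 1
  | .assign _ i e => 1 + i.costWt * (B + 1) + e.costWt * (B + 1)
  | .seq p q => p.tm B + q.tm B
  | .ite e p q => 1 + e.costWt * (B + 1) + (p.tm B + q.tm B)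
  | .loop e p => (B + 1) * (1 + e.costWt * (B + 1) + p.tm B)
  -- `B` pays for the answer, and `B * (B + 1)` for a query list of at most `B` entries.
  | .query _ _ b => 1 + b.costWt * (B + 1) + B + B * (B + 1)

theorem Prog.exists_polynomial_tm (p : Prog) : ∃ P : Polynomial ℕ, ∀ B, p.tm B = P.eval B := by
  induction p with
  | skip => exact ⟨1, fun B => by simp [Prog.tm]⟩
  | assign k i e =>
    exact ⟨1 + (i.costWt : Polynomial ℕ) * (Polynomial.X + 1) + (e.costWt : Polynomial ℕ) * (Polynomial.X + 1),
      fun B => by simp [Prog.tm]⟩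
  | seq p q hp hq =>
    obtain ⟨P, hP⟩ := hp
    obtain ⟨Q, hQ⟩ := hq
    exact ⟨P + Q, fun B => by simp [Prog.tm, hP, hQ]⟩
  | ite e p q hp hq =>
    obtain ⟨P, hP⟩ := hp
    obtain ⟨Q, hQ⟩ := hq
    exact ⟨1 + (e.costWt : Polynomial ℕ) * (Polynomial.X + 1) + (P + Q), fun B => by simp [Prog.tm, hP, hQ]⟩
  | loop e p hp =>
    obtain ⟨P, hP⟩ := hp
    exact ⟨(Polynomial.X + 1) * (1 + (e.costWt : Polynomial ℕ) * (Polynomial.X + 1) + P),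
      fun B => by simp [Prog.tm, hP]⟩
  | query k k' b =>
    exact ⟨1 + (b.costWt : Polynomial ℕ) * (Polynomial.X + 1) + Polynomial.X + Polynomial.X * (Polynomial.X + 1),
      fun B => by simp [Prog.tm]⟩

/-! ### Deterministic runs -/

/-- Write a memory cell. -/
def Memory.set (m : Memory) (k : ℕ) (i z : ℤ) : Memory :=
  Function.update m k (Function.update (m k) i z)

theorem Memory.set_apply (m : Memory) (k : ℕ) (i z : ℤ) (k' : ℕ) (i' : ℤ) :
    m.set k i z k' i' = if k' = k ∧ i' = i then z else m k' i' := by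
  unfold Memory.set
  by_cases h : k' = k
  · subst h
    by_cases h2 : i' = i
    · subst h2; simp
    · simp [h2]
  · simp [h]

@[simp] theorem Memory.set_same (m : Memory) (k : ℕ) (i z : ℤ) : m.set k i z k i = z := by
  simp [Memory.set]

theorem Memory.set_of_ne (m : Memory) {k k' : ℕ} (h : k' ≠ k) (i z : ℤ) : m.set k i z k' = m k' := by
  simp [Memory.set, h]

theorem Memory.Bdd.set {B : ℕ} {m : Memory} (hm : m.Bdd B) {k : ℕ} {i z : ℤ} (hz : |z| < 2 ^ B) :
    (m.set k i z).Bdd B := by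
  intro k' i'
  rw [Memory.set_apply]
  split_ifs
  exacts [hz, hm _ _]

/-- `p` takes the memory `m` to `m'`, deterministically and within the time bound. -/
def Runs (B : ℕ) (p : Prog) (m m' : Memory) : Prop :=
  ∀ (O : Oracle) (F t : ℕ), p.tm B ≤ F →
    ∃ t' ≤ t + p.tm B, p.exec O F ⟨m, t⟩ = PMF.pure (some ⟨m', t'⟩)

section Runs

variable {B : ℕ} {m m' m'' : Memory} {p q : Prog}

theorem Runs.skip : Runs B .skip m m := fun _ _ t _ => ⟨t + 1, le_rfl, rfl⟩

theorem Runs.assign (hm : m.Bdd B) (k : ℕ) (i e : Expr) :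
    Runs B (.assign k i e) m (m.set k (i.eval m) (e.eval m)) := by
  intro O F t _
  refine ⟨_, ?_, rfl⟩
  have h1 := i.cost_le hm
  have h2 := e.cost_le hm
  simp only [Prog.tm]
  omega

theorem Runs.seq (h1 : Runs B p m m') (h2 : Runs B q m' m'') : Runs B (.seq p q) m m'' := by
  intro O F t hF
  simp only [Prog.tm] at hF
  obtain ⟨t1, ht1, he1⟩ := h1 O F t (by omega)
  obtain ⟨t2, ht2, he2⟩ := h2 O F t1 (by omega)
  refine ⟨t2, by simp only [Prog.tm]; omega, ?_⟩
  rw [Prog.exec, he1, PMF.pure_bind]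
  exact he2

theorem Runs.ite_pos (hm : m.Bdd B) {e : Expr} (he : 0 < e.eval m) (h : Runs B p m m') :
    Runs B (.ite e p q) m m' := by
  intro O F t hF
  simp only [Prog.tm] at hF
  have hc := e.cost_le hm
  obtain ⟨t1, ht1, he1⟩ := h O F (t + (1 + e.cost m)) (by omega)
  refine ⟨t1, by simp only [Prog.tm]; omega, ?_⟩
  rw [Prog.exec, if_pos he]
  exact he1

theorem Runs.ite_neg (hm : m.Bdd B) {e : Expr} (he : e.eval m ≤ 0) (h : Runs B q m m') :
    Runs B (.ite e p q) m m' := by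
  intro O F t hF
  simp only [Prog.tm] at hF
  have hc := e.cost_le hm
  obtain ⟨t1, ht1, he1⟩ := h O F (t + (1 + e.cost m)) (by omega)
  refine ⟨t1, by simp only [Prog.tm]; omega, ?_⟩
  rw [Prog.exec, if_neg (not_lt.mpr he)]
  exact he1

/-- A loop with an invariant indexed by the number of rounds done so far. -/
theorem Runs.loop {e : Expr} {c : ℕ} (hc : c ≤ B) (I : ℕ → Memory → Prop) (h0 : I 0 m)
    (hb : ∀ i m, I i m → m.Bdd B)
    (hexit : ∀ m, I c m → e.eval m ≤ 0)
    (hstep : ∀ i m, i < c → I i m → 0 < e.eval m ∧ ∃ m', Runs B p m m' ∧ I (i + 1) m') :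
    ∃ m', Runs B (.loop e p) m m' ∧ I c m' := by
  -- `d` is the number of rounds to come. The cap `G` of this loop decreases from round to round and
  -- is kept apart from the cap `F` for the body.
  have key : ∀ d i m, i + d = c → I i m → ∃ m', I c m' ∧ ∀ (O : Oracle) (F t G : ℕ),
      p.tm B ≤ F → d + 1 ≤ G → ∃ t' ≤ t + (d + 1) * (1 + e.costWt * (B + 1) + p.tm B),
      iterateLoop e (p.exec O F) G ⟨m, t⟩ = PMF.pure (some ⟨m', t'⟩) := by
    intro d
    induction d with
    | zero =>
      intro i m hi hI
      obtain rfl : i = c := by omega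
      refine ⟨m, hI, fun O F t G _ hG => ?_⟩
      obtain ⟨G', rfl⟩ := Nat.exists_eq_add_of_le' hG
      have hcost := e.cost_le (hb _ _ hI)
      refine ⟨t + (1 + e.cost m), by omega, ?_⟩
      rw [zero_add, iterateLoop, if_neg (not_lt.mpr (hexit m hI))]
      rfl
    | succ d ih =>
      intro i m hi hI
      obtain ⟨hpos, m1, hrun, hI1⟩ := hstep i m (by omega) hI
      obtain ⟨m', hI', hloop⟩ := ih (i + 1) m1 (by omega) hI1
      refine ⟨m', hI', fun O F t G hF hG => ?_⟩
      obtain ⟨G', rfl⟩ := Nat.exists_eq_add_of_le' hG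
      have hcost := e.cost_le (hb _ _ hI)
      obtain ⟨t1, ht1, he1⟩ := hrun O F (t + (1 + e.cost m)) hF
      obtain ⟨t2, ht2, he2⟩ := hloop O F t1 (G' + (d + 1)) hF (by omega)
      refine ⟨t2, ?_, ?_⟩
      · rw [add_mul (d + 1) 1]
        omega
      · rw [← add_assoc, iterateLoop, if_pos hpos]
        change PMF.bind (p.exec O F ⟨m, t + (1 + e.cost m)⟩) _ = _
        rw [he1, PMF.pure_bind]
        exact he2
  obtain ⟨m', hI', h⟩ := key c 0 m (by omega) h0
  refine ⟨m', fun O F t hF => ?_, hI'⟩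
  simp only [Prog.tm] at hF
  have h1 : B + 1 ≤ F := le_trans (Nat.le_mul_of_pos_right _ (by omega)) hF
  have h2 : p.tm B ≤ F := le_trans (by nlinarith [Nat.zero_le (p.tm B), Nat.zero_le (e.costWt * (B + 1))]) hF
  obtain ⟨t', ht', he⟩ := h O F t F h2 (by omega)
  refine ⟨t', ht'.trans ?_, he⟩
  simp only [Prog.tm]
  gcongr

/-- `for v = 0, …, N - 1 do p`. -/
def forP (v : ℕ) (N : Expr) (p : Prog) : Prog :=
  .seq (.assign v 0 0)
    (.loop (N - .get v 0) (.seq p (.assign v 0 (.get v 0 + 1))))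

theorem Runs.for {v : ℕ} {N : Expr} {c : ℕ} (hc : c ≤ B) (hm : m.Bdd B) (I : ℕ → Memory → Prop)
    (h0 : I 0 (m.set v 0 0))
    (hI : ∀ i m, I i m → m.Bdd B ∧ m v 0 = i ∧ N.eval m = c)
    (hstep : ∀ i m, i < c → I i m →
      ∃ m', Runs B p m m' ∧ m'.Bdd B ∧ m' v 0 = i ∧ I (i + 1) (m'.set v 0 (i + 1))) :
    ∃ m', Runs B (forP v N p) m m' ∧ I c m' := by
  have h1 : Runs B (.assign v 0 0) m (m.set v 0 0) := Runs.assign hm v 0 0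
  obtain ⟨m', hrun, hI'⟩ := Runs.loop (p := .seq p (.assign v 0 (.get v 0 + 1)))
    (e := N - .get v 0) hc I h0 (fun i m h => (hI i m h).1)
    (fun m h => by
      obtain ⟨-, h2, h3⟩ := hI c m h
      simp [h2, h3])
    (fun i m hi h => by
      obtain ⟨-, h2, h3⟩ := hI i m h
      refine ⟨by simp [h2, h3, hi], ?_⟩
      obtain ⟨m', hr, hb, hv, hI'⟩ := hstep i m hi h
      refine ⟨_, hr.seq (Runs.assign hb v 0 (.get v 0 + 1)), ?_⟩
      simpa [hv] using hI')
  exact ⟨m', h1.seq hrun, hI'⟩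

/-- `m'` agrees with `m` outside the arrays in `S`. -/
def Agree (S : List ℕ) (m m' : Memory) : Prop := ∀ k, k ∉ S → m' k = m k

theorem Agree.refl (S : List ℕ) (m : Memory) : Agree S m m := fun _ _ => rfl

theorem Agree.trans {S : List ℕ} (h1 : Agree S m m') (h2 : Agree S m' m'') : Agree S m m'' :=
  fun k hk => (h2 k hk).trans (h1 k hk)

theorem Agree.mono {S S' : List ℕ} (h : Agree S m m') (hS : S ⊆ S') : Agree S' m m' :=
  fun k hk => h k fun hk' => hk (hS hk')

theorem Agree.set {S : List ℕ} (h : Agree S m m') {k : ℕ} (hk : k ∈ S) (i z : ℤ) :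
    Agree S m (m'.set k i z) := fun k' hk' => by
  rw [Memory.set_of_ne _ (by rintro rfl; exact hk' hk)]; exact h k' hk'

theorem Agree.apply {S : List ℕ} (h : Agree S m m') {k : ℕ} (hk : k ∉ S) (i : ℤ) :
    m' k i = m k i := by rw [h k hk]

theorem natCast_lt_two_pow {x B : ℕ} (h : x ≤ B) : |(x : ℤ)| < 2 ^ B := by
  rw [abs_of_nonneg (by positivity)]
  exact_mod_cast h.trans_lt Nat.lt_two_pow_self

/-- `d := ∑ v < N, (p; e)`: the program `p` is run before every evaluation of `e`. -/
def sumP (d v : ℕ) (N : Expr) (p : Prog) (e : Expr) : Prog :=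
  .seq (.assign d 0 0) (forP v N (.seq p (.assign d 0 (.get d 0 + e))))

/-- `hg` speaks of all partial sums, since each of them is held in the cell `d` at some time. `S`
collects the arrays that the body may overwrite. -/
theorem Runs.sum {d v : ℕ} {N e : Expr} {c : ℕ} (S : List ℕ) (hdv : d ≠ v) (hdS : d ∉ S)
    (hvS : v ∉ S) (hc : c ≤ B) (hm : m.Bdd B)
    (g : ℕ → ℤ) (hN : ∀ m', Agree (d :: v :: S) m m' → N.eval m' = c)
    (he : ∀ i m', i < c → m'.Bdd B → Agree (d :: v :: S) m m' → m' v 0 = i →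
      ∃ m'', Runs B p m' m'' ∧ m''.Bdd B ∧ Agree S m' m'' ∧ e.eval m'' = g i)
    (hg : ∀ i ≤ c, |∑ j ∈ Finset.range i, g j| < 2 ^ B) :
    ∃ m', Runs B (sumP d v N p e) m m' ∧ m'.Bdd B ∧ Agree (d :: v :: S) m m' ∧
      m' d 0 = ∑ j ∈ Finset.range c, g j := by
  have hz : |(0 : ℤ)| < 2 ^ B := by simp
  have h1 : Runs B (.assign d 0 0) m (m.set d 0 0) := Runs.assign hm d 0 0
  obtain ⟨m', hr, hI⟩ := Runs.for (m := m.set d 0 0) (v := v) (N := N)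
    (p := .seq p (.assign d 0 (.get d 0 + e))) hc (hm.set hz)
    (fun i m' => i ≤ c ∧ m'.Bdd B ∧ Agree (d :: v :: S) m m' ∧ m' v 0 = i ∧
      m' d 0 = ∑ j ∈ Finset.range i, g j)
    ⟨Nat.zero_le _, (hm.set hz).set hz, ((Agree.refl _ _).set (by simp) _ _).set (by simp) _ _,
      by simp, by simp [Memory.set_apply, hdv]⟩
    (fun i m' h => ⟨h.2.1, h.2.2.2.1, hN m' h.2.2.1⟩)
    (fun i m' hi h => by
      obtain ⟨-, hb, ha, hv, hd⟩ := h
      obtain ⟨m₁, hr₁, hb₁, ha₁, he₁⟩ := he i m' hi hb ha hv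
      have hval : (Expr.get d 0 + e).eval m₁ = ∑ j ∈ Finset.range (i + 1), g j := by
        rw [Finset.sum_range_succ]; simp [ha₁.apply hdS, hd, he₁]
      have hr := Runs.assign hb₁ d 0 (.get d 0 + e)
      rw [hval] at hr
      have hb₂ := hb₁.set (k := d) (i := (0 : Expr).eval m₁) (hg _ hi)
      have ha₂ : Agree (d :: v :: S) m m₁ := ha.trans (ha₁.mono (by simp))
      refine ⟨_, hr₁.seq hr, hb₂, ?_, hi, ?_, ?_, ?_, ?_⟩
      · rw [Memory.set_of_ne _ hdv.symm, ha₁.apply hvS]; exact hv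
      · exact hb₂.set (by exact_mod_cast natCast_lt_two_pow (by omega : i + 1 ≤ B))
      · exact (ha₂.set (by simp) _ _).set (by simp) _ _
      · simp
      · rw [Memory.set_of_ne _ hdv]; simp)
  exact ⟨m', h1.seq hr, hI.2.1, hI.2.2.1, hI.2.2.2.2⟩

/-- Fill `N` consecutive cells of the array `k` with the values of `e`, where `p` is run before
every evaluation of `e`. -/
def fillP (k v : ℕ) (N off : Expr) (p : Prog) (e : Expr) : Prog :=
  forP v N (.seq p (.assign k (off + .get v 0) e))

/-- The body may rely on the cells of `k` that have not been written yet. So new data can be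
computed from older data in the same array. -/
theorem Runs.fill {k v : ℕ} {N off e : Expr} {c : ℕ} {o : ℤ} (S : List ℕ) (hkv : k ≠ v)
    (hkS : k ∉ S) (hvS : v ∉ S) (hc : c ≤ B)
    (hm : m.Bdd B) (g : ℕ → ℤ) (hN : ∀ m', Agree (k :: v :: S) m m' → N.eval m' = c)
    (ho : ∀ m', Agree (k :: v :: S) m m' → off.eval m' = o)
    (he : ∀ i m', i < c → m'.Bdd B → Agree (k :: v :: S) m m' → m' v 0 = i →
      (∀ j, (∀ i' < i, j ≠ o + (i' : ℕ)) → m' k j = m k j) →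
      ∃ m'', Runs B p m' m'' ∧ m''.Bdd B ∧ Agree S m' m'' ∧ e.eval m'' = g i)
    (hg : ∀ i < c, |g i| < 2 ^ B) :
    ∃ m', Runs B (fillP k v N off p e) m m' ∧ m'.Bdd B ∧ Agree (k :: v :: S) m m' ∧
      (∀ i < c, m' k (o + (i : ℕ)) = g i) ∧
      (∀ j, (∀ i < c, j ≠ o + (i : ℕ)) → m' k j = m k j) := by
  have hz : |(0 : ℤ)| < 2 ^ B := by simp
  obtain ⟨m', hr, hI⟩ := Runs.for (m := m) (v := v) (N := N)
    (p := .seq p (.assign k (off + .get v 0) e)) hc hm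
    (fun i m' => i ≤ c ∧ m'.Bdd B ∧ Agree (k :: v :: S) m m' ∧ m' v 0 = i ∧
      (∀ i' < i, m' k (o + (i' : ℕ)) = g i') ∧
      (∀ j, (∀ i' < i, j ≠ o + (i' : ℕ)) → m' k j = m k j))
    ⟨Nat.zero_le _, hm.set hz, (Agree.refl _ _).set (by simp) _ _, by simp, by simp,
      fun j _ => by rw [Memory.set_of_ne _ hkv]⟩
    (fun i m' h => ⟨h.2.1, h.2.2.2.1, hN m' h.2.2.1⟩)
    (fun i m' hi h => by
      obtain ⟨-, hb, ha, hv, hd, hd'⟩ := h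
      obtain ⟨m₁, hr₁, hb₁, ha₁, hval⟩ := he i m' hi hb ha hv hd'
      have ha₂ : Agree (k :: v :: S) m m₁ := ha.trans (ha₁.mono (by simp))
      have hv₁ : m₁ v 0 = i := by rw [ha₁.apply hvS]; exact hv
      have hidx : (off + .get v 0 : Expr).eval m₁ = o + i := by simp [ho m₁ ha₂, hv₁]
      have hr := Runs.assign hb₁ k (off + .get v 0) e
      rw [hval, hidx] at hr
      have hb₂ := hb₁.set (k := k) (i := o + i) (hg _ hi)
      refine ⟨_, hr₁.seq hr, hb₂, ?_, hi, ?_, ?_, ?_, ?_, ?_⟩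
      · rw [Memory.set_of_ne _ hkv.symm]; exact hv₁
      · exact hb₂.set (by exact_mod_cast natCast_lt_two_pow (by omega : i + 1 ≤ B))
      · exact (ha₂.set (by simp) _ _).set (by simp) _ _
      · simp
      · intro i' hi'
        rw [Memory.set_of_ne _ hkv, Memory.set_apply, ha₁.apply hkS]
        rcases Nat.lt_succ_iff_lt_or_eq.mp hi' with h | rfl
        · rw [if_neg (by omega)]; exact hd i' h
        · simp
      · intro j hj
        rw [Memory.set_of_ne _ hkv, Memory.set_apply, if_neg (by simpa using hj i (by omega)),
          ha₁.apply hkS]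
        exact hd' j fun i' hi' => hj i' (by omega))
  exact ⟨m', hr, hI.2.1, hI.2.2.1, hI.2.2.2.2.1, hI.2.2.2.2.2⟩

end Runs

/-! ### Expectations -/

/-- The expectation of a nonnegative function. -/
def PMF.expect {α : Type*} (p : PMF α) (f : α → ℝ≥0∞) : ℝ≥0∞ := ∑' a, p a * f a

theorem PMF.expect_pure {α : Type*} (a : α) (f : α → ℝ≥0∞) : (PMF.pure a).expect f = f a := by
  rw [PMF.expect, tsum_eq_single a]
  · simp
  · intro b hb; simp [hb]

theorem PMF.expect_bind {α β : Type*} (p : PMF α) (g : α → PMF β) (f : β → ℝ≥0∞) :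
    (p.bind g).expect f = p.expect fun a => (g a).expect f := by
  simp only [PMF.expect, PMF.bind_apply, ← ENNReal.tsum_mul_right, ← ENNReal.tsum_mul_left]
  rw [ENNReal.tsum_comm]
  simp only [mul_assoc]

theorem PMF.expect_map {α β : Type*} (p : PMF α) (g : α → β) (f : β → ℝ≥0∞) :
    (p.map g).expect f = p.expect (f ∘ g) := by
  rw [PMF.map, PMF.expect_bind]
  simp only [Function.comp_apply, PMF.expect_pure]
  rfl

theorem PMF.expect_mono {α : Type*} (p : PMF α) {f g : α → ℝ≥0∞} (h : ∀ a, f a ≤ g a) :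
    p.expect f ≤ p.expect g := ENNReal.tsum_le_tsum fun a => by gcongr; exact h a

/-- The function `f` of the final memory, or `∞` for a run that fails or takes too long. -/
def postVal (f : Memory → ℝ≥0∞) (T : ℕ) : Option Config → ℝ≥0∞
  | none => ⊤
  | some c => if c.time ≤ T then f c.mem else ⊤

theorem postVal_mono (f : Memory → ℝ≥0∞) {T T' : ℕ} (h : T ≤ T') (r : Option Config) :
    postVal f T' r ≤ postVal f T r := by
  rcases r with _ | c
  · exact le_rfl
  · simp only [postVal]
    split_ifs with h1 h2 h2
    · exact le_rfl
    · exact le_top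
    · omega
    · exact le_rfl

/-- The expectation of `f` after a run of `p` is at most `v` (and the time bound is kept, unless
`v = ∞`). -/
def Wp (B : ℕ) (O : Oracle) (p : Prog) (m : Memory) (f : Memory → ℝ≥0∞) (v : ℝ≥0∞) : Prop :=
  ∀ F t, p.tm B ≤ F → (p.exec O F ⟨m, t⟩).expect (postVal f (t + p.tm B)) ≤ v

section Wp

variable {B : ℕ} {O : Oracle} {p q : Prog} {m m' : Memory} {f g : Memory → ℝ≥0∞} {v w : ℝ≥0∞}

theorem Runs.wp (h : Runs B p m m') : Wp B O p m f (f m') := by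
  intro F t hF
  obtain ⟨t', ht', he⟩ := h O F t hF
  rw [he, PMF.expect_pure, postVal, if_pos ht']

theorem Wp.mono (h : Wp B O p m f v) (hv : v ≤ w) : Wp B O p m f w :=
  fun F t hF => (h F t hF).trans hv

theorem Wp.top : Wp B O p m f ⊤ := fun _ _ _ => le_top

/-- Memories of value `⊤` need no treatment, as every bound holds there. Invariants are therefore
expressed by functions that are `⊤` wherever the invariant fails. -/
theorem Wp.seq (h1 : Wp B O p m g v) (h2 : ∀ m', g m' ≠ ⊤ → Wp B O q m' f (g m')) :
    Wp B O (.seq p q) m f v := by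
  intro F t hF
  simp only [Prog.tm] at hF
  refine le_trans ?_ (h1 F t (by omega))
  rw [Prog.exec, PMF.expect_bind]
  refine PMF.expect_mono _ fun r => ?_
  rcases r with _ | c
  · exact le_top
  · simp only [postVal]
    split_ifs with ht
    · by_cases hg : g c.mem = ⊤
      · rw [hg]; exact le_top
      · refine le_trans (PMF.expect_mono _ (postVal_mono f ?_)) (h2 c.mem hg F c.time (by omega))
        simp only [Prog.tm]; omega
    · exact le_top

/-- `g d` is the bound with `d` rounds to come, so the index runs backwards. -/
theorem Wp.loop {e : Expr} {c : ℕ} (hc : c ≤ B) (g : ℕ → Memory → ℝ≥0∞)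
    (hexit : ∀ m, g 0 m ≠ ⊤ → m.Bdd B ∧ e.eval m ≤ 0 ∧ f m ≤ g 0 m)
    (hstep : ∀ j m, j < c → g (j + 1) m ≠ ⊤ →
      m.Bdd B ∧ 0 < e.eval m ∧ Wp B O p m (g j) (g (j + 1) m)) :
    Wp B O (.loop e p) m f (g c m) := by
  have key : ∀ d m F G t, d ≤ c → p.tm B ≤ F → d + 1 ≤ G →
      (iterateLoop e (p.exec O F) G ⟨m, t⟩).expect
        (postVal f (t + (d + 1) * (1 + e.costWt * (B + 1) + p.tm B))) ≤ g d m := by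
    intro d
    induction d with
    | zero =>
      intro m F G t _ hF hG
      obtain ⟨G', rfl⟩ := Nat.exists_eq_add_of_le' hG
      by_cases hg : g 0 m = ⊤
      · rw [hg]; exact le_top
      obtain ⟨hb, he, hf⟩ := hexit m hg
      have hcost := e.cost_le hb
      rw [zero_add, iterateLoop, if_neg (not_lt.mpr he), PMF.expect_pure]
      have ht : t + (1 + e.cost m) ≤ t + 1 * (1 + e.costWt * (B + 1) + p.tm B) := by omega
      exact (if_pos ht).le.trans hf
    | succ d ih =>
      intro m F G t hd hF hG
      obtain ⟨G', rfl⟩ := Nat.exists_eq_add_of_le' hG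
      by_cases hg : g (d + 1) m = ⊤
      · rw [hg]; exact le_top
      obtain ⟨hb, he, hw⟩ := hstep d m (by omega) hg
      have hcost := e.cost_le hb
      refine le_trans ?_ (hw F (t + (1 + e.cost m)) hF)
      rw [← add_assoc, iterateLoop, if_pos he, PMF.expect_bind]
      refine PMF.expect_mono _ fun r => ?_
      rcases r with _ | c'
      · exact le_top
      · simp only [postVal]
        split_ifs with ht
        · refine le_trans (PMF.expect_mono _ (postVal_mono f ?_))
            (ih c'.mem F (G' + (d + 1)) c'.time (by omega) hF (by omega))
          rw [add_mul (d + 1) 1]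
          omega
        · exact le_top
  intro F t hF
  simp only [Prog.tm] at hF
  have h1 : B + 1 ≤ F := le_trans (Nat.le_mul_of_pos_right _ (by omega)) hF
  have h2 : p.tm B ≤ F := le_trans (by nlinarith [Nat.zero_le (p.tm B), Nat.zero_le (e.costWt * (B + 1))]) hF
  refine le_trans (PMF.expect_mono _ (postVal_mono f ?_)) (key c m F F t le_rfl h2 (by omega))
  simp only [Prog.tm]
  gcongr

theorem Wp.query {k k' : ℕ} {b : Expr} {l : List ℤ} {bv : ℕ} (hm : m.Bdd B)
    (hb : b.eval m = bv) (hbv : bv ≤ B) (hl : readList (m k) = l) (hlen : l.length ≤ B) :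
    Wp B O (.query k k' b) m f
      ((O l).expect fun a => f (Function.update m k' (receive bv a))) := by
  intro F t _
  have hls : listSize l ≤ B * (B + 1) := by
    have h1 : ∀ x ∈ l.map bitLen, x ≤ B + 1 := by
      intro x hx
      obtain ⟨z, hz, rfl⟩ := List.mem_map.mp hx
      rw [← hl, readList] at hz
      obtain ⟨j, -, rfl⟩ := List.mem_map.mp hz
      exact bitLen_le_iff.mpr (hm k _)
    have := List.sum_le_card_nsmul _ _ h1
    rw [List.length_map, smul_eq_mul] at this
    exact this.trans (by gcongr)
  have hcost := b.cost_le hm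
  rw [Prog.exec, PMF.expect_map, hl, hb]
  refine PMF.expect_mono _ fun a => ?_
  simp only [Function.comp_apply, postVal, Int.toNat_natCast]
  rw [if_pos]
  simp only [Prog.tm]
  omega

open Classical in
/-- `for` loops whose bodies may query the oracle. -/
theorem Wp.for {v' : ℕ} {N : Expr} {c : ℕ} (hc : c ≤ B) (hm : m.Bdd B)
    (g : ℕ → Memory → ℝ≥0∞)
    (hexit : ∀ m, g 0 m ≠ ⊤ → m.Bdd B ∧ m v' 0 = c ∧ N.eval m = c ∧ f m ≤ g 0 m)
    (hstep : ∀ j m, j < c → g (j + 1) m ≠ ⊤ →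
      m.Bdd B ∧ m v' 0 = c - (j + 1 : ℕ) ∧ N.eval m = c ∧
      Wp B O p m (fun m' => if m'.Bdd B then g j (m'.set v' 0 (m' v' 0 + 1)) else ⊤) (g (j + 1) m)) :
    Wp B O (forP v' N p) m f (g c (m.set v' 0 0)) := by
  refine Wp.seq (g := fun m' => g c m') (Runs.assign hm v' 0 0).wp fun m' _ => ?_
  refine Wp.loop hc g (fun m h => ?_) (fun j m hj h => ?_)
  · obtain ⟨h1, h2, h3, h4⟩ := hexit m h
    exact ⟨h1, by simp [h2, h3], h4⟩
  · obtain ⟨h1, h2, h3, h4⟩ := hstep j m hj h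
    refine ⟨h1, by simp [h2, h3], h4.seq fun m' hm' => ?_⟩
    split_ifs with hb
    · exact (Runs.assign hb v' 0 (.get v' 0 + 1)).wp
    · exact Wp.top

end Wp

end

noncomputable section

/-! ### Matrices in memory -/

/-- `1` if `a = b` and `0` otherwise. -/
def Expr.ind (a b : Expr) : Expr := 1 / (1 + (a - b) * (a - b))

/-- The remainder of `a` modulo `b`. -/
def Expr.mod (a b : Expr) : Expr := a - b * (a / b)

@[simp] theorem Expr.eval_ind (m : Memory) (a b : Expr) :
    (Expr.ind a b).eval m = if a.eval m = b.eval m then 1 else 0 := by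
  simp only [Expr.ind, Expr.eval_div, Expr.eval_one, Expr.eval_add, Expr.eval_mul, Expr.eval_sub]
  split_ifs with h
  · simp [h]
  · have h1 : a.eval m - b.eval m ≠ 0 := sub_ne_zero.mpr h
    have h2 := mul_self_pos.mpr h1
    exact Int.ediv_eq_zero_of_lt (by norm_num) (by linarith)

@[simp] theorem Expr.eval_mod (m : Memory) (a b : Expr) :
    (Expr.mod a b).eval m = a.eval m % b.eval m := by
  simp [Expr.mod, Int.emod_def]

section

variable {B : ℕ} {m : Memory}

/-- Fill a square matrix, whose dimension is in cell `1` of array `0`. -/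
def fillMatrixP (k v : ℕ) (off : Expr) (p : Prog) (e : Expr) : Prog :=
  fillP k v (.get 0 1 * .get 0 1) off p e

/-- The counter t stands for row t / n and column t mod n; the proof translates between the two
indexings once and for all. -/
theorem Runs.fillMatrix {n : ℕ} (hn0 : m 0 1 = n) (hn : n * n ≤ B) {k v : ℕ} {off e : Expr}
    {p : Prog} {o : ℤ} (S : List ℕ) (hkv : k ≠ v) (hkS : k ∉ S) (hvS : v ∉ S)
    (h0 : 0 ∉ k :: v :: S) (hm : m.Bdd B) (A : Matrix (Fin n) (Fin n) ℤ)
    (ho : ∀ m', Agree (k :: v :: S) m m' → off.eval m' = o)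
    (he : ∀ (i j : Fin n) m', m'.Bdd B → Agree (k :: v :: S) m m' → m' v 0 = (i : ℤ) * n + j →
      m' v 0 / n = i → m' v 0 % n = j → (∀ l < o, m' k l = m k l) →
      ∃ m'', Runs B p m' m'' ∧ m''.Bdd B ∧ Agree S m' m'' ∧ e.eval m'' = A i j)
    (hA : ∀ i j, |A i j| < 2 ^ B) :
    ∃ m', Runs B (fillMatrixP k v off p e) m m' ∧ m'.Bdd B ∧ Agree (k :: v :: S) m m' ∧
      (∀ i j : Fin n, m' k (o + ((i : ℤ) * n + j)) = A i j) ∧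
      (∀ l < o, m' k l = m k l) := by
  have hdm : ∀ t < n * n, ∃ i j : Fin n, t = i * n + j := by
    intro t ht
    have hpos : 0 < n := Nat.pos_of_mul_pos_left (t.zero_le.trans_lt ht)
    exact ⟨⟨t / n, Nat.div_lt_of_lt_mul ht⟩, ⟨t % n, Nat.mod_lt _ hpos⟩,
      by simp [mul_comm, Nat.div_add_mod]⟩
  choose I J hIJ using hdm
  have hlt : ∀ i j : Fin n, (i : ℕ) * n + j < n * n := fun i j => by
    have := i.2; have := j.2; nlinarith
  have hdiv : ∀ i j : Fin n, ((i : ℤ) * n + j) / n = i := fun i j => by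
    have : 0 < (n : ℤ) := by have := i.2; omega
    rw [add_comm, Int.add_mul_ediv_right _ _ this.ne',
      Int.ediv_eq_zero_of_lt (by positivity) (by exact_mod_cast j.2), zero_add]
  have hmod : ∀ i j : Fin n, ((i : ℤ) * n + j) % n = j := fun i j => by
    rw [add_comm, Int.add_mul_emod_self_right]
    exact Int.emod_eq_of_lt (by positivity) (by exact_mod_cast j.2)
  obtain ⟨m', hr, hb, ha, hv, hv'⟩ := Runs.fill (N := .get 0 1 * .get 0 1) (off := off) (e := e)
    (p := p) (o := o) S hkv hkS hvS hn hm (fun t => if h : t < n * n then A (I t h) (J t h) else 0)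
    (fun m' ha => by simp [ha.apply h0, hn0]) ho
    (fun t m' ht hb ha hv hl => by
      have hv2 : m' v 0 = (I t ht : ℤ) * n + J t ht := by
        rw [hv]; exact_mod_cast congrArg (Nat.cast (R := ℤ)) (hIJ t ht)
      simp only [ht, dif_pos]
      exact he _ _ m' hb ha hv2 (by rw [hv2]; exact hdiv _ _) (by rw [hv2]; exact hmod _ _)
        fun l hlo => hl l fun i' _ => by omega)
    (fun t ht => by simp only [ht, dif_pos]; exact hA _ _)
  refine ⟨m', hr, hb, ha, fun i j => ?_, fun l hl => hv' l fun i _ => by omega⟩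
  have h := hv _ (hlt i j)
  push_cast at h
  rw [h, dif_pos (hlt i j)]
  have h2 := hIJ _ (hlt i j)
  have h3 : ((i : ℤ) * n + j) = (I _ (hlt i j) : ℤ) * n + J _ (hlt i j) := by
    exact_mod_cast congrArg (Nat.cast (R := ℤ)) h2
  have h4 := hdiv i j
  have h5 := hmod i j
  rw [h3, hdiv] at h4
  rw [h3, hmod] at h5
  have e1 : I _ (hlt i j) = i := Fin.ext (by exact_mod_cast h4)
  have e2 : J _ (hlt i j) = j := Fin.ext (by exact_mod_cast h5)
  rw [e1, e2]

/-- The Faddeev–LeVerrier algorithm for the matrix in array `4`. The result is left in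
array `15`. -/
def faddeevLeVerrierP : Prog :=
  .seq (fillMatrixP 5 20 0 .skip 0) <|
  .seq (.assign 15 0 1) <|
  forP 21 (.get 0 1) <|
  -- Round k reads its matrix at offset k n² of array 5 and writes the next one at offset (k + 1)
  -- n², so nothing it still needs is overwritten.
  .seq (fillMatrixP 5 20 ((.get 21 0 + 1) * .get 0 1 * .get 0 1)
    (sumP 17 22 (.get 0 1) .skip
      (.get 4 (.get 20 0 / .get 0 1 * .get 0 1 + .get 22 0) *
        (.get 5 (.get 21 0 * .get 0 1 * .get 0 1 +
          (.get 22 0 * .get 0 1 + Expr.mod (.get 20 0) (.get 0 1))) +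
          .get 15 0 * Expr.ind (.get 22 0) (Expr.mod (.get 20 0) (.get 0 1)))))
    (.get 17 0)) <|
  .seq (sumP 14 22 (.get 0 1) .skip
    (.get 5 ((.get 21 0 + 1) * .get 0 1 * .get 0 1 + (.get 22 0 * .get 0 1 + .get 22 0)))) <|
  .assign 15 0 ((0 - .get 14 0) / (.get 21 0 + 1))

theorem sum_range_extend {n : ℕ} (f : Fin n → ℤ) :
    ∑ l ∈ Finset.range n, (if h : l < n then f ⟨l, h⟩ else 0) = ∑ l, f l := by
  rw [Finset.sum_range]
  exact Finset.sum_congr rfl fun l _ => by simp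

theorem abs_sum_range_extend_le {n : ℕ} (f : Fin n → ℤ) {z : ℤ} (hz : ∀ i, |f i| ≤ z) (h0 : 0 ≤ z)
    {i : ℕ} (hi : i ≤ n) :
    |∑ l ∈ Finset.range i, (if h : l < n then f ⟨l, h⟩ else 0)| ≤ n * z := by
  refine (Finset.abs_sum_le_sum_abs _ _).trans ((Finset.sum_le_card_nsmul _ _ z fun l hl => ?_).trans ?_)
  · split_ifs
    exacts [hz _, by simpa using h0]
  · rw [Finset.card_range, nsmul_eq_mul]
    gcongr

/-- The power in `hzB` bounds the matrices, the coefficients and the partial sums of matrix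
products; the extra factor `n` is for the partial sums of the trace. -/
theorem Runs.faddeevLeVerrier {n : ℕ} (hn : 0 < n) (hn0 : m 0 1 = n) (hnB : n * n ≤ B)
    (hm : m.Bdd B) (A : Matrix (Fin n) (Fin n) ℤ)
    (hA : ∀ i j : Fin n, m 4 ((i : ℤ) * n + j) = A i j) {z : ℤ} (hz1 : 1 ≤ z)
    (hz : ∀ i j, |A i j| ≤ z) (hzB : n * (2 * (n : ℤ) ^ 2 * z) ^ n < 2 ^ B) :
    ∃ m', Runs B faddeevLeVerrierP m m' ∧ m'.Bdd B ∧ Agree [5, 14, 15, 17, 20, 21, 22] m m' ∧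
      m' 15 0 = (_root_.faddeevLeVerrier A n).2 := by
  have hn1 : (1 : ℤ) ≤ n := by exact_mod_cast hn
  have hnB' : n ≤ B := (Nat.le_mul_of_pos_left n hn).trans hnB
  have hone : |(1 : ℤ)| < 2 ^ B := by simpa using natCast_lt_two_pow (hn.trans_le hnB' : 1 ≤ B)
  have hw1 : 1 ≤ 2 * (n : ℤ) ^ 2 * z := by nlinarith [sq_nonneg ((n : ℤ) - 1)]
  have hpow : ∀ k ≤ n, (2 * (n : ℤ) ^ 2 * z) ^ k ≤ (2 * (n : ℤ) ^ 2 * z) ^ n := fun k hk =>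
    pow_le_pow_right₀ hw1 hk
  have hlt : ∀ k ≤ n, (2 * (n : ℤ) ^ 2 * z) ^ k < 2 ^ B := fun k hk =>
    (hpow k hk).trans_lt ((le_mul_of_one_le_left (by positivity) hn1).trans_lt hzB)
  have hbd := abs_faddeevLeVerrier_le hn A hz
  obtain ⟨m₁, hr₁, hb₁, ha₁, hv₁, -⟩ := Runs.fillMatrix (m := m) hn0 hnB (k := 5) (v := 20) (off := 0)
    (e := 0) (p := .skip) (o := 0) [] (by decide) (by decide) (by decide) (by decide) hm 0
    (fun _ _ => rfl) (fun i j m' hb _ _ _ _ _ => ⟨m', Runs.skip, hb, Agree.refl _ _, rfl⟩)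
    (fun i j => by simp)
  have hr₂ : Runs B (.assign 15 0 1) m₁ (m₁.set 15 0 1) := Runs.assign hb₁ 15 0 1
  have hb₂ : (m₁.set 15 0 1).Bdd B := hb₁.set hone
  have ha₂ : Agree [5, 14, 15, 17, 20, 21, 22] m (m₁.set 15 0 1) :=
    (ha₁.mono (by decide)).set (by decide) _ _
  obtain ⟨m', hr₃, hI⟩ := Runs.for (m := m₁.set 15 0 1) (v := 21) (N := .get 0 1) (p :=
    .seq (fillMatrixP 5 20 ((.get 21 0 + 1) * .get 0 1 * .get 0 1)
      (sumP 17 22 (.get 0 1) .skip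
      (.get 4 (.get 20 0 / .get 0 1 * .get 0 1 + .get 22 0) *
        (.get 5 (.get 21 0 * .get 0 1 * .get 0 1 +
          (.get 22 0 * .get 0 1 + Expr.mod (.get 20 0) (.get 0 1))) +
          .get 15 0 * Expr.ind (.get 22 0) (Expr.mod (.get 20 0) (.get 0 1)))))
      (.get 17 0)) <|
    .seq (sumP 14 22 (.get 0 1) .skip
      (.get 5 ((.get 21 0 + 1) * .get 0 1 * .get 0 1 + (.get 22 0 * .get 0 1 + .get 22 0)))) <|
      .assign 15 0 ((0 - .get 14 0) / (.get 21 0 + 1))) hnB' hb₂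
    (fun k m' => m'.Bdd B ∧ Agree [5, 14, 15, 17, 20, 21, 22] m m' ∧ m' 21 0 = k ∧
      m' 15 0 = (_root_.faddeevLeVerrier A k).2 ∧
      ∀ i j : Fin n, m' 5 ((k : ℤ) * n * n + ((i : ℤ) * n + j)) = (_root_.faddeevLeVerrier A k).1 i j)
    ⟨hb₂.set (by simp), ha₂.set (by decide) _ _, by simp, by simp [Memory.set_apply, _root_.faddeevLeVerrier],
      fun i j => by
        have := hv₁ i j
        simp only [zero_add] at this
        simp [Memory.set_apply, this, _root_.faddeevLeVerrier]⟩
    (fun k m' h => ⟨h.1, h.2.2.1, by simp [h.2.1.apply, hn0]⟩)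
    (fun k m' hk h => by
      obtain ⟨hb, ha, hk0, hc, hY⟩ := h
      have hn0' : m' 0 1 = n := by rw [ha.apply (by decide), hn0]
      set Y := (_root_.faddeevLeVerrier A k).1 with hYdef
      set c := (_root_.faddeevLeVerrier A k).2 with hcdef
      obtain ⟨hY1, hc1⟩ := hbd k
      obtain ⟨hY2, hc2⟩ := hbd (k + 1)
      have hstep1 : (_root_.faddeevLeVerrier A (k + 1)).1 = A * (Y + c • 1) := rfl
      have hstep2 : (_root_.faddeevLeVerrier A (k + 1)).2 =
        -(_root_.faddeevLeVerrier A (k + 1)).1.trace / ((k : ℤ) + 1) := rfl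
      have hkn : (2 * (n : ℤ) ^ 2 * z) ^ k * (2 * (n : ℤ) ^ 2 * z) ≤ (2 * (n : ℤ) ^ 2 * z) ^ n := by
        rw [← pow_succ]; exact hpow _ hk
      obtain ⟨m₃, hr₃, hb₃, ha₃, hv₃, hw₃⟩ := Runs.fillMatrix (m := m') hn0' hnB (k := 5) (v := 20)
        (off := (.get 21 0 + 1) * .get 0 1 * .get 0 1) (e := .get 17 0)
        (p := sumP 17 22 (.get 0 1) .skip
      (.get 4 (.get 20 0 / .get 0 1 * .get 0 1 + .get 22 0) *
        (.get 5 (.get 21 0 * .get 0 1 * .get 0 1 +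
          (.get 22 0 * .get 0 1 + Expr.mod (.get 20 0) (.get 0 1))) +
          .get 15 0 * Expr.ind (.get 22 0) (Expr.mod (.get 20 0) (.get 0 1)))))
        (o := ((k : ℤ) + 1) * n * n) [17, 22] (by decide) (by decide) (by decide) (by decide) hb
        (_root_.faddeevLeVerrier A (k + 1)).1
        (fun m'' ha'' => by simp [ha''.apply, hk0, hn0'])
        (fun i j m₄ hb₄ ha₄ hv₄ hdiv hmod hl => by
          obtain ⟨m₅, hr₅, hb₅, ha₅, hv₅⟩ := Runs.sum (m := m₄) (d := 17) (v := 22) (N := .get 0 1)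
            (p := .skip)
            (e := .get 4 (.get 20 0 / .get 0 1 * .get 0 1 + .get 22 0) *
              (.get 5 (.get 21 0 * .get 0 1 * .get 0 1 +
                (.get 22 0 * .get 0 1 + Expr.mod (.get 20 0) (.get 0 1))) +
                .get 15 0 * Expr.ind (.get 22 0) (Expr.mod (.get 20 0) (.get 0 1))))
            [] (by decide) (by decide) (by decide) hnB' hb₄
            (fun l => if h : l < n then A i ⟨l, h⟩ * (Y + c • 1) ⟨l, h⟩ j else 0)
            (fun m'' ha'' => by simp [ha''.apply, ha₄.apply, hn0'])
            (fun l m₅ hln hb₅ ha₅ hl₅ => ⟨m₅, Runs.skip, hb₅, Agree.refl _ _, by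
              -- The cell read lies below the offset (k + 1) n², hence outside the part that this
              -- round writes.
              have h5 : m₄ 5 ((k : ℤ) * n * n + ((l : ℤ) * n + j)) = Y ⟨l, hln⟩ j := by
                rw [hl, ← hY]
                have hj := j.2
                have : l * n + (j : ℕ) < n * n := by nlinarith
                have : (l : ℤ) * n + (j : ℕ) < n * n := by exact_mod_cast this
                nlinarith
              have h4 : m 4 ((i : ℤ) * n + l) = A i ⟨l, hln⟩ := by rw [← hA]
              have hite : (if (l : ℤ) = (j : ℕ) then (1 : ℤ) else 0) =
                  (1 : Matrix (Fin n) (Fin n) ℤ) ⟨l, hln⟩ j := by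
                rw [Matrix.one_apply]
                simp [Fin.ext_iff]
              simp only [Expr.eval_mul, Expr.eval_get, Expr.eval_add, Expr.eval_div, Expr.eval_mod,
                Expr.eval_ind, Expr.eval_zero, Expr.eval_one, hl₅, hln, dif_pos]
              simp only [ha₅.apply (k := 0) (by decide), ha₅.apply (k := 20) (by decide),
                ha₅.apply (k := 4) (by decide), ha₅.apply (k := 5) (by decide),
                ha₅.apply (k := 15) (by decide), ha₅.apply (k := 21) (by decide),
                ha₄.apply (k := 0) (by decide), ha₄.apply (k := 4) (by decide),
                ha₄.apply (k := 15) (by decide), ha₄.apply (k := 21) (by decide), hn0', hdiv, hmod,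
                hk0, hc, h5, hite, ha.apply (k := 4) (by decide), h4,
                Matrix.add_apply, Matrix.smul_apply, smul_eq_mul]⟩)
            (fun l hl => by
              have hterm : ∀ l' : Fin n, |A i l' * (Y + c • 1) l' j| ≤ z * (2 * (2 * (n : ℤ) ^ 2 * z) ^ k) := by
                intro l'
                rw [abs_mul]
                refine mul_le_mul (hz _ _) ?_ (abs_nonneg _) (by linarith)
                rw [Matrix.add_apply, Matrix.smul_apply, smul_eq_mul, two_mul]
                refine (abs_add_le _ _).trans (add_le_add (hY1 _ _) ?_)
                rw [abs_mul]
                refine (mul_le_of_le_one_right (abs_nonneg _) ?_).trans hc1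
                rw [Matrix.one_apply]; split_ifs <;> simp
              refine (abs_sum_range_extend_le (fun l' => A i l' * (Y + c • 1) l' j) hterm
                (by positivity) hl).trans_lt (lt_of_le_of_lt ?_ (hlt n le_rfl))
              refine le_trans ?_ hkn
              have hnn : (n : ℤ) ≤ n ^ 2 := by nlinarith
              have : 0 ≤ (2 * (n : ℤ) ^ 2 * z) ^ k * z := by positivity
              nlinarith)
          refine ⟨m₅, hr₅, hb₅, ha₅, ?_⟩
          rw [Expr.eval_get, Expr.eval_zero, hv₅,
            sum_range_extend fun l => A i l * (Y + c • 1) l j, hstep1, Matrix.mul_apply])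
        (fun i j => (hY2 i j).trans_lt (hlt _ hk))
      have hn3 : m₃ 0 1 = n := by rw [ha₃.apply (by decide), hn0']
      have hk3 : m₃ 21 0 = k := by rw [ha₃.apply (by decide), hk0]
      obtain ⟨m₄, hr₄, hb₄, ha₄, hv₄⟩ := Runs.sum (m := m₃) (d := 14) (v := 22) (N := .get 0 1)
        (p := .skip)
        (e := .get 5 ((.get 21 0 + 1) * .get 0 1 * .get 0 1 + (.get 22 0 * .get 0 1 + .get 22 0)))
        [] (by decide) (by decide) (by decide) hnB' hb₃
        (fun l => if h : l < n then (_root_.faddeevLeVerrier A (k + 1)).1 ⟨l, h⟩ ⟨l, h⟩ else 0)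
        (fun m'' ha'' => by simp [ha''.apply, hn3])
        (fun l m₅ hln hb₅ ha₅ hl₅ => ⟨m₅, Runs.skip, hb₅, Agree.refl _ _, by
          have := hv₃ ⟨l, hln⟩ ⟨l, hln⟩
          simp [hl₅, ha₅.apply, hn3, hk3, hln, this]⟩)
        (fun l hl => (abs_sum_range_extend_le
          (fun l => (_root_.faddeevLeVerrier A (k + 1)).1 l l) (fun l => hY2 l l) (by positivity)
          hl).trans_lt (lt_of_le_of_lt (mul_le_mul_of_nonneg_left (hpow _ hk) (by positivity)) hzB))
      rw [sum_range_extend fun l => (_root_.faddeevLeVerrier A (k + 1)).1 l l] at hv₄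
      have hr₅ := Runs.assign hb₄ 15 0 ((0 - .get 14 0) / (.get 21 0 + 1))
      have hval : ((0 - .get 14 0) / (.get 21 0 + 1) : Expr).eval m₄ =
          (_root_.faddeevLeVerrier A (k + 1)).2 := by
        simp [hv₄, ha₄.apply, hk3, hstep2, Matrix.trace]
      rw [hval] at hr₅
      have hb₅ := hb₄.set (k := 15) (i := 0) (hc2.trans_lt (hlt _ hk))
      refine ⟨_, hr₃.seq (hr₄.seq hr₅), hb₅, ?_, hb₅.set ?_, ?_, ?_, ?_, ?_⟩
      · rw [Memory.set_of_ne _ (by decide), ha₄.apply (by decide), hk3]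
      · exact_mod_cast natCast_lt_two_pow (by omega : k + 1 ≤ B)
      · exact ((((ha.trans (ha₃.mono (by decide))).trans (ha₄.mono (by decide))).set (by decide)
          _ _).set (by decide) _ _)
      · simp
      · rw [Memory.set_of_ne _ (by decide)]; simp
      · intro i j
        rw [Memory.set_of_ne _ (by decide), Memory.set_of_ne _ (by decide), ha₄.apply (by decide),
          ← hv₃]
        push_cast
        ring_nf)
  exact ⟨m', hr₁.seq (hr₂.seq hr₃), hI.1, hI.2.1, hI.2.2.2.1⟩

end

end

noncomputable section

/-! ### Encodings in memory -/

section Encoding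

variable {n : ℕ}

theorem encodeMatrix_eq_ofFn (A : Matrix (Fin n) (Fin n) ℤ) :
    encodeMatrix A = List.ofFn fun t : Fin (n * n) => A t.divNat t.modNat := by
  rw [List.ofFn_mul, encodeMatrix]
  congr 2
  funext i
  congr
  funext j
  have hn : 0 < n := by have := i.2; omega
  congr 1
  · ext
    simp only [Fin.divNat]
    rw [add_comm, Nat.add_mul_div_right _ _ hn, Nat.div_eq_of_lt j.2, zero_add]
  · ext
    simp only [Fin.modNat]
    rw [add_comm, Nat.add_mul_mod_self_right, Nat.mod_eq_of_lt j.2]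

@[simp] theorem length_encodeMatrix (A : Matrix (Fin n) (Fin n) ℤ) :
    (encodeMatrix A).length = n * n := by
  rw [encodeMatrix_eq_ofFn, List.length_ofFn]

theorem getD_encodeMatrix (A : Matrix (Fin n) (Fin n) ℤ) (i j : Fin n) :
    (encodeMatrix A).getD ((i : ℕ) * n + j) 0 = A i j := by
  have hn : 0 < n := by have := i.2; omega
  have hlt : (i : ℕ) * n + j < n * n := by have := i.2; have := j.2; nlinarith
  rw [encodeMatrix_eq_ofFn, List.getD_eq_getElem _ _ (by simpa using hlt), List.getElem_ofFn]
  congr 1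
  · ext
    simp only [Fin.divNat]
    rw [add_comm, Nat.add_mul_div_right _ _ hn, Nat.div_eq_of_lt j.2, zero_add]
  · ext
    simp only [Fin.modNat]
    rw [add_comm, Nat.add_mul_mod_self_right, Nat.mod_eq_of_lt j.2]

theorem storeList_natCast_add_one (l : List ℤ) (i : ℕ) : storeList l ((i : ℤ) + 1) = l.getD i 0 := by
  rw [storeList, if_neg (by omega), if_pos (by omega)]
  congr 1

theorem readList_eq {f : ℤ → ℤ} {l : List ℤ} (h0 : f 0 = l.length)
    (h : ∀ i < l.length, f ((i : ℤ) + 1) = l.getD i 0) : readList f = l := by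
  rw [readList, h0, Int.toNat_natCast]
  refine List.ext_getElem (by simp) fun i h1 h2 => ?_
  rw [List.getElem_map, List.getElem_range, h i h2, List.getD_eq_getElem]

variable (x : LatticeBasis)

theorem LatticeBasis.length_encode : x.encode.length = x.n * x.n + 2 := by
  simp [LatticeBasis.encode]

theorem LatticeBasis.storeList_encode_zero :
    storeList x.encode 0 = (x.n : ℤ) * x.n + 2 := by
  rw [storeList, if_pos rfl, x.length_encode]; push_cast; rfl

theorem LatticeBasis.storeList_encode_mat (i j : Fin x.n) :
    storeList x.encode (3 + ((i : ℤ) * x.n + j)) = x.mat i j := by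
  have h : (3 + ((i : ℤ) * x.n + j)) = (((i : ℕ) * x.n + j + 2 : ℕ) : ℤ) + 1 := by push_cast; ring
  rw [h, storeList_natCast_add_one, ← getD_encodeMatrix x.mat]
  rfl

end Encoding

/-! ### Replacing rows -/

/-- A square matrix with a label for every row. -/
abbrev RowState (n : ℕ) : Type := Matrix (Fin n) (Fin n) ℤ × (Fin n → ℤ)

/-- Replace row `i` by `a` and label it with `A`, unless it already has this label or the new
matrix would be singular. -/
def replaceRow {n : ℕ} (A : ℤ) (a : Fin n → ℤ) (s : RowState n) (i : Fin n) : RowState n :=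
  if (s.1.updateRow i a).det ≠ 0 ∧ s.2 i ≠ A then
    (s.1.updateRow i a, Function.update s.2 i A) else s

/-- Try to replace each of the first `k` rows. -/
def replaceRows {n : ℕ} (A : ℤ) (a : Fin n → ℤ) (s : RowState n) : ℕ → RowState n
  | 0 => s
  | k + 1 => if h : k < n then replaceRow A a (replaceRows A a s k) ⟨k, h⟩ else replaceRows A a s k

theorem replaceRow_bound {n : ℕ} {A : ℤ} {a : Fin n → ℤ} {s : RowState n} {i : Fin n} {z : ℤ}
    (hs : ∀ i j, |s.1 i j| ≤ z) (ha : ∀ j, |a j| ≤ z) (i' j' : Fin n) :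
    |(replaceRow A a s i).1 i' j'| ≤ z := by
  unfold replaceRow
  split_ifs
  · simp only [Matrix.updateRow_apply]
    split_ifs
    exacts [ha _, hs _ _]
  · exact hs _ _

theorem replaceRows_bound {n : ℕ} {A : ℤ} {a : Fin n → ℤ} {s : RowState n} {z : ℤ}
    (hs : ∀ i j, |s.1 i j| ≤ z) (ha : ∀ j, |a j| ≤ z) (k : ℕ) (i j : Fin n) :
    |(replaceRows A a s k).1 i j| ≤ z := by
  induction k generalizing i j with
  | zero => exact hs i j
  | succ k ih =>
    rw [replaceRows]
    split_ifs
    exacts [replaceRow_bound ih ha i j, ih i j]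

/-- The matrix is in array `1`, as a list, and the labels are in array `6`. -/
def Holds {n : ℕ} (s : RowState n) (m : Memory) : Prop :=
  (∀ i j : Fin n, m 1 (1 + ((i : ℤ) * n + j)) = s.1 i j) ∧ ∀ i : Fin n, m 6 (i : ℤ) = s.2 i

/-- `replaceRow`, where the index of the row is in array `23`, the new row in array `3`, and the
label in array `13`. -/
def replaceRowP : Prog :=
  -- The candidate is assembled in array 4, so that the matrix in array 1 survives a rejection.
  .seq (fillMatrixP 4 20 0 .skip (.get 1 (1 + .get 20 0) +
    Expr.ind (.get 20 0 / .get 0 1) (.get 23 0) *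
      (.get 3 (Expr.mod (.get 20 0) (.get 0 1) + 1) - .get 1 (1 + .get 20 0)))) <|
  .seq faddeevLeVerrierP <|
  -- A product of two squares is positive exactly if both the coefficient and the difference of the
  -- labels are nonzero.
  .ite (.get 15 0 * .get 15 0 *
      ((.get 6 (.get 23 0) - .get 13 0) * (.get 6 (.get 23 0) - .get 13 0)))
    (.seq (.assign 6 (.get 23 0) (.get 13 0)) (fillMatrixP 1 20 1 .skip (.get 4 (.get 20 0))))
    .skip

section

variable {B : ℕ} {m : Memory}

theorem runs_replaceRow {n : ℕ} (hn0 : m 0 1 = n) (hnB : n * n ≤ B)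
    (hm : m.Bdd B) {A : ℤ} (hA : m 13 0 = A) {a : Fin n → ℤ} (ha : ∀ j : Fin n, m 3 ((j : ℤ) + 1) = a j)
    {s : RowState n} (hs : Holds s m) {i : Fin n} (hi : m 23 0 = i) {z : ℤ} (hz1 : 1 ≤ z)
    (hsz : ∀ i j, |s.1 i j| ≤ z) (haz : ∀ j, |a j| ≤ z)
    (hzB : n * (2 * (n : ℤ) ^ 2 * z) ^ n < 2 ^ B) :
    ∃ m', Runs B replaceRowP m m' ∧ m'.Bdd B ∧ Agree [1, 4, 5, 6, 14, 15, 17, 20, 21, 22] m m' ∧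
      Holds (replaceRow A a s i) m' ∧ m' 1 0 = m 1 0 := by
  have hn : 0 < n := by have := i.2; omega
  have hUz : ∀ i' j', |s.1.updateRow i a i' j'| ≤ z := by
    intro i' j'
    rw [Matrix.updateRow_apply]
    split_ifs
    exacts [haz _, hsz _ _]
  have hn1 : (1 : ℤ) ≤ n := by exact_mod_cast hn
  have hzlt : z < 2 ^ B := by
    refine lt_of_le_of_lt ?_ hzB
    have h1 : 2 * (n : ℤ) ^ 2 * z ≤ (2 * (n : ℤ) ^ 2 * z) ^ n :=
      le_self_pow₀ (by nlinarith [sq_nonneg ((n : ℤ) - 1)]) hn.ne'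
    have h2 : z ≤ 2 * (n : ℤ) ^ 2 * z := by nlinarith [sq_nonneg ((n : ℤ) - 1)]
    have h3 : (2 * (n : ℤ) ^ 2 * z) ^ n ≤ n * (2 * (n : ℤ) ^ 2 * z) ^ n :=
      le_mul_of_one_le_left (by positivity) hn1
    linarith
  obtain ⟨m₁, hr₁, hb₁, ha₁, hv₁, -⟩ := Runs.fillMatrix (m := m) hn0 hnB (k := 4) (v := 20)
    (off := 0) (e := .get 1 (1 + .get 20 0) +
    Expr.ind (.get 20 0 / .get 0 1) (.get 23 0) *
      (.get 3 (Expr.mod (.get 20 0) (.get 0 1) + 1) - .get 1 (1 + .get 20 0))) (p := .skip) (o := 0) []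
    (by decide) (by decide) (by decide) (by decide) hm (s.1.updateRow i a) (fun _ _ => rfl)
    (fun i' j' m' hb' ha' hv hd hmod _ => ⟨m', Runs.skip, hb', Agree.refl _ _, by
      simp only [Expr.eval_add, Expr.eval_get, Expr.eval_one, Expr.eval_zero, Expr.eval_mul,
        Expr.eval_ind, Expr.eval_div, Expr.eval_sub, Expr.eval_mod, ha'.apply (k := 0) (by decide),
        ha'.apply (k := 1) (by decide), ha'.apply (k := 3) (by decide),
        ha'.apply (k := 23) (by decide), hn0, hd, hmod, hi, ha]
      rw [hv, hs.1, Matrix.updateRow_apply]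
      by_cases h : i' = i
      · simp [h]
      · have : ¬ ((i' : ℕ) : ℤ) = (i : ℕ) := by
          intro h'; exact h (Fin.ext (by exact_mod_cast h'))
        simp [h, this]⟩)
    (fun i j => (hUz i j).trans_lt hzlt)
  have hn₁ : m₁ 0 1 = n := by rw [ha₁.apply (by decide), hn0]
  obtain ⟨m₂, hr₂, hb₂, ha₂, hv₂⟩ := Runs.faddeevLeVerrier (m := m₁) hn hn₁ hnB hb₁
    (s.1.updateRow i a) (fun i j => by rw [← hv₁, zero_add]) hz1 hUz hzB
  have ha₁₂ : Agree [1, 4, 5, 6, 14, 15, 17, 20, 21, 22] m m₂ :=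
    (ha₁.mono (by decide)).trans (ha₂.mono (by decide))
  have hkeep : ∀ k ∉ [4, 5, 14, 15, 17, 20, 21, 22], m₂ k = m k := fun k hk => by
    rw [ha₂ k fun h => hk (by simp at h ⊢; tauto),
      ha₁ k fun h => hk (by simp at h ⊢; tauto)]
  have h1 : m₂ 1 = m 1 := hkeep _ (by decide)
  have h6 : m₂ 6 = m 6 := hkeep _ (by decide)
  have h13 : m₂ 13 0 = A := by rw [hkeep _ (by decide), hA]
  have h23 : m₂ 23 0 = i := by rw [hkeep _ (by decide), hi]
  have h0 : m₂ 0 1 = n := by rw [hkeep _ (by decide), hn0]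
  have h4 : ∀ i' j' : Fin n, m₂ 4 ((i' : ℤ) * n + j') = s.1.updateRow i a i' j' := fun i' j' => by
    rw [ha₂.apply (by decide), ← hv₁, zero_add]
  have hcond : 0 < (.get 15 0 * .get 15 0 *
      ((.get 6 (.get 23 0) - .get 13 0) * (.get 6 (.get 23 0) - .get 13 0)) : Expr).eval m₂ ↔
      ((s.1.updateRow i a).det ≠ 0 ∧ s.2 i ≠ A) := by
    simp only [Expr.eval_mul, Expr.eval_get, Expr.eval_sub, Expr.eval_zero, hv₂, h6, h13, h23,
      hs.2 i, ← faddeevLeVerrier_ne_zero_iff]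
    constructor
    · intro h
      constructor
      · rintro h'; simp [h'] at h
      · rintro h'; simp [h'] at h
    · rintro ⟨h, h'⟩
      have := mul_self_pos.mpr h
      have := mul_self_pos.mpr (sub_ne_zero.mpr h')
      positivity
  by_cases hc : (s.1.updateRow i a).det ≠ 0 ∧ s.2 i ≠ A
  · have hAB : |A| < 2 ^ B := by rw [← hA]; exact hm 13 0
    have hr₃ := Runs.assign hb₂ 6 (.get 23 0) (.get 13 0)
    simp only [Expr.eval_get, Expr.eval_zero, h13, h23] at hr₃
    have hb₃ := hb₂.set (k := 6) (i := (i : ℤ)) hAB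
    obtain ⟨m₄, hr₄, hb₄, ha₄, hv₄, hw₄⟩ := Runs.fillMatrix (m := m₂.set 6 i A) (n := n)
      (by rw [Memory.set_of_ne _ (by decide), h0]) hnB (k := 1) (v := 20) (off := 1)
      (e := .get 4 (.get 20 0)) (p := .skip) (o := 1) [] (by decide) (by decide) (by decide)
      (by decide) hb₃ (s.1.updateRow i a) (fun _ _ => rfl)
      (fun i' j' m' hb' ha' hv hd hmod _ => ⟨m', Runs.skip, hb', Agree.refl _ _, by
        simp only [Expr.eval_get, Expr.eval_zero, hv, ha'.apply (k := 4) (by decide)]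
        rw [Memory.set_of_ne _ (by decide), h4]⟩)
      (fun i j => (hUz i j).trans_lt hzlt)
    refine ⟨m₄, hr₁.seq (hr₂.seq (Runs.ite_pos hb₂ (hcond.mpr hc) (hr₃.seq hr₄))), hb₄,
      (ha₁₂.set (by decide) _ _).trans (ha₄.mono (by decide)), ?_, ?_⟩
    · rw [replaceRow, if_pos hc]
      refine ⟨hv₄, fun i' => ?_⟩
      rw [ha₄.apply (by decide), Memory.set_apply, h6, hs.2]
      simp [Function.update_apply, Fin.ext_iff]
    · rw [hw₄ 0 (by norm_num), Memory.set_of_ne _ (by decide), h1]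
  · refine ⟨m₂, hr₁.seq (hr₂.seq (Runs.ite_neg hb₂ (not_lt.mp (hcond.not.mpr hc)) Runs.skip)), hb₂,
      ha₁₂, ?_, by rw [h1]⟩
    rw [replaceRow, if_neg hc]
    exact ⟨fun i j => by rw [h1]; exact hs.1 i j, fun i => by rw [h6]; exact hs.2 i⟩

theorem runs_replaceRows {n : ℕ} (hn0 : m 0 1 = n) (hnB : n * n ≤ B)
    (hm : m.Bdd B) {A : ℤ} (hA : m 13 0 = A) {a : Fin n → ℤ} (ha : ∀ j : Fin n, m 3 ((j : ℤ) + 1) = a j)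
    {s : RowState n} (hs : Holds s m) {z : ℤ} (hz1 : 1 ≤ z)
    (hsz : ∀ i j, |s.1 i j| ≤ z) (haz : ∀ j, |a j| ≤ z)
    (hzB : n * (2 * (n : ℤ) ^ 2 * z) ^ n < 2 ^ B) :
    ∃ m', Runs B (forP 23 (.get 0 1) replaceRowP) m m' ∧ m'.Bdd B ∧
      Agree [1, 4, 5, 6, 14, 15, 17, 20, 21, 22, 23] m m' ∧
      Holds (replaceRows A a s n) m' ∧ m' 1 0 = m 1 0 := by
  have hnB' : n ≤ B := (Nat.le_mul_self n).trans hnB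
  obtain ⟨m', hr, hI⟩ := Runs.for (m := m) (v := 23) (N := .get 0 1) (p := replaceRowP) hnB' hm
    (fun k m' => k ≤ n ∧ m'.Bdd B ∧ Agree [1, 4, 5, 6, 14, 15, 17, 20, 21, 22, 23] m m' ∧ m' 23 0 = k ∧
      Holds (replaceRows A a s k) m' ∧ m' 1 0 = m 1 0)
    ⟨Nat.zero_le _, hm.set (by simp), (Agree.refl _ _).set (by decide) _ _, by simp,
      ⟨fun i j => by rw [Memory.set_of_ne _ (by decide)]; exact hs.1 i j,
        fun i => by rw [Memory.set_of_ne _ (by decide)]; exact hs.2 i⟩,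
      by rw [Memory.set_of_ne _ (by decide)]⟩
    (fun k m' h => ⟨h.2.1, h.2.2.2.1, by simp [h.2.2.1.apply, hn0]⟩)
    (fun k m' hk h => by
      obtain ⟨-, hb, ha', hk0, hs', h10⟩ := h
      obtain ⟨m₁, hr₁, hb₁, ha₁, hs₁, h1⟩ := runs_replaceRow (m := m') (n := n) (A := A) (a := a)
        (s := replaceRows A a s k) (i := ⟨k, hk⟩) (z := z)
        (by rw [ha'.apply (by decide), hn0]) hnB hb (by rw [ha'.apply (by decide), hA])
        (fun j => by rw [ha'.apply (by decide), ha]) hs' hk0 hz1 (replaceRows_bound hsz haz k) haz hzB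
      refine ⟨m₁, hr₁, hb₁, by rw [ha₁.apply (by decide), hk0], hk, hb₁.set ?_,
        (ha'.trans (ha₁.mono (by decide))).set (by decide) _ _, by simp, ?_, ?_⟩
      · exact_mod_cast natCast_lt_two_pow (by omega : k + 1 ≤ B)
      · rw [replaceRows, dif_pos hk]
        exact ⟨fun i j => by rw [Memory.set_of_ne _ (by decide)]; exact hs₁.1 i j,
          fun i => by rw [Memory.set_of_ne _ (by decide)]; exact hs₁.2 i⟩
      · rw [Memory.set_of_ne _ (by decide), h1, h10])
  exact ⟨m', hr, hI.2.1, hI.2.2.1, hI.2.2.2.2.1, hI.2.2.2.2.2⟩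

end

end

noncomputable section

/-! ### Using an answer of the oracle -/

/-- The coefficients given by a list. -/
def coeffs (n : ℕ) (l : List ℤ) : Fin n → ℤ := fun i => l.getD i 0

/-- The square of `den * ‖point z‖`. -/
def LatticeBasis.sqNorm (x : LatticeBasis) (z : Fin x.n → ℤ) : ℤ :=
  ∑ j, (∑ i, z i * x.mat i j) * (∑ i, z i * x.mat i j)

/-- The answer `l` is a list of the right length, has at most `b` bits, and represents a vector of
norm at most `√n * (num / rden)`. -/
def LatticeBasis.Accepts (x : LatticeBasis) (num rden : ℤ) (b : ℕ) (l : List ℤ) : Prop :=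
  listSize l ≤ b ∧ l.length = x.n ∧
    x.sqNorm (coeffs x.n l) * (rden * rden) ≤ x.n * (num * num) * ((x.den : ℤ) * x.den)

open Classical in
/-- Use the answer `l` to replace rows. -/
def LatticeBasis.process (x : LatticeBasis) (num rden A : ℤ) (b : ℕ) (s : RowState x.n)
    (l : List ℤ) : RowState x.n :=
  if x.Accepts num rden b l then replaceRows A (coeffs x.n l) s x.n else s

theorem abs_lt_of_listSize_le {l : List ℤ} {b : ℕ} (h : listSize l ≤ b) {y : ℤ} (hy : y ∈ l) :
    |y| < 2 ^ b := by
  have h1 : bitLen y ≤ listSize l := List.single_le_sum (by simp) _ (List.mem_map_of_mem hy)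
  exact bitLen_le_iff.mp (by omega)

theorem abs_getD_lt_of_listSize_le {l : List ℤ} {b : ℕ} (h : listSize l ≤ b) (i : ℕ) :
    |l.getD i 0| < 2 ^ b := by
  by_cases hi : i < l.length
  · rw [List.getD_eq_getElem _ _ hi]
    exact abs_lt_of_listSize_le h (List.getElem_mem hi)
  · rw [List.getD_eq_default _ _ (not_lt.mp hi)]
    simp

theorem LatticeBasis.abs_process_le (x : LatticeBasis) {num rden A : ℤ} {b : ℕ} {s : RowState x.n}
    {l : List ℤ} {z : ℤ} (hs : ∀ i j, |s.1 i j| ≤ z) (hb : 2 ^ b ≤ z) (i j : Fin x.n) :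
    |(x.process num rden A b s l).1 i j| ≤ z := by
  unfold LatticeBasis.process
  split_ifs with h
  · exact replaceRows_bound hs (fun j => (abs_getD_lt_of_listSize_le h.1 _).le.trans hb) _ _ _
  · exact hs i j

theorem length_le_listSize (l : List ℤ) : l.length ≤ listSize l := by
  rw [listSize, ← List.length_map (f := bitLen)]
  refine List.length_le_sum_of_one_le _ fun i hi => ?_
  obtain ⟨y, -, rfl⟩ := List.mem_map.mp hi
  exact bitLen_pos y

theorem abs_receive_lt {b B : ℕ} (hb : b ≤ B) (hB : 0 < B) (l : List ℤ) (i : ℤ) :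
    |receive b l i| < 2 ^ B := by
  have h1 : (1 : ℤ) < 2 ^ B := one_lt_pow₀ (by norm_num) hB.ne'
  unfold receive
  split_ifs with h
  · rw [storeList]
    split_ifs
    · exact natCast_lt_two_pow ((length_le_listSize l).trans (h.trans hb))
    · exact (abs_getD_lt_of_listSize_le h _).trans_le (pow_le_pow_right₀ (by norm_num) hb)
    · simp
  · dsimp only
    split_ifs <;> simp [h1]

/-- Use the answer in array `3`. -/
def processP : Prog :=
  -- 1 - d² is positive only for d = 0: the answer has length n. An answer that was too long to be
  -- received has left -1 in this cell and fails the test.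
  .ite (1 - (.get 3 0 - .get 0 1) * (.get 3 0 - .get 0 1))
    (.seq (sumP 16 23 (.get 0 1) (sumP 17 22 (.get 0 1) .skip
      (.get 3 (.get 22 0 + 1) * .get 0 (3 + (.get 22 0 * .get 0 1 + .get 23 0))))
      (.get 17 0 * .get 17 0)) <|
    -- Norms are compared after squaring and clearing denominators. The added 1 turns the strict
    -- test into a non-strict one between integers.
    .ite (.get 0 1 * (.get 2 (.get 0 0 + 1) * .get 2 (.get 0 0 + 1)) * (.get 0 2 * .get 0 2) + 1 -
      .get 16 0 * (.get 2 (.get 0 0 + 2) * .get 2 (.get 0 0 + 2)))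
      (forP 23 (.get 0 1) replaceRowP) .skip)
    .skip

theorem runs_process {B : ℕ} {m : Memory} (x : LatticeBasis) (h0 : m 0 = storeList x.encode)
    (hnB : x.n * x.n ≤ B) (hm : m.Bdd B) {A num rden : ℤ} (hA : m 13 0 = A)
    (hnum : m 2 (m 0 0 + 1) = num) (hrden : m 2 (m 0 0 + 2) = rden)
    {b : ℕ} {l : List ℤ} (h3 : m 3 = receive b l)
    {s : RowState x.n} (hs : Holds s m) {z y : ℤ} (hz1 : 1 ≤ z) (hy1 : 1 ≤ y) (hbz : 2 ^ b ≤ z)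
    (hsz : ∀ i j, |s.1 i j| ≤ z) (hy : ∀ i j, |x.mat i j| ≤ y)
    (hzB : x.n * (2 * (x.n : ℤ) ^ 2 * z) ^ x.n < 2 ^ B)
    (hyB : x.n * (x.n * (z * y)) ^ 2 < 2 ^ B) :
    ∃ m', Runs B processP m m' ∧ m'.Bdd B ∧
      Agree [1, 4, 5, 6, 14, 15, 16, 17, 20, 21, 22, 23] m m' ∧
      Holds (x.process num rden A b s l) m' ∧ m' 1 0 = m 1 0 := by
  have hn0 : m 0 1 = x.n := by rw [h0]; rfl
  have hd0 : m 0 2 = x.den := by rw [h0]; rfl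
  have hnB' : x.n ≤ B := (Nat.le_mul_self _).trans hnB
  have hn1 : (1 : ℤ) ≤ x.n := by exact_mod_cast x.n_pos
  have hcond : 0 < (1 - (.get 3 0 - .get 0 1) * (.get 3 0 - .get 0 1) : Expr).eval m ↔
      listSize l ≤ b ∧ l.length = x.n := by
    simp only [Expr.eval_sub, Expr.eval_one, Expr.eval_mul, Expr.eval_get, Expr.eval_zero, hn0]
    constructor
    · intro h
      have h1 : m 3 0 - x.n = 0 := by
        by_contra h2
        have := mul_self_pos.mpr h2
        omega
      rw [h3, receive] at h1
      split_ifs at h1 with h2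
      · refine ⟨h2, ?_⟩
        rw [storeList, if_pos rfl] at h1
        omega
      · simp only [if_pos] at h1
        omega
    · rintro ⟨h1, h2⟩
      have : m 3 0 = x.n := by rw [h3, receive, if_pos h1, storeList, if_pos rfl, h2]
      rw [this]; simp
  by_cases hc : listSize l ≤ b ∧ l.length = x.n
  · have ha : ∀ j : Fin x.n, m 3 ((j : ℤ) + 1) = coeffs x.n l j := fun j => by
      rw [h3, receive, if_pos hc.1, storeList_natCast_add_one]; rfl
    have haz : ∀ j, |coeffs x.n l j| ≤ z := fun j => (abs_getD_lt_of_listSize_le hc.1 _).le.trans hbz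
    have hw : 1 ≤ z * y := one_le_mul_of_one_le_of_one_le hz1 hy1
    have hterm : ∀ i j, |coeffs x.n l i * x.mat i j| ≤ z * y := fun i j => by
      rw [abs_mul]; exact mul_le_mul (haz i) (hy i j) (abs_nonneg _) (by linarith)
    have hinner : ∀ j, |∑ i, coeffs x.n l i * x.mat i j| ≤ x.n * (z * y) := fun j => by
      refine (Finset.abs_sum_le_sum_abs _ _).trans ?_
      refine (Finset.sum_le_card_nsmul _ _ (z * y) fun i _ => hterm i j).trans ?_
      simp
    have hw1 : 1 ≤ x.n * (z * y) := one_le_mul_of_one_le_of_one_le hn1 hw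
    have hwB : x.n * (z * y) < 2 ^ B := by
      refine lt_of_le_of_lt ?_ hyB
      nlinarith [mul_le_mul hn1 (le_self_pow₀ hw1 two_ne_zero) (by linarith) (by linarith)]
    obtain ⟨m₁, hr₁, hb₁, ha₁, hv₁⟩ := Runs.sum (m := m) (d := 16) (v := 23) (N := .get 0 1)
      (p := sumP 17 22 (.get 0 1) .skip
      (.get 3 (.get 22 0 + 1) * .get 0 (3 + (.get 22 0 * .get 0 1 + .get 23 0))))
      (e := .get 17 0 * .get 17 0) [17, 22] (by decide) (by decide) (by decide) hnB' hm
      (fun j => if h : j < x.n then (∑ i, coeffs x.n l i * x.mat i ⟨j, h⟩) *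
        (∑ i, coeffs x.n l i * x.mat i ⟨j, h⟩) else 0)
      (fun m' ha' => by simp [ha'.apply, hn0])
      (fun j m' hj hb' ha' hj' => by
        obtain ⟨m₂, hr₂, hb₂, ha₂, hv₂⟩ := Runs.sum (m := m') (d := 17) (v := 22) (N := .get 0 1)
          (p := .skip)
          (e := .get 3 (.get 22 0 + 1) * .get 0 (3 + (.get 22 0 * .get 0 1 + .get 23 0)))
          [] (by decide) (by decide) (by decide) hnB' hb'
          (fun i => if h : i < x.n then coeffs x.n l ⟨i, h⟩ * x.mat ⟨i, h⟩ ⟨j, hj⟩ else 0)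
          (fun m'' ha'' => by simp [ha''.apply, ha'.apply, hn0])
          (fun i m'' hi hb'' ha'' hi' => ⟨m'', Runs.skip, hb'', Agree.refl _ _, by
            have e1 := x.storeList_encode_mat ⟨i, hi⟩ ⟨j, hj⟩
            have e2 := ha ⟨i, hi⟩
            simp only at e1 e2
            simp only [Expr.eval_mul, Expr.eval_get, Expr.eval_add, Expr.eval_zero, Expr.eval_one,
              Expr.eval_ofNat, hi', ha''.apply (k := 0) (by decide), ha''.apply (k := 3) (by decide),
              ha''.apply (k := 23) (by decide), ha'.apply (k := 0) (by decide),
              ha'.apply (k := 3) (by decide), hj', hn0, e2]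
            rw [h0, e1, dif_pos hi]⟩)
          (fun i hi => (abs_sum_range_extend_le
            (fun i => coeffs x.n l i * x.mat i ⟨j, hj⟩) (fun i => hterm i _) (by linarith)
            hi).trans_lt hwB)
        refine ⟨m₂, hr₂, hb₂, ha₂, ?_⟩
        rw [sum_range_extend fun i => coeffs x.n l i * x.mat i ⟨j, hj⟩] at hv₂
        simp [hv₂, hj])
      (fun j hj => (abs_sum_range_extend_le
        (fun j => (∑ i, coeffs x.n l i * x.mat i j) * (∑ i, coeffs x.n l i * x.mat i j))
        (z := (x.n * (z * y)) ^ 2)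
        (fun j => by
          rw [abs_mul, sq]
          exact mul_le_mul (hinner j) (hinner j) (abs_nonneg _) (by linarith)) (by positivity)
        hj).trans_lt hyB)
    rw [sum_range_extend fun j => (∑ i, coeffs x.n l i * x.mat i j) *
      (∑ i, coeffs x.n l i * x.mat i j)] at hv₁
    have hcond2 : 0 < (.get 0 1 * (.get 2 (.get 0 0 + 1) * .get 2 (.get 0 0 + 1)) *
        (.get 0 2 * .get 0 2) + 1 -
        .get 16 0 * (.get 2 (.get 0 0 + 2) * .get 2 (.get 0 0 + 2)) : Expr).eval m₁ ↔
        x.Accepts num rden b l := by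
      simp only [Expr.eval_mul, Expr.eval_get, Expr.eval_sub, Expr.eval_add, Expr.eval_zero,
        Expr.eval_one, Expr.eval_ofNat, hv₁, ha₁.apply (k := 0) (by decide),
        ha₁.apply (k := 2) (by decide), hn0, hd0, hnum, hrden, LatticeBasis.Accepts, hc,
        LatticeBasis.sqNorm]
      simp only [true_and]
      omega
    by_cases hc2 : x.Accepts num rden b l
    · obtain ⟨m₂, hr₂, hb₂, ha₂, hs₂, h1⟩ := runs_replaceRows (m := m₁) (n := x.n) (A := A)
        (a := coeffs x.n l) (s := s) (z := z) (by rw [ha₁.apply (by decide), hn0]) hnB hb₁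
        (by rw [ha₁.apply (by decide), hA]) (fun j => by rw [ha₁.apply (by decide), ha])
        ⟨fun i j => by rw [ha₁.apply (by decide)]; exact hs.1 i j,
          fun i => by rw [ha₁.apply (by decide)]; exact hs.2 i⟩ hz1 hsz haz hzB
      refine ⟨m₂, Runs.ite_pos hm (hcond.mpr hc) (hr₁.seq (Runs.ite_pos hb₁ (hcond2.mpr hc2) hr₂)),
        hb₂, (ha₁.mono (by decide)).trans (ha₂.mono (by decide)), ?_, ?_⟩
      · rwa [LatticeBasis.process, if_pos hc2]
      · rw [h1, ha₁.apply (by decide)]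
    · refine ⟨m₁, Runs.ite_pos hm (hcond.mpr hc)
        (hr₁.seq (Runs.ite_neg hb₁ (not_lt.mp (hcond2.not.mpr hc2)) Runs.skip)), hb₁,
        ha₁.mono (by decide), ?_, by rw [ha₁.apply (by decide)]⟩
      rw [LatticeBasis.process, if_neg hc2]
      exact ⟨fun i j => by rw [ha₁.apply (by decide)]; exact hs.1 i j,
        fun i => by rw [ha₁.apply (by decide)]; exact hs.2 i⟩
  · refine ⟨m, Runs.ite_neg hm (not_lt.mp (hcond.not.mpr hc)) Runs.skip, hm, Agree.refl _ _, ?_, rfl⟩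
    rw [LatticeBasis.process, if_neg fun h => hc ⟨h.1, h.2.1⟩]
    exact hs

end

noncomputable section

/-! ### The reduction -/

/-- The least valid bound is a function of the memory alone. It can stand between a query and the
rest of the program, where the given bound depends on the answer and not just on the memory it
leaves. -/
theorem Wp.sInf_wp {B : ℕ} {O : Oracle} {p : Prog} {m : Memory} {f : Memory → ℝ≥0∞} :
    Wp B O p m f (sInf {v | Wp B O p m f v}) :=
  fun F t hF => le_sInf fun _ hv => hv F t hF

theorem Wp.query_seq {B : ℕ} {O : Oracle} {p : Prog} {m : Memory} {f : Memory → ℝ≥0∞}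
    {k k' : ℕ} {b : Expr} {l : List ℤ} {bv : ℕ} {g : List ℤ → ℝ≥0∞} (hm : m.Bdd B)
    (hb : b.eval m = bv) (hbv : bv ≤ B) (hl : readList (m k) = l) (hlen : l.length ≤ B)
    (h : ∀ a, Wp B O p (Function.update m k' (receive bv a)) f (g a)) :
    Wp B O (.seq (.query k k' b) p) m f ((O l).expect g) := by
  refine Wp.mono (Wp.seq (g := fun m' => sInf {v | Wp B O p m' f v})
    (Wp.query hm hb hbv hl hlen) fun m' _ => Wp.sInf_wp) ?_
  exact PMF.expect_mono _ fun a => sInf_le (h a)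

namespace LatticeBasis

variable (x : LatticeBasis)

/-- The sum of the squares of the entries of the encoding. -/
def sqSize : ℤ := ∑ i ∈ Finset.range x.encode.length, x.encode.getD i 0 * x.encode.getD i 0

/-- The logarithm of the largest scale. -/
def logSize : ℕ := Nat.clog 2 x.sqSize.toNat

/-- The number of bits received of every answer. -/
def answerSize : ℕ := x.n * (4 * x.logSize * x.n + 2)

/-- `B` is large enough for all bounds. -/
structure Fits (B : ℕ) : Prop where
  rounds : 100 * x.n ≤ B
  length : x.n * x.n + 4 ≤ B
  scales : 2 * x.logSize + 1 ≤ B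
  input : listSize x.encode ≤ B
  answer : x.answerSize ≤ B
  sqSize : x.sqSize < 2 ^ B
  matrix : x.n * (2 * (x.n : ℤ) ^ 2 * 2 ^ x.answerSize) ^ x.n < 2 ^ B
  norm : x.n * (x.n * (2 ^ x.answerSize * 2 ^ listSize x.encode)) ^ 2 < (2 : ℤ) ^ B

/-- The query for the scale `2 ^ j / 2 ^ logSize`. -/
def scaleQuery (j : ℕ) : List ℤ := x.encode ++ [2 ^ (j - x.logSize), 2 ^ (x.logSize - j)]

/-- `process` for the scale `2 ^ j / 2 ^ logSize`. -/
def scaleUpdate (j : ℕ) (s : RowState x.n) (l : List ℤ) : RowState x.n :=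
  x.process (2 ^ (j - x.logSize)) (2 ^ (x.logSize - j)) (2 ^ j) x.answerSize s l

/-- The part of the memory that stays fixed after the initialization. -/
structure Frame (B : ℕ) (m : Memory) : Prop where
  bdd : m.Bdd B
  input : m 0 = storeList x.encode
  query_zero : m 2 0 = (x.n : ℤ) * x.n + 4
  query : ∀ i < x.encode.length, m 2 ((i : ℤ) + 1) = x.encode.getD i 0
  logSize : m 10 0 = x.logSize
  pow : m 11 0 = 2 ^ x.logSize
  output : m 1 0 = (x.n : ℤ) * x.n

/-- The matrix and the labels in the memory. -/
def stateOf (m : Memory) : RowState x.n :=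
  (fun i j => m 1 (1 + ((i : ℤ) * x.n + j)), fun i => m 6 (i : ℤ))

theorem _root_.Holds.stateOf_eq {x : LatticeBasis} {s : RowState x.n} {m : Memory} (h : Holds s m) :
    x.stateOf m = s :=
  Prod.ext (funext fun i => funext fun j => h.1 i j) (funext fun i => h.2 i)

variable {x}

theorem Frame.of_agree {B : ℕ} {m m' : Memory} {S : List ℕ} (h : x.Frame B m) (ha : Agree S m m')
    (hb : m'.Bdd B) (h1 : m' 1 0 = m 1 0) (hS : 0 ∉ S ∧ 2 ∉ S ∧ 10 ∉ S ∧ 11 ∉ S) : x.Frame B m' where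
  bdd := hb
  input := by rw [ha _ hS.1, h.input]
  query_zero := by rw [ha _ hS.2.1, h.query_zero]
  query := by rw [ha _ hS.2.1]; exact h.query
  logSize := by rw [ha _ hS.2.2.1, h.logSize]
  pow := by rw [ha _ hS.2.2.2, h.pow]
  output := by rw [h1, h.output]

end LatticeBasis

/-- Query a sample and process it. -/
def sampleP : Prog := .seq (.query 2 3 (.get 0 1 * (4 * .get 10 0 * .get 0 1 + 2))) processP

/-- All samples for one scale. -/
def scaleP : Prog :=
  -- For q ≥ 0 the value of q + 1 / (q + 1) is q, except that q = 0 becomes 1. This produces 2^(j -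
  -- K) with truncated subtraction.
  .seq (.assign 2 (.get 0 0 + 1) (.get 13 0 / .get 11 0 + 1 / (.get 13 0 / .get 11 0 + 1))) <|
  .seq (.assign 2 (.get 0 0 + 2) (.get 11 0 / .get 13 0 + 1 / (.get 11 0 / .get 13 0 + 1))) <|
  .seq (forP 24 (100 * .get 0 1) sampleP) <|
  -- After the scale with j = 0 the quotient is 0, which ends the outer loop.
  .assign 13 0 (.get 13 0 / 2)

/-- The initialization. -/
def initP : Prog :=
  .seq (fillP 2 20 (.get 0 0) 1 .skip (.get 0 (.get 20 0 + 1))) <|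
  .seq (.assign 2 0 (.get 0 0 + 2)) <|
  .seq (sumP 12 20 (.get 0 0) .skip (.get 0 (.get 20 0 + 1) * .get 0 (.get 20 0 + 1))) <|
  .seq (.assign 11 0 1) <|
  -- A power of 2 is doubled until it reaches the sum of squares, and array 10 counts the doublings.
  .seq (.loop (.get 12 0 - .get 11 0)
    (.seq (.assign 11 0 (.get 11 0 * 2)) (.assign 10 0 (.get 10 0 + 1)))) <|
  .seq (.assign 1 0 (.get 0 1 * .get 0 1)) <|
  .seq (fillMatrixP 1 20 1 .skip (Expr.ind (.get 20 0 / .get 0 1) (Expr.mod (.get 20 0) (.get 0 1)))) <|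
  .assign 13 0 (.get 11 0 * .get 11 0)

/-- The oracle program that reduces the independent vectors problem to discrete Gaussian sampling. -/
def reductionP : Prog := .seq initP (.loop (.get 13 0) scaleP)

section

variable {x : LatticeBasis} {B : ℕ} {m : Memory} {O : Oracle}

theorem wp_sample (hB : x.Fits B) (hm : x.Frame B m) {j : ℕ} (hA : m 13 0 = 2 ^ j)
    (hnum : m 2 ((x.n : ℤ) * x.n + 3) = 2 ^ (j - x.logSize))
    (hrden : m 2 ((x.n : ℤ) * x.n + 4) = 2 ^ (x.logSize - j))
    (hz : ∀ i j, |(x.stateOf m).1 i j| ≤ 2 ^ x.answerSize)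
    {f : Memory → ℝ≥0∞} {v : List ℤ → ℝ≥0∞}
    (hf : ∀ l m', x.Frame B m' → Agree [1, 3, 4, 5, 6, 14, 15, 16, 17, 20, 21, 22, 23] m m' →
      x.stateOf m' = x.scaleUpdate j (x.stateOf m) l → f m' ≤ v l) :
    Wp B O sampleP m f ((O (x.scaleQuery j)).expect v) := by
  have h00 : m 0 0 = (x.n : ℤ) * x.n + 2 := by rw [hm.input, x.storeList_encode_zero]
  have h01 : m 0 1 = x.n := by rw [hm.input]; rfl
  have hlen : (x.scaleQuery j).length = x.n * x.n + 4 := by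
    rw [LatticeBasis.scaleQuery, List.length_append, x.length_encode]; rfl
  refine Wp.query_seq hm.bdd (bv := x.answerSize) ?_ hB.answer (l := x.scaleQuery j) ?_
    (hlen.trans_le hB.length) fun l => ?_
  · simp [h01, hm.logSize, LatticeBasis.answerSize]
  · refine readList_eq ?_ fun i hi => ?_
    · rw [hm.query_zero, hlen]; push_cast; rfl
    · rw [hlen] at hi
      have hle := x.length_encode
      rw [LatticeBasis.scaleQuery]
      rcases lt_or_ge i x.encode.length with h | h
      · rw [hm.query i h, List.getD_append _ _ _ _ h]
      · rw [List.getD_append_right _ _ _ _ h, hle]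
        rw [hle] at h
        obtain rfl | rfl : i = x.n * x.n + 2 ∨ i = x.n * x.n + 3 := by omega
        · push_cast
          rw [add_assoc, show (2 : ℤ) + 1 = 3 by norm_num, hnum]
          simp
        · push_cast
          rw [add_assoc, show (3 : ℤ) + 1 = 4 by norm_num, hrden]
          simp
  · have hag : Agree [3] m (Function.update m 3 (receive x.answerSize l)) := fun k hk => by
      rw [Function.update_of_ne (by simpa using hk)]
    obtain ⟨m', hr, hb, ha, hs, h1⟩ := runs_process (m := Function.update m 3 (receive x.answerSize l))
      (B := B) (A := 2 ^ j) (num := 2 ^ (j - x.logSize)) (rden := 2 ^ (x.logSize - j))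
      (b := x.answerSize) (l := l) (s := x.stateOf m) (z := 2 ^ x.answerSize)
      (y := 2 ^ listSize x.encode) x
      (by rw [hag _ (by decide), hm.input]) (by have := hB.length; omega)
      (fun k i => by
        rcases eq_or_ne k 3 with rfl | hk
        · rw [Function.update_self]
          exact abs_receive_lt hB.answer (by have := hB.length; omega) _ _
        · rw [Function.update_of_ne hk]; exact hm.bdd k i)
      (by rw [hag _ (by decide), hA])
      (by rw [hag _ (by decide), hag _ (by decide), h00, add_assoc]; exact hnum)
      (by rw [hag _ (by decide), hag _ (by decide), h00, add_assoc]; exact hrden)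
      (by rw [Function.update_self])
      ⟨fun i j => by rw [hag _ (by decide)]; rfl, fun i => by rw [hag _ (by decide)]; rfl⟩
      (one_le_pow₀ (by norm_num)) (one_le_pow₀ (by norm_num)) le_rfl hz
      (fun i j => by
        refine (abs_lt_of_listSize_le (le_refl (listSize x.encode)) ?_).le
        refine List.mem_cons_of_mem _ (List.mem_cons_of_mem _ ?_)
        rw [encodeMatrix, List.mem_flatten]
        exact ⟨_, List.mem_ofFn.mpr ⟨i, rfl⟩, List.mem_ofFn.mpr ⟨j, rfl⟩⟩)
      hB.matrix hB.norm
    have ha' : Agree [1, 3, 4, 5, 6, 14, 15, 16, 17, 20, 21, 22, 23] m m' :=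
      (hag.mono (by decide)).trans (ha.mono (by decide))
    refine hr.wp.mono (hf l m' (hm.of_agree ha' hb ?_ (by decide)) ha' hs.stateOf_eq)
    rw [h1, hag _ (by decide)]

open Classical in
-- `V k` is the bound with k samples to come at this scale. By `hV0` its finiteness carries the
-- bound on the matrix entries, which keeps all numbers below 2^B.
theorem wp_scale (hB : x.Fits B) {f : Memory → ℝ≥0∞} {j : ℕ} (hj : j ≤ 2 * x.logSize)
    (V : ℕ → RowState x.n → ℝ≥0∞)
    (hV0 : ∀ k s, V k s ≠ ⊤ → ∀ i j, |s.1 i j| ≤ 2 ^ x.answerSize)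
    (hV1 : ∀ k s, k < 100 * x.n → V (k + 1) s ≠ ⊤ →
      (O (x.scaleQuery j)).expect (fun l => V k (x.scaleUpdate j s l)) ≤ V (k + 1) s)
    (hf : ∀ m', x.Frame B m' → m' 13 0 = 2 ^ j / 2 → f m' ≤ V 0 (x.stateOf m'))
    (hm : x.Frame B m) (hA : m 13 0 = 2 ^ j) :
    Wp B O scaleP m f (V (100 * x.n) (x.stateOf m)) := by
  have hBK := hB.scales
  have hpow : ∀ i ≤ 2 * x.logSize, |(2 : ℤ) ^ i| < 2 ^ B := fun i hi => by
    rw [abs_of_pos (by positivity)]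
    exact pow_lt_pow_right₀ (by norm_num) (by omega)
  have hval : ∀ a b : ℕ, (2 : ℤ) ^ a / 2 ^ b + 1 / (2 ^ a / 2 ^ b + 1) = 2 ^ (a - b) := fun a b => by
    rcases le_or_gt b a with h | h
    · obtain ⟨c, rfl⟩ := Nat.exists_eq_add_of_le h
      rw [pow_add, Int.mul_ediv_cancel_left _ (by positivity), Nat.add_sub_cancel_left,
        Int.ediv_eq_zero_of_lt (by norm_num), add_zero]
      have : 0 < (2 : ℤ) ^ c := by positivity
      linarith
    · rw [Int.ediv_eq_zero_of_lt (by positivity) (pow_lt_pow_right₀ (by norm_num) h),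
        Nat.sub_eq_zero_of_le h.le]
      norm_num
  have h00 : ∀ m, x.Frame B m → m 0 0 = (x.n : ℤ) * x.n + 2 := fun m hm => by
    rw [hm.input, x.storeList_encode_zero]
  have h01 : ∀ m, x.Frame B m → m 0 1 = x.n := fun m hm => by rw [hm.input]; rfl
  have hset : ∀ m, x.Frame B m → ∀ (i : ℤ) (z : ℤ), (x.n : ℤ) * x.n + 2 < i → |z| < 2 ^ B →
      x.Frame B (m.set 2 i z) := fun m hm i z hi hz =>
    { bdd := hm.bdd.set hz
      input := by rw [Memory.set_of_ne _ (by decide), hm.input]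
      query_zero := by
        have : (0 : ℤ) ≤ x.n * x.n := by positivity
        rw [Memory.set_apply, if_neg (by omega), hm.query_zero]
      query := fun i' hi' => by
        rw [x.length_encode] at hi'
        have : (i' : ℤ) < x.n * x.n + 2 := by exact_mod_cast hi'
        rw [Memory.set_apply, if_neg (by omega), hm.query i' (by rwa [x.length_encode])]
      logSize := by rw [Memory.set_of_ne _ (by decide), hm.logSize]
      pow := by rw [Memory.set_of_ne _ (by decide), hm.pow]
      output := by rw [Memory.set_of_ne _ (by decide), hm.output] }
  -- the two entries of the query
  have hr₁ := Runs.assign hm.bdd 2 (.get 0 0 + 1)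
    (.get 13 0 / .get 11 0 + 1 / (.get 13 0 / .get 11 0 + 1))
  simp only [Expr.eval_add, Expr.eval_div, Expr.eval_get, Expr.eval_zero, Expr.eval_one, hA, hm.pow,
    hval, h00 m hm] at hr₁
  have hm₁ := hset m hm ((x.n : ℤ) * x.n + 2 + 1) (2 ^ (j - x.logSize)) (by omega) (hpow _ (by omega))
  set m₁ := m.set 2 ((x.n : ℤ) * x.n + 2 + 1) (2 ^ (j - x.logSize)) with hm₁def
  have hA₁ : m₁ 13 0 = 2 ^ j := by rw [hm₁def, Memory.set_of_ne _ (by decide), hA]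
  have hr₂ := Runs.assign hm₁.bdd 2 (.get 0 0 + 2)
    (.get 11 0 / .get 13 0 + 1 / (.get 11 0 / .get 13 0 + 1))
  simp only [Expr.eval_add, Expr.eval_div, Expr.eval_get, Expr.eval_zero, Expr.eval_one,
    Expr.eval_ofNat, hA₁, hm₁.pow, hval, h00 m₁ hm₁] at hr₂
  have hm₂ := hset m₁ hm₁ ((x.n : ℤ) * x.n + 2 + 2) (2 ^ (x.logSize - j)) (by omega) (hpow _ (by omega))
  set m₂ := m₁.set 2 ((x.n : ℤ) * x.n + 2 + 2) (2 ^ (x.logSize - j)) with hm₂def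
  have hA₂ : m₂ 13 0 = 2 ^ j := by rw [hm₂def, Memory.set_of_ne _ (by decide), hA₁]
  have hnum₂ : m₂ 2 ((x.n : ℤ) * x.n + 3) = 2 ^ (j - x.logSize) := by
    rw [hm₂def, Memory.set_apply, if_neg (by omega), hm₁def, Memory.set_apply, if_pos ⟨rfl, by ring⟩]
  have hrden₂ : m₂ 2 ((x.n : ℤ) * x.n + 4) = 2 ^ (x.logSize - j) := by
    rw [hm₂def, Memory.set_apply, if_pos ⟨rfl, by ring⟩]
  have hst₂ : x.stateOf m₂ = x.stateOf m := by
    simp only [LatticeBasis.stateOf, hm₂def, hm₁def, Memory.set_of_ne _ (by decide : (1 : ℕ) ≠ 2),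
      Memory.set_of_ne _ (by decide : (6 : ℕ) ≠ 2)]
  -- the samples
  let P : Memory → Prop := fun m => x.Frame B m ∧ m 13 0 = 2 ^ j ∧
    m 2 ((x.n : ℤ) * x.n + 3) = 2 ^ (j - x.logSize) ∧ m 2 ((x.n : ℤ) * x.n + 4) = 2 ^ (x.logSize - j)
  let f' : Memory → ℝ≥0∞ := fun m' => if P m' then V 0 (x.stateOf m') else ⊤
  let g : ℕ → Memory → ℝ≥0∞ := fun k m' =>
    if P m' ∧ m' 24 0 = ((100 * x.n : ℕ) : ℤ) - k then V k (x.stateOf m') else ⊤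
  have hset24 : ∀ m (z : ℤ), P m → |z| < 2 ^ B → P (m.set 24 0 z) := fun m z hP hz =>
    ⟨hP.1.of_agree ((Agree.refl [24] m).set (by simp) 0 z) (hP.1.bdd.set hz)
      (by rw [Memory.set_of_ne _ (by decide)]) (by decide),
      by rw [Memory.set_of_ne _ (by decide)]; exact hP.2.1,
      by rw [Memory.set_of_ne _ (by decide)]; exact hP.2.2.1,
      by rw [Memory.set_of_ne _ (by decide)]; exact hP.2.2.2⟩
  have hst24 : ∀ m (z : ℤ), x.stateOf (m.set 24 0 z) = x.stateOf m := fun m z => by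
    simp only [LatticeBasis.stateOf, Memory.set_of_ne _ (by decide : (1 : ℕ) ≠ 24),
      Memory.set_of_ne _ (by decide : (6 : ℕ) ≠ 24)]
  have hN : ∀ m, P m → (100 * .get 0 1 : Expr).eval m = ((100 * x.n : ℕ) : ℤ) := fun m hP => by
    simp [h01 m hP.1]
  have hloop : Wp B O (forP 24 (100 * .get 0 1) sampleP) m₂ f' (g (100 * x.n) (m₂.set 24 0 0)) := by
    refine Wp.for hB.rounds hm₂.bdd g (fun m' h => ?_) fun k m' hk h => ?_
    · have hP : P m' ∧ m' 24 0 = ((100 * x.n : ℕ) : ℤ) - (0 : ℕ) := by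
        by_contra hc; exact h (if_neg hc)
      refine ⟨hP.1.1.bdd, by simpa using hP.2, hN m' hP.1, ?_⟩
      simp only [f', g, if_pos hP, if_pos hP.1, le_refl]
    · have hP : P m' ∧ m' 24 0 = ((100 * x.n : ℕ) : ℤ) - (k + 1 : ℕ) := by
        by_contra hc; exact h (if_neg hc)
      refine ⟨hP.1.1.bdd, hP.2, hN m' hP.1, ?_⟩
      have hg : g (k + 1) m' = V (k + 1) (x.stateOf m') := if_pos hP
      rw [hg] at h ⊢
      refine Wp.mono (wp_sample hB hP.1.1 hP.1.2.1 hP.1.2.2.1 hP.1.2.2.2 (hV0 _ _ h)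
        (v := fun l => V k (x.scaleUpdate j (x.stateOf m') l)) fun l m'' hm'' ha'' hs'' => ?_)
        (hV1 k _ hk h)
      have h24 : m'' 24 0 = m' 24 0 := by rw [ha'' _ (by decide)]
      have hb : |m'' 24 0 + 1| < 2 ^ B := by
        rw [h24, hP.2]
        have := natCast_lt_two_pow (x := 100 * x.n - k) (B := B) (by have := hB.rounds; omega)
        rw [Nat.cast_sub hk.le] at this
        convert this using 2
        push_cast
        ring
      have hP'' : P m'' := ⟨hm'', by rw [ha'' _ (by decide)]; exact hP.1.2.1,
        by rw [ha'' _ (by decide)]; exact hP.1.2.2.1, by rw [ha'' _ (by decide)]; exact hP.1.2.2.2⟩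
      rw [if_pos hm''.bdd]
      have hcnt : m''.set 24 0 (m'' 24 0 + 1) 24 0 = ((100 * x.n : ℕ) : ℤ) - k := by
        rw [Memory.set_same, h24, hP.2]
        push_cast
        ring
      simp only [g]
      rw [if_pos ⟨hset24 _ _ hP'' hb, hcnt⟩, hst24, hs'']
  have hP₂ : P m₂ := ⟨hm₂, hA₂, hnum₂, hrden₂⟩
  have hg₂ : g (100 * x.n) (m₂.set 24 0 0) = V (100 * x.n) (x.stateOf m) := by
    simp only [g]
    rw [if_pos ⟨hset24 _ _ hP₂ (by simp), by simp⟩, hst24, hst₂]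
  rw [hg₂] at hloop
  -- The assignment is deterministic, so the intermediate function is finite only at its one
  -- outcome.
  refine Wp.mono (Wp.seq hr₁.wp (g := fun m' => if m' = m₁ then V (100 * x.n) (x.stateOf m) else ⊤)
    fun m' hm' => ?_) (if_pos rfl).le
  obtain rfl : m' = m₁ := by by_contra hc; exact hm' (if_neg hc)
  rw [if_pos rfl]
  refine Wp.mono (Wp.seq hr₂.wp (g := fun m' => if m' = m₂ then V (100 * x.n) (x.stateOf m) else ⊤)
    fun m' hm' => ?_) (if_pos rfl).le
  obtain rfl : m' = m₂ := by by_contra hc; exact hm' (if_neg hc)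
  rw [if_pos rfl]
  refine Wp.seq hloop fun m' hm' => ?_
  have hP' : P m' := by by_contra hc; exact hm' (if_neg hc)
  have hr₃ := Runs.assign hP'.1.bdd 13 0 (.get 13 0 / 2)
  simp only [Expr.eval_div, Expr.eval_get, Expr.eval_zero, Expr.eval_ofNat, hP'.2.1] at hr₃
  have hb : |(2 : ℤ) ^ j / 2| < 2 ^ B :=
    (Int.abs_ediv_le_abs _ _).trans_lt (hpow j hj)
  refine hr₃.wp.mono ?_
  simp only [f', if_pos hP']
  refine (hf _ (hP'.1.of_agree ((Agree.refl [13] m').set (by simp) 0 _) (hP'.1.bdd.set hb)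
      (by rw [Memory.set_of_ne _ (by decide)]) (by decide)) (by rw [Memory.set_same])).trans_eq ?_
  congr 1

end

end

/-! ### The initialization and the program as a whole -/

noncomputable section

variable {x : LatticeBasis} {B : ℕ} {O : Oracle}

namespace LatticeBasis

theorem sqSize_nonneg (x : LatticeBasis) : 0 ≤ x.sqSize :=
  Finset.sum_nonneg fun _ _ => mul_self_nonneg _

theorem sqSize_le_two_pow (x : LatticeBasis) : x.sqSize ≤ 2 ^ x.logSize := by
  have h := Nat.le_pow_clog (by norm_num : 1 < 2) x.sqSize.toNat
  have h2 : ((x.sqSize.toNat : ℕ) : ℤ) ≤ ((2 ^ Nat.clog 2 x.sqSize.toNat : ℕ) : ℤ) := by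
    exact_mod_cast h
  rw [Int.toNat_of_nonneg x.sqSize_nonneg] at h2
  exact_mod_cast h2

theorem two_pow_lt_sqSize (x : LatticeBasis) {i : ℕ} (hi : i < x.logSize) : 2 ^ i < x.sqSize := by
  have h := (Nat.lt_clog_iff_pow_lt (by norm_num : 1 < 2)).mp hi
  have h2 : ((2 ^ i : ℕ) : ℤ) < x.sqSize.toNat := by exact_mod_cast h
  rw [Int.toNat_of_nonneg x.sqSize_nonneg] at h2
  exact_mod_cast h2

end LatticeBasis

theorem startConfig_bdd (hB : x.Fits B) : (startConfig x.encode).mem.Bdd B := by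
  intro k i
  have hB0 : 0 < B := by have := hB.length; omega
  simp only [startConfig]
  split_ifs
  · have h := abs_receive_lt hB.input hB0 x.encode i
    rwa [receive, if_pos le_rfl] at h
  · simp

theorem runs_init (hB : x.Fits B) :
    ∃ m, Runs B initP (startConfig x.encode).mem m ∧ x.Frame B m ∧
      m 13 0 = 2 ^ (2 * x.logSize) ∧ x.stateOf m = (1, 0) := by
  set m := (startConfig x.encode).mem with hmdef
  have hm : m.Bdd B := startConfig_bdd hB
  have hm0 : m 0 = storeList x.encode := rfl
  have hz : ∀ k, k ≠ 0 → ∀ i, m k i = 0 := fun k hk i => by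
    simp [hmdef, startConfig, hk]
  have hlenB : x.encode.length ≤ B := by rw [x.length_encode]; have := hB.length; omega
  have h00 : m 0 0 = x.encode.length := by rw [hm0, storeList, if_pos rfl]
  have hone : |(1 : ℤ)| < 2 ^ B := by
    simpa using natCast_lt_two_pow (x := 1) (B := B) (by have := hB.length; omega)
  have hentry : ∀ i, |x.encode.getD i 0| < 2 ^ B := fun i =>
    abs_getD_lt_of_listSize_le hB.input i
  obtain ⟨m₁, hr₁, hb₁, ha₁, hv₁, -⟩ := Runs.fill (m := m) (k := 2) (v := 20) (N := .get 0 0)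
    (off := 1) (e := .get 0 (.get 20 0 + 1)) (p := .skip) (o := 1) [] (by decide) (by decide)
    (by decide) hlenB hm (fun i => x.encode.getD i 0) (fun m' ha => by simp [ha.apply, h00])
    (fun _ _ => rfl)
    (fun i m' hi hb ha hv _ => ⟨m', Runs.skip, hb, Agree.refl _ _, by
      simp only [Expr.eval_get, Expr.eval_add, Expr.eval_zero, Expr.eval_one, hv,
        ha.apply (k := 0) (by decide), hm0, storeList_natCast_add_one]⟩)
    (fun i _ => hentry i)
  have hlen2 : |(x.encode.length : ℤ) + 2| < 2 ^ B := by
    have := natCast_lt_two_pow (x := x.encode.length + 2) (B := B)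
      (by rw [x.length_encode]; have := hB.length; omega)
    exact_mod_cast this
  have hr₂ := Runs.assign hb₁ 2 0 (.get 0 0 + 2)
  simp only [Expr.eval_get, Expr.eval_add, Expr.eval_zero, Expr.eval_ofNat,
    ha₁.apply (k := 0) (by decide), h00] at hr₂
  have hb₂ := hb₁.set (k := 2) (i := 0) hlen2
  set m₂ := m₁.set 2 0 ((x.encode.length : ℤ) + 2) with hm₂
  have ha₂ : Agree [2, 20] m m₂ := ha₁.set (by decide) _ _
  obtain ⟨m₃, hr₃, hb₃, ha₃, hv₃⟩ := Runs.sum (m := m₂) (d := 12) (v := 20) (N := .get 0 0)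
    (e := .get 0 (.get 20 0 + 1) * .get 0 (.get 20 0 + 1)) (p := .skip) [] (by decide) (by decide)
    (by decide) hlenB hb₂ (fun i => x.encode.getD i 0 * x.encode.getD i 0)
    (fun m' ha => by simp [ha.apply, ha₂.apply, h00])
    (fun i m' hi hb ha hv => ⟨m', Runs.skip, hb, Agree.refl _ _, by
      simp only [Expr.eval_get, Expr.eval_add, Expr.eval_mul, Expr.eval_zero, Expr.eval_one, hv,
        ha.apply (k := 0) (by decide), ha₂.apply (k := 0) (by decide), hm0,
        storeList_natCast_add_one]⟩)
    (fun i hi => by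
      rw [abs_of_nonneg (Finset.sum_nonneg fun _ _ => mul_self_nonneg _)]
      exact (Finset.sum_le_sum_of_subset_of_nonneg (Finset.range_mono hi)
        fun _ _ _ => mul_self_nonneg _).trans_lt hB.sqSize)
  have hr₄ : Runs B (.assign 11 0 1) m₃ (m₃.set 11 0 1) := Runs.assign hb₃ 11 0 1
  have hb₄ : (m₃.set 11 0 1).Bdd B := hb₃.set hone
  have ha₄ : Agree [2, 11, 12, 20] m (m₃.set 11 0 1) :=
    ((ha₂.mono (by decide)).trans (ha₃.mono (by decide))).set (by decide) _ _
  have hv₄ : m₃.set 11 0 1 12 0 = x.sqSize := by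
    rw [Memory.set_of_ne _ (by decide), hv₃]; rfl
  have h2₄ : m₃.set 11 0 1 2 = m₂ 2 := by
    rw [Memory.set_of_ne _ (by decide), ha₃ _ (by decide)]
  set m₄ := m₃.set 11 0 1 with hm₄
  have hBK := hB.scales
  have hpow : ∀ i ≤ 2 * x.logSize, |(2 : ℤ) ^ i| < 2 ^ B := fun i hi => by
    rw [abs_of_pos (by positivity)]
    exact pow_lt_pow_right₀ (by norm_num) (by omega)
  obtain ⟨m₅, hr₅, hb₅, ha₅, h11₅, h10₅⟩ := Runs.loop (m := m₄) (e := .get 12 0 - .get 11 0)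
    (p := .seq (.assign 11 0 (.get 11 0 * 2)) (.assign 10 0 (.get 10 0 + 1))) (c := x.logSize)
    (by omega : x.logSize ≤ B)
    (fun i m' => m'.Bdd B ∧ Agree [10, 11] m₄ m' ∧ m' 11 0 = 2 ^ i ∧ m' 10 0 = i)
    ⟨hb₄, Agree.refl _ _, by rw [hm₄, Memory.set_same, pow_zero],
      by rw [ha₄.apply (by decide), hz _ (by decide)]; rfl⟩
    (fun i m' h => h.1)
    (fun m' h => by
      have := x.sqSize_le_two_pow
      simp only [Expr.eval_sub, Expr.eval_get, Expr.eval_zero, h.2.2.1,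
        h.2.1.apply (k := 12) (by decide), hv₄]
      linarith)
    (fun i m' hi h => by
      obtain ⟨hb, ha, h11, h10⟩ := h
      refine ⟨?_, ?_⟩
      · have := x.two_pow_lt_sqSize hi
        simp only [Expr.eval_sub, Expr.eval_get, Expr.eval_zero, h11,
          ha.apply (k := 12) (by decide), hv₄]
        linarith
      · have hr := Runs.assign hb 11 0 (.get 11 0 * 2)
        simp only [Expr.eval_mul, Expr.eval_get, Expr.eval_zero, Expr.eval_ofNat, h11, ← pow_succ] at hr
        have hb' := hb.set (k := 11) (i := 0) (hpow (i + 1) (by omega))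
        have hr' := Runs.assign hb' 10 0 (.get 10 0 + 1)
        simp only [Expr.eval_add, Expr.eval_get, Expr.eval_zero, Expr.eval_one] at hr'
        rw [Memory.set_of_ne _ (by decide), h10] at hr'
        refine ⟨_, hr.seq hr', hb'.set ?_, (ha.set (by decide) _ _).set (by decide) _ _, ?_, ?_⟩
        · exact_mod_cast natCast_lt_two_pow (x := i + 1) (B := B) (by omega)
        · rw [Memory.set_of_ne _ (by decide), Memory.set_same]
        · rw [Memory.set_same]; push_cast; rfl)
  have h01₅ : m₅ 0 1 = x.n := by rw [ha₅.apply (by decide), ha₄.apply (by decide), hm0]; rfl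
  have hnnB : |(x.n : ℤ) * x.n| < 2 ^ B := by
    have := natCast_lt_two_pow (x := x.n * x.n) (B := B) (by have := hB.length; omega)
    exact_mod_cast this
  have hr₆ := Runs.assign hb₅ 1 0 (.get 0 1 * .get 0 1)
  simp only [Expr.eval_mul, Expr.eval_get, Expr.eval_zero, Expr.eval_one, h01₅] at hr₆
  have hb₆ := hb₅.set (k := 1) (i := 0) hnnB
  obtain ⟨m₇, hr₇, hb₇, ha₇, hv₇, hw₇⟩ := Runs.fillMatrix (m := m₅.set 1 0 ((x.n : ℤ) * x.n))
    (n := x.n) (by rw [Memory.set_of_ne _ (by decide), h01₅]) (by have := hB.length; omega)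
    (k := 1) (v := 20) (off := 1)
    (e := Expr.ind (.get 20 0 / .get 0 1) (Expr.mod (.get 20 0) (.get 0 1))) (p := .skip) (o := 1) []
    (by decide) (by decide) (by decide) (by decide) hb₆ 1 (fun _ _ => rfl)
    (fun i j m' hb ha hv hd hmod _ => ⟨m', Runs.skip, hb, Agree.refl _ _, by
      simp only [Expr.eval_ind, Expr.eval_div, Expr.eval_mod, Expr.eval_get, Expr.eval_zero,
        Expr.eval_one, ha.apply (k := 0) (by decide)]
      rw [Memory.set_of_ne _ (by decide), h01₅, hd, hmod, Matrix.one_apply]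
      simp [Fin.ext_iff]⟩)
    (fun i j => by rw [Matrix.one_apply]; split_ifs <;> first | exact hone | simp)
  have hkeep : ∀ k ∉ [1, 20], m₇ k = m₅ k := fun k hk => by
    rw [ha₇ _ hk, Memory.set_of_ne _ (by rintro rfl; simp at hk)]
  have h11 : m₇ 11 0 = 2 ^ x.logSize := by rw [hkeep _ (by decide), h11₅]
  have hr₈ := Runs.assign hb₇ 13 0 (.get 11 0 * .get 11 0)
  simp only [Expr.eval_mul, Expr.eval_get, Expr.eval_zero, h11, ← pow_add, ← two_mul] at hr₈
  have hb₈ := hb₇.set (k := 13) (i := 0) (hpow (2 * x.logSize) le_rfl)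
  have hqry : ∀ i, m₇.set 13 0 (2 ^ (2 * x.logSize)) 2 i = m₂ 2 i := fun i => by
    rw [Memory.set_of_ne _ (by decide), hkeep _ (by decide), ha₅ _ (by decide), h2₄]
  refine ⟨_, hr₁.seq (hr₂.seq (hr₃.seq (hr₄.seq (hr₅.seq (hr₆.seq (hr₇.seq hr₈)))))), ?_, ?_, ?_⟩
  · refine ⟨hb₈, ?_, ?_, fun i hi => ?_, ?_, ?_, ?_⟩
    · rw [Memory.set_of_ne _ (by decide), hkeep _ (by decide), ha₅ _ (by decide),
        ha₄ _ (by decide), hm0]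
    · rw [hqry, hm₂, Memory.set_same, x.length_encode]; push_cast; ring
    · rw [hqry, hm₂, Memory.set_apply, if_neg (by omega), add_comm]; exact hv₁ i hi
    · rw [Memory.set_of_ne _ (by decide), hkeep _ (by decide), h10₅]
    · rw [Memory.set_of_ne _ (by decide), h11]
    · rw [Memory.set_of_ne _ (by decide), hw₇ 0 (by norm_num), Memory.set_same]
  · rw [Memory.set_same]
  · refine Holds.stateOf_eq ⟨fun i j => ?_, fun i => ?_⟩
    · rw [Memory.set_of_ne _ (by decide)]; exact hv₇ i j
    · rw [Memory.set_of_ne _ (by decide), hkeep _ (by decide), ha₅ _ (by decide),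
        ha₄ _ (by decide), hz _ (by decide)]; rfl

open Classical in
/-- An upper bound for the expectation of a function of the final state from a potential function
`V j k s`, where `j` is the scale and `k` the number of samples to come for this scale. -/
theorem wp_reduction (hB : x.Fits B) (V : ℕ → ℕ → RowState x.n → ℝ≥0∞) (out : RowState x.n → ℝ≥0∞)
    (hV0 : ∀ j k s, V j k s ≠ ⊤ → ∀ i j, |s.1 i j| ≤ 2 ^ x.answerSize)
    (hV1 : ∀ j k s, j ≤ 2 * x.logSize → k < 100 * x.n → V j (k + 1) s ≠ ⊤ →
      (O (x.scaleQuery j)).expect (fun l => V j k (x.scaleUpdate j s l)) ≤ V j (k + 1) s)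
    (hV2 : ∀ j s, j < 2 * x.logSize → V j (100 * x.n) s ≤ V (j + 1) 0 s)
    (hV3 : ∀ s, out s ≤ V 0 0 s) :
    Wp B O reductionP (startConfig x.encode).mem
      (fun m => if m.Bdd B ∧ m 1 0 = (x.n : ℤ) * x.n then out (x.stateOf m) else ⊤)
      (V (2 * x.logSize) (100 * x.n) (1, 0)) := by
  obtain ⟨m₁, hr, hF, h13, hst⟩ := runs_init hB
  -- `r` is the number of rounds of the outer loop to come; the next scale is then number r - 1, and
  -- r = 0 is the end, with 0 in array 13.
  let A : ℕ → ℤ := fun r => if r = 0 then 0 else 2 ^ (r - 1)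
  let W : ℕ → RowState x.n → ℝ≥0∞ := fun r => if r = 0 then out else V (r - 1) (100 * x.n)
  let g : ℕ → Memory → ℝ≥0∞ := fun r m =>
    if x.Frame B m ∧ m 13 0 = A r then W r (x.stateOf m) else ⊤
  refine Wp.mono (Wp.seq hr.wp (g := g (2 * x.logSize + 1)) fun m _ => ?_) ?_
  · refine Wp.loop hB.scales g (fun m h => ?_) fun j m hj h => ?_
    · have hP : x.Frame B m ∧ m 13 0 = A 0 := by by_contra hc; exact h (if_neg hc)
      refine ⟨hP.1.bdd, by simp [hP.2, A], ?_⟩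
      rw [if_pos ⟨hP.1.bdd, hP.1.output⟩]
      simp only [g, if_pos hP, W, if_pos, le_refl]
    · have hP : x.Frame B m ∧ m 13 0 = A (j + 1) := by by_contra hc; exact h (if_neg hc)
      have hA : m 13 0 = 2 ^ j := hP.2
      refine ⟨hP.1.bdd, by simp [hA], ?_⟩
      have hg : g (j + 1) m = V j (100 * x.n) (x.stateOf m) := if_pos hP
      rw [hg]
      refine wp_scale hB (by omega) (V j) (hV0 j) (fun k s hk hs => hV1 j k s (by omega) hk hs)
        (fun m' hF' h' => ?_) hP.1 hA
      have hAj : m' 13 0 = A j := by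
        rw [h']
        rcases j with _ | j
        · rfl
        · rw [pow_succ, Int.mul_ediv_cancel _ two_ne_zero]; rfl
      simp only [g, if_pos (⟨hF', hAj⟩ : x.Frame B m' ∧ m' 13 0 = A j)]
      rcases j with _ | j
      · exact hV3 _
      · exact hV2 j _ (by omega)
  · have : g (2 * x.logSize + 1) m₁ = V (2 * x.logSize) (100 * x.n) (x.stateOf m₁) :=
      if_pos ⟨hF, h13⟩
    rw [this, hst]

end

noncomputable section

/-! ### Running time -/

/-- An entry of b bits, sign included, has square below 4^(b - 1), and the product of the bounds
dominates the sum. Hence K is at most twice the input length. -/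
theorem sum_mul_self_lt (l : List ℤ) :
    ∑ i ∈ Finset.range l.length, l.getD i 0 * l.getD i 0 < 4 ^ listSize l := by
  induction l with
  | nil => simp [listSize]
  | cons a l ih =>
    rw [List.length_cons, Finset.sum_range_succ']
    simp only [List.getD_cons_succ, List.getD_cons_zero]
    have h1 : listSize (a :: l) = bitLen a + listSize l := by simp [listSize]
    obtain ⟨y, hy⟩ := Nat.exists_eq_add_of_le' (bitLen_pos a)
    have h2 := bitLen_le_iff.mp hy.le
    have h3 : a * a < 4 ^ y := by
      rw [← abs_mul_abs_self, show (4 : ℤ) = 2 * 2 by norm_num, mul_pow]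
      exact mul_self_lt_mul_self (abs_nonneg a) h2
    rw [h1, hy, show y + 1 + listSize l = y + listSize l + 1 by ring, pow_succ, pow_add]
    have h4 : (1 : ℤ) ≤ 4 ^ y := one_le_pow₀ (by norm_num)
    have h5 : (1 : ℤ) ≤ 4 ^ listSize l := one_le_pow₀ (by norm_num)
    nlinarith

theorem natCast_le_two_pow {n u : ℕ} (h : n ≤ u) : (n : ℤ) ≤ 2 ^ u := by
  exact_mod_cast h.trans Nat.lt_two_pow_self.le

namespace LatticeBasis

variable (x : LatticeBasis)

theorem length_encode_le : x.n * x.n + 2 ≤ listSize x.encode :=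
  x.length_encode ▸ length_le_listSize x.encode

theorem n_le_listSize : x.n ≤ listSize x.encode :=
  (Nat.le_mul_self _).trans ((Nat.le_add_right _ 2).trans x.length_encode_le)

theorem logSize_le : x.logSize ≤ 2 * listSize x.encode := by
  refine Nat.clog_le_of_le_pow ?_
  have h := (sum_mul_self_lt x.encode).le
  rw [Int.toNat_le, pow_mul]
  exact_mod_cast h

/-- The answers have O(s³) bits, where s is the input length. The largest numbers are powers with
exponent n ≤ s of numbers of this size and have O(s⁴) bits, so degree 5 leaves room. -/
theorem fits : x.Fits (100 * (listSize x.encode + 1) ^ 5) := by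
  have hn := x.n_le_listSize
  have hnn := x.length_encode_le
  have hK := x.logSize_le
  have hsq := sum_mul_self_lt x.encode
  obtain ⟨s, hs⟩ : ∃ s, listSize x.encode = s := ⟨_, rfl⟩
  rw [hs] at hn hnn hK hsq ⊢
  have hu1 : 1 ≤ s + 1 := by omega
  have hu (k : ℕ) (hk : k ≤ 5) : (s + 1) ^ k ≤ (s + 1) ^ 5 := pow_le_pow_right₀ hu1 hk
  have e1 : s + 1 ≤ (s + 1) ^ 5 := le_self_pow₀ hu1 (by norm_num)
  have e2 := hu 2 (by norm_num)
  have e3 := hu 3 (by norm_num)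
  have e4 := hu 4 (by norm_num)
  have hb : x.answerSize ≤ 8 * (s + 1) ^ 3 := by
    calc x.n * (4 * x.logSize * x.n + 2) ≤ s * (4 * (2 * s) * s + 2) := by gcongr
      _ ≤ 8 * (s + 1) ^ 3 := by nlinarith [Nat.zero_le (s ^ 2)]
  have e5 : (s + 1) + (1 + (s + 1) * 2 + 8 * (s + 1) ^ 3) * (s + 1) < 100 * (s + 1) ^ 5 := by
    have : (1 + (s + 1) * 2 + 8 * (s + 1) ^ 3) * (s + 1) =
      (s + 1) + 2 * (s + 1) ^ 2 + 8 * (s + 1) ^ 4 := by ring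
    omega
  have e6 : (s + 1) + ((s + 1) + (8 * (s + 1) ^ 3 + s)) * 2 < 100 * (s + 1) ^ 5 := by omega
  have e7 : 100 * x.n ≤ 100 * (s + 1) ^ 5 ∧ x.n * x.n + 4 ≤ 100 * (s + 1) ^ 5 ∧
      2 * x.logSize + 1 ≤ 100 * (s + 1) ^ 5 ∧ s ≤ 100 * (s + 1) ^ 5 ∧
      x.answerSize ≤ 100 * (s + 1) ^ 5 ∧ 2 * s < 100 * (s + 1) ^ 5 := by omega
  generalize 100 * (s + 1) ^ 5 = B at e5 e6 e7 ⊢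
  generalize 8 * (s + 1) ^ 3 = c at hb e5 e6
  have hnZ : (x.n : ℤ) ≤ 2 ^ (s + 1) := natCast_le_two_pow (by omega)
  have hbZ : (2 : ℤ) ^ x.answerSize ≤ 2 ^ c := pow_le_pow_right₀ (by norm_num) hb
  have hlt : ∀ k, k < B → (2 : ℤ) ^ k < 2 ^ (B) := fun k hk =>
    pow_lt_pow_right₀ (by norm_num) hk
  refine ⟨e7.1, e7.2.1, e7.2.2.1, hs.trans_le e7.2.2.2.1, e7.2.2.2.2.1, ?_, ?_, ?_⟩
  · rw [show (4 : ℤ) = 2 ^ 2 by norm_num, ← pow_mul] at hsq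
    exact hsq.trans (hlt _ e7.2.2.2.2.2)
  · have h1 : 2 * (x.n : ℤ) ^ 2 * 2 ^ x.answerSize ≤ 2 ^ (1 + (s + 1) * 2 + c) := by
      rw [pow_add, pow_add, pow_mul, pow_one]
      gcongr
    have h0 : 1 ≤ 2 * (x.n : ℤ) ^ 2 * 2 ^ x.answerSize := by
      have : (1 : ℤ) ≤ x.n := by exact_mod_cast x.n_pos
      have h2 : (1 : ℤ) ≤ 2 ^ x.answerSize := one_le_pow₀ (by norm_num)
      have h3 : (1 : ℤ) ≤ (x.n : ℤ) ^ 2 := one_le_pow₀ this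
      nlinarith
    calc (x.n : ℤ) * (2 * (x.n : ℤ) ^ 2 * 2 ^ x.answerSize) ^ x.n
        ≤ 2 ^ (s + 1) * (2 ^ (1 + (s + 1) * 2 + c)) ^ (s + 1) := by
          refine mul_le_mul hnZ ?_ (by positivity) (by positivity)
          exact (pow_le_pow_right₀ h0 (by omega)).trans (pow_le_pow_left₀ (by positivity) h1 _)
      _ = 2 ^ ((s + 1) + (1 + (s + 1) * 2 + c) * (s + 1)) := by
          rw [← pow_mul, ← pow_add]
      _ < _ := hlt _ e5
  · rw [hs]
    calc (x.n : ℤ) * (x.n * (2 ^ x.answerSize * 2 ^ s)) ^ 2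
        ≤ 2 ^ (s + 1) * (2 ^ (s + 1) * (2 ^ c * 2 ^ s)) ^ 2 := by gcongr
      _ = 2 ^ ((s + 1) + ((s + 1) + (c + s)) * 2) := by
          rw [← pow_add, ← pow_add, ← pow_mul, ← pow_add]
      _ < _ := hlt _ e6

end LatticeBasis

theorem listSize_readList_le {m : Memory} {B : ℕ} (hm : m.Bdd B) (k : ℕ) :
    listSize (readList (m k)) ≤ (readList (m k)).length * (B + 1) := by
  have h1 : ∀ y ∈ (readList (m k)).map bitLen, y ≤ B + 1 := by
    intro y hy
    obtain ⟨z, hz, rfl⟩ := List.mem_map.mp hy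
    rw [readList] at hz
    obtain ⟨j, -, rfl⟩ := List.mem_map.mp hz
    exact bitLen_le_iff.mpr (hm k _)
  have := List.sum_le_card_nsmul _ _ h1
  rwa [List.length_map, smul_eq_mul] at this

theorem PMF.expect_const_le {α : Type*} (p : PMF α) {f : α → ℝ≥0∞} {c : ℝ≥0∞} (h : ∀ a, f a ≤ c) :
    p.expect f ≤ c := by
  refine (p.expect_mono h).trans_eq ?_
  rw [PMF.expect, ENNReal.tsum_mul_right, p.tsum_coe, one_mul]

theorem PMF.toOuterMeasure_map_le_expect {α β : Type*} (p : PMF α) (g : α → β) (S : Set β)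
    {f : α → ℝ≥0∞} (h : ∀ a, g a ∈ S → 1 ≤ f a) : (p.map g).toOuterMeasure S ≤ p.expect f := by
  rw [PMF.toOuterMeasure_map_apply, PMF.toOuterMeasure_apply]
  refine ENNReal.tsum_le_tsum fun a => ?_
  by_cases ha : a ∈ g ⁻¹' S
  · rw [Set.indicator_of_mem ha]
    exact le_mul_of_one_le_right zero_le (h a ha)
  · rw [Set.indicator_of_notMem ha]
    exact zero_le

theorem readList_output {x : LatticeBasis} {m : Memory} (h : m 1 0 = (x.n : ℤ) * x.n) :
    readList (m 1) = encodeMatrix (x.stateOf m).1 := by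
  refine readList_eq (by rw [h, length_encodeMatrix]; push_cast; rfl) fun t ht => ?_
  rw [length_encodeMatrix] at ht
  have hpos : 0 < x.n := x.n_pos
  have e : t = t / x.n * x.n + t % x.n := by rw [mul_comm, Nat.div_add_mod]
  have h1 := getD_encodeMatrix (x.stateOf m).1 ⟨t / x.n, Nat.div_lt_of_lt_mul ht⟩
    ⟨t % x.n, Nat.mod_lt _ hpos⟩
  simp only [← e] at h1
  rw [h1]
  simp only [LatticeBasis.stateOf]
  rw [add_comm]
  congr 2
  exact_mod_cast congrArg (Nat.cast (R := ℤ)) e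

/-- A bound for the size of the numbers in the computation. -/
def sizeBound (s : ℕ) : ℕ := 100 * (s + 1) ^ 5

theorem exists_polynomial_time : ∃ T : Polynomial ℕ, ∀ s,
    T.eval s = reductionP.tm (sizeBound s) + s * (sizeBound s + 1) := by
  obtain ⟨P, hP⟩ := reductionP.exists_polynomial_tm
  refine ⟨P.comp (100 * (Polynomial.X + 1) ^ 5) +
    Polynomial.X * (100 * (Polynomial.X + 1) ^ 5 + 1), fun s => ?_⟩
  simp [hP, sizeBound]

open Classical in
/-- The program respects any time bound `T` that dominates its running time on entries of the
right size. -/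
theorem reductionP_runsInTime (γ : ℕ → ℝ) (φ : LatticeFun) {T : ℕ → ℕ}
    (hT : ∀ s, T s = reductionP.tm (sizeBound s) + s * (sizeBound s + 1)) :
    reductionP.RunsInTime (GIVP γ φ) T := by
  intro O x r hr
  change LatticeBasis at x
  change r ∈ (reductionP.exec O (T (listSize x.encode)) (startConfig x.encode)).support at hr
  change ∃ c : Config, r = some c ∧ c.time + listSize c.output ≤ T (listSize x.encode)
  obtain ⟨B, hBdef⟩ : ∃ B, sizeBound (listSize x.encode) = B := ⟨_, rfl⟩
  have hB : x.Fits B := hBdef ▸ x.fits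
  -- The potential is 1 as long as the entries are bounded. Since the expectation is finite, no
  -- outcome of positive probability has value `⊤`: every run ends in time.
  let V : ℕ → ℕ → RowState x.n → ℝ≥0∞ := fun _ _ s =>
    if ∀ i j, |s.1 i j| ≤ 2 ^ x.answerSize then 1 else ⊤
  have hwp := wp_reduction (O := O) hB V (fun _ => 1)
    (fun j k s h => by by_contra hc; exact h (if_neg hc))
    (fun j k s _ _ h => by
      have hs : ∀ i j, |s.1 i j| ≤ 2 ^ x.answerSize := by by_contra hc; exact h (if_neg hc)
      simp only [V, if_pos hs]
      exact PMF.expect_const_le _ fun l => (if_pos (x.abs_process_le hs le_rfl)).le)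
    (fun j s _ => le_rfl)
    (fun s => by simp only [V]; split_ifs <;> simp)
  have h1 : V (2 * x.logSize) (100 * x.n) (1, 0) = 1 := by
    refine if_pos fun i j => ?_
    have : (1 : ℤ) ≤ 2 ^ x.answerSize := one_le_pow₀ (by norm_num)
    simp only [Matrix.one_apply]
    split_ifs
    · simpa using this
    · rw [abs_zero]; linarith
  rw [h1] at hwp
  have h2 := hwp (T (listSize x.encode)) 0 (by rw [hT, hBdef]; exact Nat.le_add_right _ _)
  have h3 := (ENNReal.le_tsum r).trans h2
  have hr0 := (PMF.mem_support_iff _ _).mp hr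
  rcases r with _ | c
  · exfalso
    simp only [postVal] at h3
    exact absurd ((ENNReal.mul_top hr0).symm.le.trans h3) (by simp)
  · refine ⟨c, rfl, ?_⟩
    simp only [postVal] at h3
    have htop : (reductionP.exec O (T (listSize x.encode)) (startConfig x.encode)) (some c) * ⊤ = ⊤ :=
      ENNReal.mul_top hr0
    split_ifs at h3 with ht hc
    · have hlen : (readList (c.mem 1)).length = x.n * x.n := by
        rw [readList_output hc.2, length_encodeMatrix]
      have h4 := listSize_readList_le hc.1 1
      have h5 : x.n * x.n ≤ listSize x.encode := by have := x.length_encode_le; omega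
      have h6 : x.n * x.n * (B + 1) ≤ listSize x.encode * (B + 1) := Nat.mul_le_mul_right _ h5
      rw [hlen] at h4
      rw [hT, hBdef, Config.output]
      omega
    · exact absurd (htop.symm.le.trans h3) (by simp)
    · exact absurd (htop.symm.le.trans h3) (by simp)

open Classical in
/-- The failure probability is bounded by the initial value of a potential function. -/
theorem err_reductionP_le (γ : ℕ → ℝ) (φ : LatticeFun) (x : LatticeBasis) {O : Oracle} {F : ℕ}
    (hF : reductionP.tm (sizeBound (listSize x.encode)) ≤ F)
    (V : ℕ → ℕ → RowState x.n → ℝ≥0∞)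
    (hV0 : ∀ j k s, V j k s ≠ ⊤ → ∀ i j, |s.1 i j| ≤ 2 ^ x.answerSize)
    (hV1 : ∀ j k s, j ≤ 2 * x.logSize → k < 100 * x.n → V j (k + 1) s ≠ ⊤ →
      (O (x.scaleQuery j)).expect (fun l => V j k (x.scaleUpdate j s l)) ≤ V j (k + 1) s)
    (hV2 : ∀ j s, j < 2 * x.logSize → V j (100 * x.n) s ≤ V (j + 1) 0 s)
    (hV3 : ∀ s, ¬ x.IsShortSet (γ x.n * φ x.n x.lattice) (encodeMatrix s.1) → 1 ≤ V 0 0 s) :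
    (GIVP γ φ).err x (reductionP.outputDist O F x.encode) ≤
      V (2 * x.logSize) (100 * x.n) (1, 0) := by
  have hwp := wp_reduction (O := O) x.fits V
    (fun s => if x.IsShortSet (γ x.n * φ x.n x.lattice) (encodeMatrix s.1) then 0 else 1) hV0 hV1 hV2
    (fun s => by
      split_ifs with h
      exacts [zero_le, hV3 s h])
  refine le_trans (PMF.toOuterMeasure_map_le_expect _ _ _ fun r hr => ?_) (hwp F 0 hF)
  rcases r with _ | c
  · exact le_top
  · simp only [postVal]
    split_ifs with ht hc hs
    · exfalso
      apply hr
      simpa only [Option.elim_some, Config.output, readList_output hc.2] using hs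
    · exact le_rfl
    · exact le_top
    · exact le_top

end

noncomputable section

/-! ### Replacing rows: linear algebra -/

section ReplaceRows

variable {n : ℕ} {A : ℤ} {a : Fin n → ℤ} {s : RowState n}

theorem replaceRows_det_ne_zero (hs : s.1.det ≠ 0) (k : ℕ) : (replaceRows A a s k).1.det ≠ 0 := by
  induction k with
  | zero => exact hs
  | succ k ih =>
    rw [replaceRows]
    split_ifs with h
    · unfold replaceRow
      split_ifs with h2
      exacts [h2.1, ih]
    · exact ih

/-- Every row is either kept or replaced, and rows that already have the label are kept. -/
theorem replaceRows_row (k : ℕ) (i : Fin n) :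
    ((replaceRows A a s k).1 i = s.1 i ∧ (replaceRows A a s k).2 i = s.2 i) ∨
      ((replaceRows A a s k).1 i = a ∧ (replaceRows A a s k).2 i = A ∧ s.2 i ≠ A) := by
  induction k with
  | zero => exact Or.inl ⟨rfl, rfl⟩
  | succ k ih =>
    rw [replaceRows]
    split_ifs with h
    · unfold replaceRow
      split_ifs with h2
      · by_cases hi : i = ⟨k, h⟩
        · subst hi
          refine Or.inr ⟨by simp, by simp, ?_⟩
          rcases ih with ih | ih
          · rw [← ih.2]; exact h2.2
          · exact ih.2.2
        · simp only [Matrix.updateRow_ne hi, Function.update_of_ne hi]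
          exact ih
      · exact ih
    · exact ih

/-- As long as nothing has been replaced, each test is made with the original matrix, so a failed
test says that the corresponding determinant of `s` vanishes. -/
theorem replaceRows_progress (k : ℕ) (hk : k ≤ n) :
    (∃ i, s.2 i ≠ A ∧ (replaceRows A a s k).2 i = A) ∨ (replaceRows A a s k = s ∧
      ∀ i : Fin n, (i : ℕ) < k → s.2 i ≠ A → (s.1.updateRow i a).det = 0) := by
  induction k with
  | zero => exact Or.inr ⟨rfl, fun i hi => absurd hi (by omega)⟩
  | succ k ih =>
    rcases ih (by omega) with ⟨i, h1, h2⟩ | ⟨h1, h2⟩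
    · refine Or.inl ⟨i, h1, ?_⟩
      rw [replaceRows, dif_pos (show k < n by omega)]
      unfold replaceRow
      split_ifs with h3
      · simp only [Function.update_apply]
        split_ifs
        exacts [rfl, h2]
      · exact h2
    · have hkn : k < n := by omega
      rw [replaceRows, dif_pos hkn, h1]
      by_cases h3 : (s.1.updateRow ⟨k, hkn⟩ a).det ≠ 0 ∧ s.2 ⟨k, hkn⟩ ≠ A
      · refine Or.inl ⟨⟨k, hkn⟩, h3.2, ?_⟩
        rw [replaceRow, if_pos h3]
        simp
      · refine Or.inr ⟨by rw [replaceRow, if_neg h3], fun i hi hA => ?_⟩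
        rcases Nat.lt_succ_iff_lt_or_eq.mp hi with hi | hi
        · exact h2 i hi hA
        · obtain rfl : i = ⟨k, hkn⟩ := Fin.ext hi
          by_contra hc
          exact h3 ⟨hc, hA⟩

/-- This is Cramer's rule. If every admissible replacement by `a` is singular, only the labelled
rows contribute to the right-hand side, so a multiple of `a` lies in their span. -/
theorem det_smul_eq_sum (Z : Matrix (Fin n) (Fin n) ℤ) (a : Fin n → ℤ) :
    Z.det • a = ∑ i, (Z.updateRow i a).det • Z i := by
  have h := Matrix.mulVec_cramer Z.transpose a
  rw [Matrix.det_transpose] at h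
  rw [← h]
  ext j
  simp only [Matrix.mulVec, dotProduct, Matrix.transpose_apply, Matrix.cramer_transpose_apply,
    Finset.sum_apply, Pi.smul_apply, smul_eq_mul]
  exact Finset.sum_congr rfl fun i _ => mul_comm _ _

end ReplaceRows

namespace LatticeBasis

variable (x : LatticeBasis)

/-! ### The geometry of the lattice -/

theorem linearIndependent_vec : LinearIndependent ℝ x.vec := by
  have hd : (x.den : ℝ) ≠ 0 := by exact_mod_cast x.den_pos.ne'
  have h1 : (x.mat.map (Int.cast : ℤ → ℝ)).det ≠ 0 := by
    have h := RingHom.map_det (Int.castRingHom ℝ) x.mat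
    simp only [RingHom.mapMatrix_apply, Int.coe_castRingHom] at h
    rw [← h]
    exact_mod_cast x.det_ne_zero
  have h2 : (((x.den : ℝ)⁻¹) • x.mat.map (Int.cast : ℤ → ℝ)).det ≠ 0 := by
    rw [Matrix.det_smul]
    exact mul_ne_zero (pow_ne_zero _ (inv_ne_zero hd)) h1
  have h3 := (Matrix.linearIndependent_rows_of_det_ne_zero h2).map'
    (WithLp.linearEquiv 2 ℝ (Fin x.n → ℝ)).symm.toLinearMap (LinearEquiv.ker _)
  have h4 : x.vec = (WithLp.linearEquiv 2 ℝ (Fin x.n → ℝ)).symm.toLinearMap ∘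
      fun i => ((x.den : ℝ)⁻¹ • x.mat.map (Int.cast : ℤ → ℝ)) i := by
    funext i
    ext j
    simp [vec, div_eq_inv_mul]
  rw [h4]
  exact h3

/-- The basis of the space. -/
def basis : Module.Basis (Fin x.n) ℝ (Euc x.n) :=
  have : Nonempty (Fin x.n) := ⟨⟨0, x.n_pos⟩⟩
  basisOfLinearIndependentOfCardEqFinrank x.linearIndependent_vec (by simp)

theorem coe_basis : ⇑x.basis = x.vec := by simp [basis]

theorem lattice_eq : x.lattice = Submodule.span ℤ (Set.range x.basis) := by
  rw [coe_basis]; rfl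

instance : DiscreteTopology x.lattice := by rw [lattice_eq]; infer_instance

instance : IsZLattice ℝ x.lattice := by
  constructor
  rw [lattice_eq]
  exact IsZLattice.span_top

theorem point_apply (z : Fin x.n → ℤ) (j : Fin x.n) :
    x.point z j = ((∑ i, z i * x.mat i j : ℤ) : ℝ) / x.den := by
  simp only [point, vec, WithLp.ofLp_sum, WithLp.ofLp_smul, Finset.sum_apply, Pi.smul_apply]
  simp only [zsmul_eq_mul]
  push_cast
  rw [Finset.sum_div]
  exact Finset.sum_congr rfl fun i _ => by ring

theorem point_sum {ι : Type*} (S : Finset ι) (c : ι → ℤ) (Z : ι → Fin x.n → ℤ) :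
    x.point (∑ i ∈ S, c i • Z i) = ∑ i ∈ S, c i • x.point (Z i) := by
  simp only [point, Finset.sum_apply, Pi.smul_apply, Finset.smul_sum, Finset.sum_smul, smul_eq_mul,
    mul_smul]
  exact Finset.sum_comm

theorem point_smul (c : ℤ) (z : Fin x.n → ℤ) : x.point (c • z) = c • x.point z := by
  simp only [point, Pi.smul_apply, Finset.smul_sum, smul_eq_mul, mul_smul]

theorem linearIndependent_point {Z : Matrix (Fin x.n) (Fin x.n) ℤ} (hZ : Z.det ≠ 0) :
    LinearIndependent ℝ fun i => x.point (Z i) := by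
  have h1 : (Z.map (Int.cast : ℤ → ℝ)).det ≠ 0 := by
    have h := RingHom.map_det (Int.castRingHom ℝ) Z
    simp only [RingHom.mapMatrix_apply, Int.coe_castRingHom] at h
    rw [← h]
    exact_mod_cast hZ
  have h3 := (Matrix.linearIndependent_rows_of_det_ne_zero h1).map'
    x.basis.equivFun.symm.toLinearMap (LinearEquiv.ker _)
  have h4 : (fun i => x.point (Z i)) = x.basis.equivFun.symm.toLinearMap ∘
      fun i => (Z.map (Int.cast : ℤ → ℝ)) i := by
    funext i
    simp [point, Module.Basis.equivFun_symm_apply, coe_basis, Int.cast_smul_eq_zsmul]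
  rw [h4]
  exact h3

theorem norm_point_sq (z : Fin x.n → ℤ) : ‖x.point z‖ ^ 2 = x.sqNorm z / (x.den : ℝ) ^ 2 := by
  rw [EuclideanSpace.norm_sq_eq, sqNorm]
  push_cast
  rw [Finset.sum_div]
  refine Finset.sum_congr rfl fun j _ => ?_
  rw [point_apply, Real.norm_eq_abs, sq_abs, div_pow]
  push_cast
  ring

theorem mem_lattice_iff (v : Euc x.n) : v ∈ x.lattice ↔ ∃ z, x.point z = v := by
  rw [lattice, Submodule.mem_span_range_iff_exists_fun]
  rfl

theorem sqNorm_le_iff {num rden : ℤ} (hnum : 0 < num) (hrden : 0 < rden) (z : Fin x.n → ℤ) :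
    x.sqNorm z * (rden * rden) ≤ x.n * (num * num) * ((x.den : ℤ) * x.den) ↔
      ‖x.point z‖ ≤ √x.n * (num / rden) := by
  have hd : (0 : ℝ) < x.den := by exact_mod_cast x.den_pos
  have h1 : (0 : ℝ) < num := by exact_mod_cast hnum
  have h2 : (0 : ℝ) < rden := by exact_mod_cast hrden
  have h3 : (0 : ℝ) ≤ √x.n * (num / rden) := by positivity
  rw [← sq_le_sq₀ (norm_nonneg _) h3, norm_point_sq, mul_pow, Real.sq_sqrt (by positivity), div_pow,
    ← mul_div_assoc, div_le_div_iff₀ (by positivity) (by positivity)]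
  rw [← Int.cast_le (R := ℝ)]
  push_cast
  simp only [sq]

/-! ### Sizes -/

theorem sqSize_eq : x.sqSize = (x.n : ℤ) ^ 2 + (x.den : ℤ) ^ 2 + ∑ i, ∑ j, x.mat i j ^ 2 := by
  have h : ∀ l : List ℤ, ∑ i ∈ Finset.range l.length, l.getD i 0 * l.getD i 0 =
      (l.map fun y => y ^ 2).sum := by
    intro l
    induction l with
    | nil => simp
    | cons a l ih =>
      rw [List.length_cons, Finset.sum_range_succ']
      simp only [List.getD_cons_succ, List.getD_cons_zero, List.map_cons, List.sum_cons]
      rw [ih]; ring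
  rw [sqSize, h, encode, List.map_cons, List.map_cons, List.sum_cons, List.sum_cons, ← add_assoc,
    encodeMatrix, List.map_flatten, List.sum_flatten, List.map_map, List.map_ofFn, List.sum_ofFn]
  congr 1
  refine Finset.sum_congr rfl fun i _ => ?_
  simp [List.map_ofFn, List.sum_ofFn]

theorem mat_sq_le (i j : Fin x.n) : x.mat i j ^ 2 ≤ ∑ i, ∑ j, x.mat i j ^ 2 :=
  (Finset.single_le_sum (f := fun j => x.mat i j ^ 2) (fun _ _ => sq_nonneg _) (Finset.mem_univ j)).trans
    (Finset.single_le_sum (f := fun i => ∑ j, x.mat i j ^ 2)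
      (fun _ _ => Finset.sum_nonneg fun _ _ => sq_nonneg _) (Finset.mem_univ i))

theorem sum_sq_le : (x.n : ℤ) ^ 2 + (x.den : ℤ) ^ 2 + ∑ i, ∑ j, x.mat i j ^ 2 ≤ 2 ^ x.logSize :=
  x.sqSize_eq ▸ x.sqSize_le_two_pow

theorem sum_mat_sq_nonneg : 0 ≤ ∑ i, ∑ j, x.mat i j ^ 2 :=
  Finset.sum_nonneg fun _ _ => Finset.sum_nonneg fun _ _ => sq_nonneg _

theorem n_sq_le : (x.n : ℤ) ^ 2 ≤ 2 ^ x.logSize := by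
  have := x.sum_sq_le; have := x.sum_mat_sq_nonneg; nlinarith [sq_nonneg (x.den : ℤ)]

theorem den_sq_le : (x.den : ℤ) ^ 2 ≤ 2 ^ x.logSize := by
  have := x.sum_sq_le; have := x.sum_mat_sq_nonneg; nlinarith [sq_nonneg (x.n : ℤ)]

theorem sum_mat_sq_le : ∑ i, ∑ j, x.mat i j ^ 2 ≤ 2 ^ x.logSize := by
  have := x.sum_sq_le; nlinarith [sq_nonneg (x.n : ℤ), sq_nonneg (x.den : ℤ)]

theorem n_le_two_pow : (x.n : ℤ) ≤ 2 ^ x.logSize := by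
  have h := x.n_sq_le
  have : (1 : ℤ) ≤ x.n := by exact_mod_cast x.n_pos
  nlinarith

theorem den_le_two_pow : (x.den : ℤ) ≤ 2 ^ x.logSize := by
  have h := x.den_sq_le
  have : (1 : ℤ) ≤ x.den := by exact_mod_cast x.den_pos
  nlinarith

/-- The rows of the identity matrix stand for the given basis, which therefore is a solution when
φ(L) is at least the largest scale. -/
theorem norm_vec_le (i : Fin x.n) : ‖x.point ((1 : Matrix (Fin x.n) (Fin x.n) ℤ) i)‖ ≤ 2 ^ x.logSize := by
  have hd : (1 : ℝ) ≤ x.den := by exact_mod_cast x.den_pos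
  have h1 : (1 : ℝ) ≤ 2 ^ x.logSize := one_le_pow₀ (by norm_num)
  have h2 : x.sqNorm ((1 : Matrix (Fin x.n) (Fin x.n) ℤ) i) ≤ 2 ^ x.logSize := by
    refine le_trans (le_of_eq ?_) ((Finset.single_le_sum (f := fun i => ∑ j, x.mat i j ^ 2)
      (fun _ _ => Finset.sum_nonneg fun _ _ => sq_nonneg _) (Finset.mem_univ i)).trans x.sum_mat_sq_le)
    refine Finset.sum_congr rfl fun j _ => ?_
    simp [Matrix.one_apply, sq]
  have h3 : (x.sqNorm ((1 : Matrix (Fin x.n) (Fin x.n) ℤ) i) : ℝ) ≤ 2 ^ x.logSize := by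
    exact_mod_cast h2
  have h4 : (0 : ℝ) ≤ x.sqNorm ((1 : Matrix (Fin x.n) (Fin x.n) ℤ) i) := by
    exact_mod_cast Finset.sum_nonneg fun j _ => mul_self_nonneg _
  rw [← sq_le_sq₀ (norm_nonneg _) (by positivity), norm_point_sq]
  refine (div_le_self h4 (one_le_pow₀ hd)).trans (h3.trans ?_)
  exact le_self_pow₀ h1 two_ne_zero

/-- Coefficient vectors of short lattice vectors have few bits. -/
theorem listSize_le_answerSize {l : List ℤ} (hl : l.length = x.n)
    (h : ‖x.point (coeffs x.n l)‖ ≤ √x.n * 2 ^ x.logSize) : listSize l ≤ x.answerSize := by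
  set K := x.logSize with hK
  have hn1 : (1 : ℝ) ≤ x.n := by exact_mod_cast x.n_pos
  have hd0 : (0 : ℝ) < x.den := by exact_mod_cast x.den_pos
  -- From n² + den² ≤ 2^K by the inequality of the means, together with √n ≤ n.
  have hdn : (x.den : ℝ) * √x.n ≤ 2 ^ K := by
    have e1 : ((x.n : ℝ)) ^ 2 + (x.den : ℝ) ^ 2 ≤ 2 ^ K := by
      have := x.sum_sq_le
      have h0 := x.sum_mat_sq_nonneg
      have : (x.n : ℤ) ^ 2 + (x.den : ℤ) ^ 2 ≤ 2 ^ K := by linarith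
      exact_mod_cast this
    have e2 : √(x.n : ℝ) ≤ x.n := Real.sqrt_le_iff.mpr ⟨by positivity, by nlinarith⟩
    nlinarith [sq_nonneg ((x.n : ℝ) - x.den), Real.sqrt_nonneg (x.n : ℝ)]
  have hw : ∀ j, |∑ i, coeffs x.n l i * x.mat i j| ≤ (2 ^ (2 * K) : ℤ) := by
    intro j
    have h1 : |x.point (coeffs x.n l) j| ≤ √x.n * 2 ^ K :=
      ((Real.norm_eq_abs _).symm.le.trans (PiLp.norm_apply_le _ j)).trans h
    rw [point_apply, abs_div, abs_of_pos hd0, div_le_iff₀ hd0] at h1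
    have h2 : |((∑ i, coeffs x.n l i * x.mat i j : ℤ) : ℝ)| ≤ 2 ^ (2 * K) := by
      refine h1.trans ?_
      rw [two_mul, pow_add]
      nlinarith [show (0 : ℝ) ≤ 2 ^ K by positivity]
    exact_mod_cast h2
  have hmat : ∀ i j, |x.mat i j| ≤ (2 ^ (2 * K) : ℤ) := by
    intro i j
    have h1 := (x.mat_sq_le i j).trans x.sum_mat_sq_le
    have h2 : (2 : ℤ) ^ K ≤ 2 ^ (2 * K) := pow_le_pow_right₀ (by norm_num) (by omega)
    have h3 : |x.mat i j| ≤ x.mat i j ^ 2 := by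
      rw [← sq_abs]
      exact Int.le_self_sq _
    linarith
  have hz : ∀ i, |coeffs x.n l i| < 2 ^ (4 * K * x.n + 1) := by
    intro i
    -- By Cramer's rule the coefficient is a quotient by a nonzero integer of a determinant with
    -- entries at most 2^(2K). With n! ≤ 2^(Kn) this gives the bound 2^(3Kn).
    have h1 : x.mat.det * coeffs x.n l i =
        (x.mat.updateRow i (Matrix.vecMul (coeffs x.n l) x.mat)).det := by
      rw [← Matrix.cramer_transpose_apply, ← Matrix.mulVec_transpose, Matrix.cramer_eq_adjugate_mulVec,
        Matrix.mulVec_mulVec, Matrix.adjugate_mul, Matrix.smul_mulVec, Matrix.one_mulVec,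
        Matrix.det_transpose]
      rfl
    have h2 := Matrix.det_le (abv := AbsoluteValue.abs) (x := (2 : ℤ) ^ (2 * K))
      (A := x.mat.updateRow i (Matrix.vecMul (coeffs x.n l) x.mat)) (fun i' j' => by
        rw [Matrix.updateRow_apply]
        split_ifs
        · exact hw j'
        · exact hmat i' j')
    rw [Fintype.card_fin, ← h1, AbsoluteValue.abs_apply, abs_mul, nsmul_eq_mul] at h2
    have h3 : 1 ≤ |x.mat.det| := Int.one_le_abs x.det_ne_zero
    have h4 : ((x.n.factorial : ℕ) : ℤ) ≤ (2 ^ K) ^ x.n := by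
      have h5 : ((x.n.factorial : ℕ) : ℤ) ≤ (x.n : ℤ) ^ x.n := by
        exact_mod_cast Nat.factorial_le_pow x.n
      exact h5.trans (pow_le_pow_left₀ (by positivity) x.n_le_two_pow _)
    calc |coeffs x.n l i| ≤ |x.mat.det| * |coeffs x.n l i| :=
          le_mul_of_one_le_left (abs_nonneg _) h3
      _ ≤ (2 ^ K) ^ x.n * (2 ^ (2 * K)) ^ x.n := h2.trans (by gcongr)
      _ = 2 ^ (3 * K * x.n) := by rw [← pow_mul, ← pow_mul, ← pow_add]; ring_nf
      _ < _ := pow_lt_pow_right₀ (by norm_num) (by nlinarith [Nat.zero_le (K * x.n)])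
  have hb : ∀ y ∈ l.map bitLen, y ≤ 4 * K * x.n + 2 := by
    intro y hy
    obtain ⟨c, hc, rfl⟩ := List.mem_map.mp hy
    obtain ⟨i, hi, rfl⟩ := List.getElem_of_mem hc
    refine bitLen_le_iff.mpr ?_
    have := hz ⟨i, hl ▸ hi⟩
    rwa [coeffs, List.getD_eq_getElem _ _ hi] at this
  have := List.sum_le_card_nsmul _ _ hb
  rwa [List.length_map, smul_eq_mul, hl] at this

/-- The limit on the bits never rejects a vector that is short enough, since no scale exceeds 2^K.
-/
theorem accepts_iff {j : ℕ} (hj : j ≤ 2 * x.logSize) (l : List ℤ) :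
    x.Accepts (2 ^ (j - x.logSize)) (2 ^ (x.logSize - j)) x.answerSize l ↔
      l.length = x.n ∧ ‖x.point (coeffs x.n l)‖ ≤ √x.n * (2 ^ (j - x.logSize) / 2 ^ (x.logSize - j)) := by
  rw [Accepts, x.sqNorm_le_iff (by positivity) (by positivity)]
  push_cast
  refine ⟨fun h => h.2, fun h => ⟨x.listSize_le_answerSize h.1 (h.2.trans ?_), h⟩⟩
  gcongr
  refine (div_le_self (by positivity) (one_le_pow₀ (by norm_num))).trans ?_
  exact pow_le_pow_right₀ (by norm_num) (by omega)

/-- Because den · L consists of integer vectors, den times a unit vector is a dual vector, of norm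
at most 2^K. So the smallest scale 2^(-K) lies at or below every admissible φ(L). -/
theorem two_pow_neg_le {ε : ℝ} (hε : 0 < ε) (hε1 : ε ≤ 1 / 10) :
    1 ≤ √2 * smoothingParameter ε x.lattice * 2 ^ x.logSize := by
  have hd0 : (0 : ℝ) < x.den := by exact_mod_cast x.den_pos
  have hη := smoothingParameter_pos x.lattice x.n_pos hε hε1
  set y : Euc x.n := EuclideanSpace.single ⟨0, x.n_pos⟩ (x.den : ℝ) with hy
  have hyn : ‖y‖ = x.den := by rw [hy, PiLp.norm_single, Real.norm_eq_abs, abs_of_pos hd0]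
  have hmem : y ∈ dualLattice x.lattice := by
    refine mem_innerDual.mpr fun v hv => ?_
    obtain ⟨z, rfl⟩ := (x.mem_lattice_iff v).mp hv
    refine ⟨∑ i, z i * x.mat i ⟨0, x.n_pos⟩, ?_⟩
    rw [hy, EuclideanSpace.inner_single_left, point_apply]
    simp
    field_simp
  have h := one_le_smoothingParameter_mul_norm x.lattice x.n_pos hε hε1 hmem
    (by rw [← norm_pos_iff, hyn]; exact hd0)
  rw [hyn] at h
  refine h.trans ?_
  have : (x.den : ℝ) ≤ 2 ^ x.logSize := by exact_mod_cast x.den_le_two_pow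
  gcongr

end LatticeBasis

end

noncomputable section

/-! ### The probability of a useful sample -/

section

variable {n : ℕ} (L : Submodule ℤ (Euc n)) [DiscreteTopology L] [IsZLattice ℝ L]

/-- A union bound: escaping from `H` has probability at least 1/10, and being long has probability
at most 2^(-n). -/
theorem tsum_discreteGaussian_short_notMem_ge {ε r : ℝ} (hε : 0 < ε) (hε1 : ε ≤ 1 / 10)
    (hr : √2 * smoothingParameter ε L ≤ r) (H : Submodule ℝ (Euc n)) (hH : Module.finrank ℝ H < n) :
    ENNReal.ofReal (1 / 10 - (1 / 2) ^ n) ≤ ∑' v : L, ENNReal.ofReal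
      (Set.indicator {v : L | (v : Euc n) ∉ H ∧ ‖(v : Euc n)‖ ≤ √n * r}
        (fun v : L => discreteGaussian L r v) v) := by
  have hn : 0 < n := by omega
  have hr0 : 0 < r := (mul_pos (by positivity) (smoothingParameter_pos L hn hε hε1)).trans_le hr
  have hmass := gaussianMass_pos L hr0
  set f : L → ℝ := fun v => discreteGaussian L r v with hf
  have hfeq : ∀ v : L, f v = gaussian r (v : Euc n) / gaussianMass r (L : Set (Euc n)) := fun v => by
    simp [hf, discreteGaussian]
  have hf0 : ∀ v, 0 ≤ f v := fun v => by
    rw [hfeq]; exact div_nonneg (gaussian_pos _ _).le hmass.le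
  have hsum : Summable f := by
    simp only [funext hfeq]
    exact (summable_gaussian L hr0).div_const _
  have h1 : 1 / 10 ≤ ∑' v : L, Set.indicator {v : L | (v : Euc n) ∉ H} f v := by
    refine (tsum_discreteGaussian_notMem_ge L hε hε1 hr H hH).trans_eq ?_
    have e1 := tsum_subtype {x : Euc n | x ∈ L ∧ x ∉ H} (discreteGaussian L r)
    have e2 := tsum_subtype (L : Set (Euc n))
      (Set.indicator {x : Euc n | x ∉ H} (discreteGaussian L r))
    rw [Set.indicator_indicator] at e2
    exact e1.trans e2.symm
  have h2 : ∑' v : L, Set.indicator {v : L | √n * r < ‖(v : Euc n)‖} f v ≤ (1 / 2) ^ n := by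
    rw [← tsum_subtype {v : L | √n * r < ‖(v : Euc n)‖} f]
    simp only [hfeq]
    rw [tsum_div_const, div_le_iff₀ hmass]
    exact tsum_gaussian_tail_le L hn hr0
  have hs : ∀ S : Set L, Summable (S.indicator f) := fun S => hsum.indicator S
  rw [← ENNReal.ofReal_tsum_of_nonneg (fun v => Set.indicator_nonneg (fun v _ => hf0 v) v) (hs _)]
  refine ENNReal.ofReal_le_ofReal ?_
  have h3 : ∑' v : L, Set.indicator {v : L | (v : Euc n) ∉ H} f v ≤
      ∑' v : L, (Set.indicator {v : L | (v : Euc n) ∉ H ∧ ‖(v : Euc n)‖ ≤ √n * r} f v +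
        Set.indicator {v : L | √n * r < ‖(v : Euc n)‖} f v) := by
    refine (hs _).tsum_le_tsum (fun v => ?_) ((hs _).add (hs _))
    have := hf0 v
    by_cases h : (v : Euc n) ∉ H <;> by_cases h' : ‖(v : Euc n)‖ ≤ √n * r <;>
      simp [Set.indicator, h, h', this, not_lt.mpr, not_le.mp]
  rw [(hs _).tsum_add (hs _)] at h3
  linarith

end

/-- If the value halves with probability at least 1/20 and never grows beyond c, the expected factor
is at most 1 - 1/40. -/
theorem PMF.expect_le_of_event {α : Type*} (p : PMF α) {f : α → ℝ≥0∞} {c : ℝ≥0∞} (G : Set α)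
    (hG : ENNReal.ofReal (1 / 20) ≤ p.toOuterMeasure G) (h1 : ∀ a, f a ≤ c)
    (h2 : ∀ a ∈ G, f a ≤ c * ENNReal.ofReal (1 / 2)) :
    p.expect f ≤ c * ENNReal.ofReal (39 / 40) := by
  classical
  have hsplit : p.toOuterMeasure G + p.toOuterMeasure Gᶜ = 1 := by
    rw [PMF.toOuterMeasure_apply, PMF.toOuterMeasure_apply, ← ENNReal.tsum_add, ← p.tsum_coe]
    exact tsum_congr fun a => Set.indicator_self_add_compl_apply G (⇑p) a
  have h3 : p.expect f ≤ c * (ENNReal.ofReal (1 / 2) * p.toOuterMeasure G + p.toOuterMeasure Gᶜ) := by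
    rw [PMF.toOuterMeasure_apply, PMF.toOuterMeasure_apply, ← ENNReal.tsum_mul_left,
      ← ENNReal.tsum_add, ← ENNReal.tsum_mul_left]
    refine ENNReal.tsum_le_tsum fun a => ?_
    by_cases ha : a ∈ G
    · simp only [Set.indicator_of_mem ha, Set.indicator_of_notMem (Set.notMem_compl_iff.mpr ha),
        add_zero]
      rw [← mul_assoc, mul_comm]
      gcongr
      exact h2 a ha
    · simp only [Set.indicator_of_notMem ha, Set.indicator_of_mem (Set.mem_compl ha), mul_zero, zero_add]
      rw [mul_comm]
      gcongr
      exact h1 a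
  refine h3.trans ?_
  gcongr
  have hne : p.toOuterMeasure G ≠ ⊤ := ne_top_of_le_ne_top ENNReal.one_ne_top (hsplit ▸ le_self_add)
  have hne' : p.toOuterMeasure Gᶜ ≠ ⊤ := ne_top_of_le_ne_top ENNReal.one_ne_top (hsplit ▸ le_add_self)
  obtain ⟨g, hg0, hg⟩ : ∃ g : ℝ, 0 ≤ g ∧ p.toOuterMeasure G = ENNReal.ofReal g :=
    ⟨_, ENNReal.toReal_nonneg, (ENNReal.ofReal_toReal hne).symm⟩
  obtain ⟨g', hg0', hg'⟩ : ∃ g : ℝ, 0 ≤ g ∧ p.toOuterMeasure Gᶜ = ENNReal.ofReal g :=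
    ⟨_, ENNReal.toReal_nonneg, (ENNReal.ofReal_toReal hne').symm⟩
  rw [hg, hg', ← ENNReal.ofReal_add hg0 hg0', ← ENNReal.ofReal_one,
    ENNReal.ofReal_eq_ofReal_iff (by positivity) zero_le_one] at hsplit
  rw [hg, ENNReal.ofReal_le_ofReal_iff hg0] at hG
  rw [hg, hg', ← ENNReal.ofReal_mul (by norm_num), ← ENNReal.ofReal_add (by positivity) hg0']
  exact ENNReal.ofReal_le_ofReal (by linarith)

/-- Passing from the ideal distribution to the oracle's changes the probability of an event by at
most the statistical distance. Distinct lattice vectors have distinct coefficient lists, so the sum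
over the lattice embeds in one over lists. -/
theorem DGSInstance.toOuterMeasure_ge {φ : LatticeFun} (I : DGSInstance φ) {p : PMF (List ℤ)}
    {δ : ℝ≥0∞} (hp : (DGS φ).err I p ≤ δ) {ε : ℝ} (hε : 0 < ε) (hε1 : ε ≤ 1 / 10)
    (hφ : √2 * smoothingParameter ε I.lattice ≤ φ I.n I.lattice)
    (H : Submodule ℝ (Euc I.n)) (hH : Module.finrank ℝ H < I.n) :
    ENNReal.ofReal (1 / 10 - (1 / 2) ^ I.n) ≤ p.toOuterMeasure
      {l | l.length = I.n ∧ I.point (coeffs I.n l) ∉ H ∧ ‖I.point (coeffs I.n l)‖ ≤ √I.n * I.r} + δ := by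
  classical
  refine (tsum_discreteGaussian_short_notMem_ge I.lattice hε hε1 (hφ.trans I.lt_r.le) H hH).trans ?_
  set G := {l : List ℤ | l.length = I.n ∧ I.point (coeffs I.n l) ∉ H ∧
    ‖I.point (coeffs I.n l)‖ ≤ √I.n * I.r} with hG
  choose z hz using fun v : I.lattice => (I.mem_lattice_iff v).mp v.2
  have hco : ∀ v, coeffs I.n (List.ofFn (z v)) = z v := fun v => by
    funext i
    simp [coeffs]
  have hinj : Function.Injective fun v => List.ofFn (z v) := fun v w h => by
    have : z v = z w := by rw [← hco v, ← hco w]; exact congrArg _ h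
    exact Subtype.ext ((hz v).symm.trans (this ▸ hz w))
  calc _ = ∑' v : I.lattice, (fun l => G.indicator (fun l => ENNReal.ofReal (I.target l)) l)
        (List.ofFn (z v)) := by
        refine tsum_congr fun v => ?_
        have ht : I.target (List.ofFn (z v)) = discreteGaussian I.lattice I.r v := by
          rw [DGSInstance.target, if_pos (by simp)]
          congr 1
          exact (congrArg I.point (hco v)).trans (hz v)
        have hmem : List.ofFn (z v) ∈ G ↔ (v : Euc I.n) ∉ H ∧ ‖(v : Euc I.n)‖ ≤ √I.n * I.r := by
          simp [hG, hco, hz]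
        dsimp only
        by_cases h : (v : Euc I.n) ∉ H ∧ ‖(v : Euc I.n)‖ ≤ √I.n * I.r
        · rw [Set.indicator_of_mem (s := {v : I.lattice | (v : Euc I.n) ∉ H ∧
              ‖(v : Euc I.n)‖ ≤ √I.n * I.r}) h,
            Set.indicator_of_mem (hmem.mpr h), ht]
        · rw [Set.indicator_of_notMem (s := {v : I.lattice | (v : Euc I.n) ∉ H ∧
              ‖(v : Euc I.n)‖ ≤ √I.n * I.r}) h,
            Set.indicator_of_notMem (hmem.not.mpr h), ENNReal.ofReal_zero]
    _ ≤ ∑' l, G.indicator (fun l => ENNReal.ofReal (I.target l)) l :=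
        ENNReal.tsum_comp_le_tsum_of_injective hinj _
    _ ≤ ∑' l, (G.indicator p l + ENNReal.ofReal |(p l).toReal - I.target l|) := by
        refine ENNReal.tsum_le_tsum fun l => ?_
        by_cases hl : l ∈ G
        · rw [Set.indicator_of_mem hl, Set.indicator_of_mem hl,
            ← ENNReal.ofReal_toReal (p.apply_ne_top l),
            ← ENNReal.ofReal_add ENNReal.toReal_nonneg (abs_nonneg _)]
          refine ENNReal.ofReal_le_ofReal ?_
          rw [ENNReal.toReal_ofReal ENNReal.toReal_nonneg]
          linarith [neg_abs_le ((p l).toReal - I.target l)]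
        · rw [Set.indicator_of_notMem hl]; exact zero_le
    _ ≤ _ := by
        rw [ENNReal.tsum_add, ← PMF.toOuterMeasure_apply]
        gcongr
        exact hp

namespace LatticeBasis

variable (x : LatticeBasis)

/-- The scale number `j`. -/
def scale (j : ℕ) : ℝ := 2 ^ (j - x.logSize) / 2 ^ (x.logSize - j)

theorem scale_eq (j : ℕ) : x.scale j = 2 ^ j / 2 ^ x.logSize := by
  rw [scale, div_eq_div_iff (by positivity) (by positivity), ← pow_add, ← pow_add]
  congr 1
  omega

theorem scale_mono {i j : ℕ} (h : i ≤ j) : x.scale i ≤ x.scale j := by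
  rw [scale_eq, scale_eq]
  gcongr
  norm_num

theorem scale_le {j : ℕ} (hj : j ≤ 2 * x.logSize) : x.scale j ≤ 2 ^ x.logSize := by
  rw [scale_eq, div_le_iff₀ (by positivity), ← pow_add]
  exact pow_le_pow_right₀ (by norm_num) (by omega)

theorem exists_instance (φ : LatticeFun) (j : ℕ) (h : φ x.n x.lattice < x.scale j) :
    ∃ I : DGSInstance φ, I.toLatticeBasis = x ∧ (I.r : ℝ) = x.scale j ∧
      (DGS φ).encode I = x.scaleQuery j := by
  have hcast : (((2 : ℤ) ^ (j - x.logSize) : ℤ) / ((2 : ℤ) ^ (x.logSize - j) : ℤ) : ℚ) =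
      ((2 ^ (j - x.logSize) / 2 ^ (x.logSize - j) : ℚ)) := by push_cast; rfl
  -- By truncated subtraction one of the two powers is 1. The fraction is in lowest terms, and so
  -- the query is literally the encoding of an instance.
  have hcop : Nat.Coprime ((2 : ℤ) ^ (j - x.logSize)).natAbs ((2 : ℤ) ^ (x.logSize - j)).natAbs := by
    rcases le_total j x.logSize with h | h
    · rw [Nat.sub_eq_zero_of_le h]; simp
    · rw [Nat.sub_eq_zero_of_le h]; simp
  have hr : (((2 ^ (j - x.logSize) / 2 ^ (x.logSize - j) : ℚ)) : ℝ) = x.scale j := by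
    rw [scale]; push_cast; rfl
  refine ⟨⟨x, 2 ^ (j - x.logSize) / 2 ^ (x.logSize - j), by positivity, by rw [hr]; exact h⟩, rfl, hr, ?_⟩
  have h1 := Rat.num_div_eq_of_coprime (a := 2 ^ (j - x.logSize)) (b := 2 ^ (x.logSize - j))
    (by positivity) hcop
  have h2 := Rat.den_div_eq_of_coprime (a := 2 ^ (j - x.logSize)) (b := 2 ^ (x.logSize - j))
    (by positivity) hcop
  rw [hcast] at h1 h2
  simp only [DGS, scaleQuery, h1, h2]

end LatticeBasis

end

noncomputable section

/-! ### The potential function -/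

namespace LatticeBasis

variable {x : LatticeBasis}

/-- The invariant at scale `j`: the rows are independent, and rows with the label of the present
scale are short. -/
structure Inv (x : LatticeBasis) (j : ℕ) (s : RowState x.n) : Prop where
  det : s.1.det ≠ 0
  bound : ∀ i j', |s.1 i j'| ≤ 2 ^ x.answerSize
  short : ∀ i, s.2 i = 2 ^ j → ‖x.point (s.1 i)‖ ≤ √x.n * x.scale j
  label : ∀ i, s.2 i = 0 ∨ ∃ j' ≥ j, s.2 i = 2 ^ j'

theorem inv_start (x : LatticeBasis) (j : ℕ) : x.Inv j (1, 0) where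
  det := by simp
  bound i j' := by
    have : (1 : ℤ) ≤ 2 ^ x.answerSize := one_le_pow₀ (by norm_num)
    simp only [Matrix.one_apply]
    split_ifs
    · simpa using this
    · rw [abs_zero]; linarith
  short i h := absurd h (by simpa using (pow_ne_zero j (two_ne_zero (α := ℤ))).symm)
  label i := Or.inl rfl

/-- On entering a new scale no row has its label: the labels in use are 0 and powers of 2 with
larger exponents. -/
theorem Inv.pred {j : ℕ} {s : RowState x.n} (h : x.Inv (j + 1) s) : x.Inv j s where
  det := h.det
  bound := h.bound
  short i hi := by
    exfalso
    rcases h.label i with h' | ⟨j', hj', h'⟩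
    · rw [hi] at h'; exact absurd h' (by positivity)
    · rw [hi] at h'
      have := Int.pow_right_injective (a := 2) (by norm_num) h'
      omega
  label i := (h.label i).imp_right fun ⟨j', hj', h'⟩ => ⟨j', by omega, h'⟩

theorem scaleUpdate_row {j : ℕ} (hj : j ≤ 2 * x.logSize) (s : RowState x.n) (l : List ℤ) (i : Fin x.n) :
    ((x.scaleUpdate j s l).1 i = s.1 i ∧ (x.scaleUpdate j s l).2 i = s.2 i) ∨
      (‖x.point ((x.scaleUpdate j s l).1 i)‖ ≤ √x.n * x.scale j ∧
        (x.scaleUpdate j s l).2 i = 2 ^ j ∧ s.2 i ≠ 2 ^ j) := by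
  unfold scaleUpdate process
  split_ifs with h
  · rcases replaceRows_row (A := 2 ^ j) (a := coeffs x.n l) (s := s) x.n i with h1 | h1
    · exact Or.inl h1
    · refine Or.inr ⟨?_, h1.2⟩
      rw [h1.1]
      exact ((accepts_iff x hj l).mp h).2
  · exact Or.inl ⟨rfl, rfl⟩

theorem Inv.scaleUpdate {j : ℕ} (hj : j ≤ 2 * x.logSize) {s : RowState x.n} (h : x.Inv j s)
    (l : List ℤ) : x.Inv j (x.scaleUpdate j s l) where
  det := by
    unfold LatticeBasis.scaleUpdate process
    split_ifs
    exacts [replaceRows_det_ne_zero h.det _, h.det]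
  bound := x.abs_process_le h.bound le_rfl
  short i hi := by
    rcases scaleUpdate_row hj s l i with h1 | h1
    · rw [h1.1]; exact h.short i (h1.2 ▸ hi)
    · exact h1.1
  label i := by
    rcases scaleUpdate_row hj s l i with h1 | h1
    · rw [h1.2]; exact h.label i
    · exact Or.inr ⟨j, le_rfl, h1.2.1⟩

theorem short_scaleUpdate {j : ℕ} (hj : j ≤ 2 * x.logSize) {s : RowState x.n} {t : ℝ}
    (ht : √x.n * x.scale j ≤ t) (h : ∀ i, ‖x.point (s.1 i)‖ ≤ t) (l : List ℤ) (i : Fin x.n) :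
    ‖x.point ((x.scaleUpdate j s l).1 i)‖ ≤ t := by
  rcases scaleUpdate_row hj s l i with h1 | h1
  · rw [h1.1]; exact h i
  · exact h1.1.trans ht

theorem Inv.isShortSet {j : ℕ} {s : RowState x.n} (h : x.Inv j s) {t : ℝ}
    (ht : ∀ i, ‖x.point (s.1 i)‖ ≤ t) : x.IsShortSet t (encodeMatrix s.1) :=
  ⟨s.1, rfl, x.linearIndependent_point h.det, ht⟩

/-- The rows without the label of scale `j`. -/
def unlabelled (x : LatticeBasis) (j : ℕ) (s : RowState x.n) : Finset (Fin x.n) :=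
  Finset.univ.filter fun i => s.2 i ≠ 2 ^ j

theorem unlabelled_scaleUpdate_subset {j : ℕ} (hj : j ≤ 2 * x.logSize) (s : RowState x.n) (l : List ℤ) :
    x.unlabelled j (x.scaleUpdate j s l) ⊆ x.unlabelled j s := by
  intro i hi
  simp only [unlabelled, Finset.mem_filter, Finset.mem_univ, true_and] at hi ⊢
  rcases scaleUpdate_row hj s l i with h1 | h1
  · rwa [← h1.2]
  · exact h1.2.2

/-- The subspace spanned by the rows with the label of scale `j`. -/
def labelledSpan (x : LatticeBasis) (j : ℕ) (s : RowState x.n) : Submodule ℝ (Euc x.n) := by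
  classical
  exact Submodule.span ℝ
    (((Finset.univ \ x.unlabelled j s).image fun i => x.point (s.1 i) : Finset (Euc x.n)) : Set (Euc x.n))

theorem finrank_labelledSpan_lt {j : ℕ} {s : RowState x.n} (h : (x.unlabelled j s).Nonempty) :
    Module.finrank ℝ (x.labelledSpan j s) < x.n := by
  classical
  refine (finrank_span_finset_le_card _).trans_lt (Finset.card_image_le.trans_lt ?_)
  have h1 := Finset.card_sdiff_add_card_eq_card (Finset.subset_univ (x.unlabelled j s))
  rw [Finset.card_univ, Fintype.card_fin] at h1
  have := h.card_pos
  omega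

/-- If no row got a new label, all unlabelled rows would have coefficient 0 in Cramer's rule, and
the sample would lie in the span of the labelled rows. -/
theorem unlabelled_scaleUpdate_ssubset {j : ℕ} (hj : j ≤ 2 * x.logSize) {s : RowState x.n}
    (hs : s.1.det ≠ 0) {l : List ℤ} (hl : l.length = x.n)
    (h1 : x.point (coeffs x.n l) ∉ x.labelledSpan j s)
    (h2 : ‖x.point (coeffs x.n l)‖ ≤ √x.n * x.scale j) :
    x.unlabelled j (x.scaleUpdate j s l) ⊂ x.unlabelled j s := by
  classical
  refine (Finset.ssubset_iff_of_subset (unlabelled_scaleUpdate_subset hj s l)).mpr ?_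
  have hacc := (accepts_iff x hj l).mpr ⟨hl, h2⟩
  have hproc : x.scaleUpdate j s l = replaceRows (2 ^ j) (coeffs x.n l) s x.n := if_pos hacc
  rcases replaceRows_progress (A := 2 ^ j) (a := coeffs x.n l) (s := s) x.n le_rfl with
    ⟨i, hi, hi'⟩ | ⟨-, h⟩
  · refine ⟨i, by simpa [unlabelled] using hi, ?_⟩
    rw [hproc]
    simpa [unlabelled] using hi'
  · exfalso
    apply h1
    have h3 := congrArg x.point (det_smul_eq_sum s.1 (coeffs x.n l))
    rw [point_smul] at h3
    replace h3 := h3.trans (x.point_sum Finset.univ _ fun i => s.1 i)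
    have h4 : s.1.det • x.point (coeffs x.n l) ∈ x.labelledSpan j s := by
      rw [h3]
      refine Submodule.sum_mem _ fun i _ => ?_
      by_cases hi : s.2 i = 2 ^ j
      · refine zsmul_mem (Submodule.subset_span ?_) _
        rw [Finset.coe_image]
        exact ⟨i, by simpa [unlabelled] using hi, rfl⟩
      · rw [h i i.2 hi, zero_smul]
        exact Submodule.zero_mem _
    rw [← Int.cast_smul_eq_zsmul ℝ] at h4
    exact (Submodule.smul_mem_iff _ (by exact_mod_cast hs)).mp h4

/-- The potential at the decisive scale. -/
def potential (x : LatticeBasis) (j k : ℕ) (s : RowState x.n) : ℝ≥0∞ :=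
  -- Success has to count as exactly 0. Otherwise there is a factor 2 for each missing row and a
  -- factor 39/40 for each sample to come.
  if x.unlabelled j s = ∅ then 0
  else 2 ^ (x.unlabelled j s).card * ENNReal.ofReal (39 / 40) ^ k

theorem potential_le (j k : ℕ) (s : RowState x.n) {u : ℕ} (hu : (x.unlabelled j s).card ≤ u) :
    x.potential j k s ≤ 2 ^ u * ENNReal.ofReal (39 / 40) ^ k := by
  unfold potential
  split_ifs
  · exact zero_le
  · gcongr
    norm_num

/-- The sample is short and outside the span of the labelled rows with probability at least 1/10 -
1/32 - 1/100 > 1/20, and then at least one factor 2 is lost. -/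
theorem potential_step {φ : LatticeFun} {O : Oracle} {δ : ℕ → ℝ≥0∞} (hO : O.Solves (DGS φ) δ) {ε : ℝ}
    (hε : 0 < ε) (hε1 : ε ≤ 1 / 10) (hφ : √2 * smoothingParameter ε x.lattice ≤ φ x.n x.lattice)
    (hδ : δ x.n ≤ ENNReal.ofReal (1 / 100)) (hn : 5 ≤ x.n) {j : ℕ} (hj : j ≤ 2 * x.logSize)
    (hφj : φ x.n x.lattice < x.scale j) (k : ℕ) {s : RowState x.n} (hs : s.1.det ≠ 0) :
    (O (x.scaleQuery j)).expect (fun l => x.potential j k (x.scaleUpdate j s l)) ≤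
      x.potential j (k + 1) s := by
  by_cases h0 : x.unlabelled j s = ∅
  · refine PMF.expect_const_le _ fun l => ?_
    have : x.unlabelled j (x.scaleUpdate j s l) = ∅ :=
      Finset.subset_empty.mp (h0 ▸ unlabelled_scaleUpdate_subset hj s l)
    rw [potential, if_pos this]
    exact zero_le
  · rw [potential, if_neg h0, pow_succ, ← mul_assoc]
    have hne := Finset.nonempty_iff_ne_empty.mpr h0
    obtain ⟨I, hI, hIr, hIe⟩ := exists_instance x φ j hφj
    subst hI
    have hOI := hO I
    rw [hIe] at hOI
    have hprob := I.toOuterMeasure_ge hOI hε hε1 hφ (I.labelledSpan j s) (finrank_labelledSpan_lt hne)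
    rw [hIr] at hprob
    refine PMF.expect_le_of_event _ {l : List ℤ | l.length = I.n ∧
      I.point (coeffs I.n l) ∉ I.labelledSpan j s ∧ ‖I.point (coeffs I.n l)‖ ≤ √I.n * I.scale j} ?_
      (fun l => potential_le j k _
        (Finset.card_le_card (unlabelled_scaleUpdate_subset hj s l))) (fun l hl => ?_)
    · have h1 : ENNReal.ofReal (1 / 20) + ENNReal.ofReal (1 / 100) ≤
          ENNReal.ofReal (1 / 10 - (1 / 2) ^ I.n) := by
        rw [← ENNReal.ofReal_add (by norm_num) (by norm_num)]
        refine ENNReal.ofReal_le_ofReal ?_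
        have : (1 / 2 : ℝ) ^ I.n ≤ (1 / 2) ^ 5 :=
          pow_le_pow_of_le_one (by norm_num) (by norm_num) hn
        norm_num at this ⊢
        linarith
      have h2 := h1.trans (hprob.trans (add_le_add_right hδ _))
      exact (ENNReal.add_le_add_iff_right ENNReal.ofReal_ne_top).mp h2
    · have hlt := Finset.card_lt_card
        (unlabelled_scaleUpdate_ssubset hj hs hl.1 hl.2.1 hl.2.2)
      obtain ⟨u, hu⟩ : ∃ u, (I.unlabelled j s).card = u + 1 :=
        ⟨_, (Nat.succ_pred_eq_of_pos hne.card_pos).symm⟩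
      refine (potential_le j k _ (show _ ≤ u by omega)).trans_eq ?_
      rw [hu, pow_succ, mul_right_comm, mul_assoc _ 2, one_div,
        ENNReal.ofReal_inv_of_pos two_pos, ENNReal.ofReal_ofNat,
        ENNReal.mul_inv_cancel two_ne_zero ENNReal.ofNat_ne_top, mul_one]

/-- The decisive scale. -/
theorem exists_scale {t : ℝ} (h1 : 1 ≤ t * 2 ^ x.logSize) (h2 : t < 2 ^ x.logSize) :
    ∃ j, 0 < j ∧ j ≤ 2 * x.logSize ∧ t < x.scale j ∧ x.scale j ≤ 2 * t := by
  have hK : (0 : ℝ) < 2 ^ x.logSize := by positivity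
  -- The decisive j is the least one whose scale exceeds `t`; by minimality the scale before it,
  -- half as large, is at most `t`.
  have hex : ∃ j : ℕ, t * 2 ^ x.logSize < 2 ^ j := ⟨2 * x.logSize, by
    rw [two_mul, pow_add]; gcongr⟩
  classical
  have hfind := Nat.find_spec hex
  have hle : Nat.find hex ≤ 2 * x.logSize := Nat.find_le (by rw [two_mul, pow_add]; gcongr)
  have hpos : 0 < Nat.find hex := by
    rw [Nat.find_pos, pow_zero]
    exact not_lt.mpr h1
  refine ⟨Nat.find hex, hpos, hle, ?_, ?_⟩
  · rwa [scale_eq, lt_div_iff₀ hK]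
  · have hmin := Nat.find_min hex (Nat.sub_lt hpos one_pos)
    rw [not_lt] at hmin
    rw [scale_eq, div_le_iff₀ hK]
    obtain ⟨u, hu⟩ : ∃ u, Nat.find hex = u + 1 := ⟨_, (Nat.succ_pred_eq_of_pos hpos).symm⟩
    rw [hu, Nat.add_sub_cancel] at hmin
    rw [hu, pow_succ]
    linarith

open Classical in
-- Nothing is expected of the oracle except at the decisive scale. Before it only independence and
-- the bound on the entries matter; after it shortness of all rows can no longer be lost, whatever
-- the oracle answers.
theorem err_le_of_solves {φ : LatticeFun} {O : Oracle} {δ : ℕ → ℝ≥0∞} (hO : O.Solves (DGS φ) δ)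
    {ε : ℝ} (hε : 0 < ε) (hε1 : ε ≤ 1 / 10)
    (hφ : √2 * smoothingParameter ε x.lattice ≤ φ x.n x.lattice)
    (hδ : δ x.n ≤ ENNReal.ofReal (1 / 100)) (hn : 5 ≤ x.n) {F : ℕ}
    (hF : reductionP.tm (sizeBound (listSize x.encode)) ≤ F) :
    (GIVP (fun n => 2 * √n) φ).err x (reductionP.outputDist O F x.encode) ≤
      2 ^ x.n * ENNReal.ofReal (39 / 40) ^ (100 * x.n) := by
  set t := φ x.n x.lattice with ht
  have hK : (0 : ℝ) < 2 ^ x.logSize := by positivity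
  have ht1 : 1 ≤ t * 2 ^ x.logSize := (x.two_pow_neg_le hε hε1).trans (by gcongr)
  have ht0 : 0 < t := by
    by_contra hc
    nlinarith [not_lt.mp hc]
  have hn1 : (1 : ℝ) ≤ √x.n := Real.one_le_sqrt.mpr (by exact_mod_cast x.n_pos)
  have hshort : ∀ (j : ℕ) (s : RowState x.n), x.Inv j s →
      ¬ x.IsShortSet (2 * √x.n * t) (encodeMatrix s.1) → ¬ ∀ i, ‖x.point (s.1 i)‖ ≤ 2 * √x.n * t :=
    fun j s hs h h' => h (hs.isShortSet h')
  -- In the first case every scale is at most φ(L), so the given basis is short and replacements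
  -- keep it short: the error is 0.
  rcases le_or_gt (2 ^ x.logSize) t with hbig | hsmall
  · have hsc : ∀ j ≤ 2 * x.logSize, √x.n * x.scale j ≤ 2 * √x.n * t := fun j hj => by
      have := (scale_le x hj).trans hbig
      nlinarith
    let V : ℕ → ℕ → RowState x.n → ℝ≥0∞ := fun j _ s =>
      if x.Inv j s ∧ ∀ i, ‖x.point (s.1 i)‖ ≤ 2 * √x.n * t then 0 else ⊤
    have hV : ∀ j k s, V j k s ≠ ⊤ → x.Inv j s ∧ ∀ i, ‖x.point (s.1 i)‖ ≤ 2 * √x.n * t :=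
      fun j k s h => by by_contra hc; exact h (if_neg hc)
    refine (err_reductionP_le (fun n => 2 * √n) φ x hF V (fun j k s h => (hV j k s h).1.bound)
      (fun j k s hj hk h => ?_) (fun j s hj => ?_) (fun s h => ?_)).trans ?_
    · have hs := hV j (k + 1) s h
      refine PMF.expect_const_le _ fun l => ?_
      simp only [V]
      rw [if_pos ⟨hs.1.scaleUpdate hj l, short_scaleUpdate hj (hsc j hj) hs.2 l⟩]
      exact zero_le
    · by_cases h : V (j + 1) 0 s = ⊤
      · rw [h]; exact le_top
      · have hs := hV (j + 1) 0 s h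
        exact (if_pos ⟨hs.1.pred, hs.2⟩).trans_le zero_le
    · by_cases h' : V 0 0 s = ⊤
      · rw [h']; exact le_top
      · have hs := hV 0 0 s h'
        exact absurd hs.2 (hshort 0 s hs.1 h)
    · refine (if_pos ⟨inv_start x _, fun i => (x.norm_vec_le i).trans ?_⟩).trans_le zero_le
      nlinarith
  · obtain ⟨j₀, hj₀, hj₀K, hlt, hle⟩ := exists_scale ht1 hsmall
    have hsc : ∀ j ≤ j₀, √x.n * x.scale j ≤ 2 * √x.n * t := fun j hj => by
      have := (scale_mono x hj).trans hle
      nlinarith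
    let v₀ : ℝ≥0∞ := 2 ^ x.n * ENNReal.ofReal (39 / 40) ^ (100 * x.n)
    -- A constant before the decisive scale, the potential during it, and the indicator of failure
    -- afterwards.
    let W : ℕ → ℕ → RowState x.n → ℝ≥0∞ := fun j k s =>
      if j₀ < j then v₀ else if j = j₀ then x.potential j₀ k s else
        if ∀ i, ‖x.point (s.1 i)‖ ≤ 2 * √x.n * t then 0 else 1
    have hW1 : ∀ j k s, j₀ < j → W j k s = v₀ := fun j k s h => if_pos h
    have hW2 : ∀ k s, W j₀ k s = x.potential j₀ k s := fun k s =>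
      (if_neg (lt_irrefl _)).trans (if_pos rfl)
    have hW3 : ∀ j k s, j < j₀ → W j k s =
        if ∀ i, ‖x.point (s.1 i)‖ ≤ 2 * √x.n * t then 0 else 1 := fun j k s h =>
      (if_neg (by omega)).trans (if_neg (by omega))
    let V : ℕ → ℕ → RowState x.n → ℝ≥0∞ := fun j k s => if x.Inv j s then W j k s else ⊤
    have hV : ∀ j k s, V j k s ≠ ⊤ → x.Inv j s := fun j k s h => by
      by_contra hc; exact h (if_neg hc)
    have hVW : ∀ j k s, x.Inv j s → V j k s = W j k s := fun j k s h => if_pos h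
    have hpot : ∀ k s, x.potential j₀ k s ≤ 2 ^ x.n * ENNReal.ofReal (39 / 40) ^ k := fun k s =>
      potential_le j₀ k s ((Finset.card_le_univ _).trans_eq (Fintype.card_fin _))
    refine (err_reductionP_le (fun n => 2 * √n) φ x hF V (fun j k s h => (hV j k s h).bound)
      (fun j k s hj hk h => ?_) (fun j s hj => ?_) (fun s h => ?_)).trans ?_
    · have hs := hV _ _ _ h
      have e : ∀ l, V j k (x.scaleUpdate j s l) = W j k (x.scaleUpdate j s l) := fun l =>
        hVW _ _ _ (hs.scaleUpdate hj l)
      simp only [e, hVW _ _ _ hs]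
      rcases lt_trichotomy j j₀ with hjj | rfl | hjj
      · simp only [hW3 _ _ _ hjj]
        split_ifs with hc
        · exact PMF.expect_const_le _ fun l =>
            (if_pos (short_scaleUpdate hj (hsc j hjj.le) hc l)).le
        · exact PMF.expect_const_le _ fun l => by split_ifs <;> simp
      · simp only [hW2]
        exact potential_step hO hε hε1 hφ hδ hn hj hlt k hs.det
      · simp only [hW1 _ _ _ hjj]
        exact PMF.expect_const_le _ fun l => le_rfl
    · by_cases h : V (j + 1) 0 s = ⊤
      · rw [h]; exact le_top
      · have hs := hV _ _ _ h
        rw [hVW _ _ _ hs, hVW _ _ _ hs.pred]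
        rcases lt_trichotomy j j₀ with hjj | rfl | hjj
        · rw [hW3 _ _ _ hjj]
          rcases eq_or_lt_of_le (Nat.succ_le_of_lt hjj) with rfl | hjj'
          · rw [hW2, potential]
            by_cases hu : x.unlabelled (j + 1) s = ∅
            · rw [if_pos]
              · exact zero_le
              · intro i
                have hi : s.2 i = 2 ^ (j + 1) := by
                  by_contra hc
                  exact Finset.notMem_empty i (hu ▸ by simpa [unlabelled] using hc)
                exact (hs.short i hi).trans (hsc _ le_rfl)
            · rw [if_neg hu, pow_zero, mul_one]
              -- With no samples left, a missing row leaves a potential of at least 1, which covers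
              -- a failure.
              have : (1 : ℝ≥0∞) ≤ 2 ^ (x.unlabelled (j + 1) s).card := one_le_pow₀ (by norm_num)
              split_ifs
              exacts [zero_le, this]
          · rw [hW3 _ _ _ hjj']
        · rw [hW2, hW1 _ _ _ (Nat.lt_succ_self _)]
          exact hpot _ _
        · rw [hW1 _ _ _ hjj, hW1 _ _ _ (by omega)]
    · by_cases h' : V 0 0 s = ⊤
      · rw [h']; exact le_top
      · have hs := hV _ _ _ h'
        rw [hVW _ _ _ hs, hW3 _ _ _ hj₀, if_neg (hshort 0 s hs h)]
    · rw [hVW _ _ _ (inv_start x _)]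
      rcases eq_or_lt_of_le hj₀K with he | hlt'
      · rw [← he, hW2]; exact hpot _ _
      · rw [hW1 _ _ _ hlt']

end LatticeBasis

/-! ### The reductions -/

theorem givp_polyTimeReducible (ε : ℕ → ℝ) (φ : LatticeFun) (hε : ∀ n, 0 < ε n ∧ ε n ≤ 1 / 10)
    (hφ : ∀ (n : ℕ) (L : Submodule ℤ (Euc n)) [DiscreteTopology L] [IsZLattice ℝ L],
      0 < n → √2 * smoothingParameter (ε n) L ≤ φ n L) :
    PolyTimeReducible (GIVP (fun n => 2 * √n) φ) (DGS φ) := by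
  classical
  obtain ⟨T, hT⟩ := exists_polynomial_time
  refine ⟨reductionP, T, reductionP_runsInTime _ _ hT, fun δ hδ => ?_⟩
  -- Only the behaviour for large n matters; in the finitely many dimensions that are too small, or
  -- where δ is not yet small, the bound is vacuous.
  refine ⟨fun n => if δ n ≤ ENNReal.ofReal (1 / 100) ∧ 5 ≤ n then
    2 ^ n * ENNReal.ofReal (39 / 40) ^ (100 * n) else ⊤, ⟨2, two_pos, ?_⟩, fun O hO x => ?_⟩
  · obtain ⟨c, hc, hδc⟩ := hδ
    have hlim : Filter.Tendsto (fun n : ℕ => (2 : ℝ) ^ (-(c * n))) Filter.atTop (nhds 0) := by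
      have h1 : ∀ n : ℕ, (2 : ℝ) ^ (-(c * n)) = ((2 : ℝ) ^ (-c)) ^ n := fun n => by
        rw [← Real.rpow_natCast, ← Real.rpow_mul zero_le_two, neg_mul]
      simp only [h1]
      exact tendsto_pow_atTop_nhds_zero_of_lt_one (by positivity)
        (Real.rpow_lt_one_of_one_lt_of_neg one_lt_two (by linarith))
    filter_upwards [hδc, hlim.eventually (ge_mem_nhds (by norm_num : (0 : ℝ) < 1 / 100)),
      Filter.eventually_ge_atTop 5] with n h1 h2 h3
    rw [if_pos ⟨h1.trans (ENNReal.ofReal_le_ofReal h2), h3⟩]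
    have e1 : (2 : ℝ≥0∞) ^ n * ENNReal.ofReal (39 / 40) ^ (100 * n) =
        ENNReal.ofReal ((2 * (39 / 40) ^ 100) ^ n) := by
      rw [mul_pow, ← pow_mul, ENNReal.ofReal_mul (by positivity), ENNReal.ofReal_pow (by norm_num),
        ENNReal.ofReal_pow (by norm_num), ENNReal.ofReal_ofNat]
    rw [e1]
    refine ENNReal.ofReal_le_ofReal ?_
    have e2 : (2 : ℝ) ^ (-(2 * (n : ℝ))) = (1 / 4) ^ n := by
      rw [← neg_mul, Real.rpow_mul zero_le_two, Real.rpow_natCast]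
      congr 1
      rw [Real.rpow_neg zero_le_two]
      norm_num
    rw [e2]
    -- What remains is 2 (39/40)^100 ≤ 1/4, the reason for taking 100 samples per dimension.
    gcongr
    norm_num
  · change LatticeBasis at x
    change (GIVP (fun n => 2 * √n) φ).err x (reductionP.outputDist O (T.eval (listSize x.encode))
      x.encode) ≤ if δ x.n ≤ ENNReal.ofReal (1 / 100) ∧ 5 ≤ x.n then _ else _
    split_ifs with h
    · exact LatticeBasis.err_le_of_solves hO (hε x.n).1 (hε x.n).2 (hφ x.n x.lattice x.n_pos) h.1 h.2
        (by rw [hT]; exact Nat.le_add_right _ _)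
    · exact le_top

end

noncomputable section

/-! ### Approximation factors -/

theorem LatticeBasis.IsShortSet.mono {B : LatticeBasis} {s t : ℝ} {a : List ℤ}
    (h : B.IsShortSet s a) (hst : s ≤ t) : B.IsShortSet t a := by
  obtain ⟨z, ha, hz, hs⟩ := h
  exact ⟨z, ha, hz, fun i => (hs i).trans hst⟩

/-- A weaker bound on the norms makes the generalized independent vectors problem easier. -/
theorem PolyTimeReducible.givp_mono {Q : LatticeProblem} {γ γ' : ℕ → ℝ} {φ φ' : LatticeFun}
    (h : PolyTimeReducible (GIVP γ φ) Q)
    (hle : ∀ x : LatticeBasis, γ x.n * φ x.n x.lattice ≤ γ' x.n * φ' x.n x.lattice) :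
    PolyTimeReducible (GIVP γ' φ') Q := by
  obtain ⟨M, T, hT, hM⟩ := h
  refine ⟨M, T, hT, fun δ hδ => ?_⟩
  obtain ⟨δ', hδ', hO⟩ := hM δ hδ
  refine ⟨δ', hδ', fun O hQ x => le_trans ?_ (hO O hQ x)⟩
  exact MeasureTheory.measure_mono fun a ha hs => ha (hs.mono (hle x))

/-- The function √(2n) η/α exceeds √2 η, so the first reduction applies. Its length bound 2√n ·
√(2n) η/α = 2√2 (n/α) η becomes a multiple of λ_n by `smoothingParameter_le_lambdaN`. -/
theorem sivp_polyTimeReducible (ε α : ℕ → ℝ) (hε : ∀ n, 0 < ε n ∧ ε n ≤ 1 / 10)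
    (hα : ∀ n, 0 < α n ∧ α n < 1) :
    PolyTimeReducible
      (SIVP fun n => 2 * √2 * (n / α n) * √(Real.log (2 * n * (1 + 1 / ε n)) / Real.pi))
      (DGS fun n L => √(2 * n) * smoothingParameter (ε n) L / α n) := by
  refine (givp_polyTimeReducible ε _ hε fun n L _ _ hn => ?_).givp_mono fun x => ?_
  · have hη := smoothingParameter_pos L hn (hε n).1 (hε n).2
    have hn1 : (1 : ℝ) ≤ n := by exact_mod_cast hn
    rw [le_div_iff₀ (hα n).1]
    calc √2 * smoothingParameter (ε n) L * α n
        ≤ √2 * smoothingParameter (ε n) L * 1 := by gcongr; exact (hα n).2.le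
      _ ≤ √(2 * n) * smoothingParameter (ε n) L := by
        rw [mul_one]
        gcongr
        linarith
  · have hα0 := (hα x.n).1
    have hle := smoothingParameter_le_lambdaN x.lattice x.n_pos (hε x.n).1
    have hsq : √(x.n : ℝ) * √x.n = x.n := Real.mul_self_sqrt (Nat.cast_nonneg _)
    calc 2 * √(x.n : ℝ) * (√(2 * x.n) * smoothingParameter (ε x.n) x.lattice / α x.n)
        = 2 * √2 * ((√(x.n : ℝ) * √x.n) / α x.n) * smoothingParameter (ε x.n) x.lattice := by
          rw [Real.sqrt_mul zero_le_two]
          ring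
      _ ≤ 2 * √2 * ((√(x.n : ℝ) * √x.n) / α x.n) * (lambdaN x.n x.lattice *
            √(Real.log (2 * x.n * (1 + 1 / ε x.n)) / Real.pi)) := by gcongr
      _ = _ := by
          rw [hsq]
          ring

/-- A negligible function whose inverse has only quasi-polynomial growth. -/
def expNegLogSq (n : ℕ) : ℝ := Real.exp (-Real.log (n + 1) ^ 2) / 10

theorem expNegLogSq_pos (n : ℕ) : 0 < expNegLogSq n := by
  unfold expNegLogSq
  positivity

theorem expNegLogSq_le (n : ℕ) : expNegLogSq n ≤ 1 / 10 := by
  unfold expNegLogSq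
  gcongr
  exact Real.exp_le_one_iff.mpr (neg_nonpos.mpr (sq_nonneg _))

/-- With u = log(n + 1), n^k times the function is at most exp(-u (u - k)). -/
theorem superpolynomialDecay_expNegLogSq :
    Asymptotics.SuperpolynomialDecay Filter.atTop (fun n : ℕ => (n : ℝ)) expNegLogSq := by
  intro k
  have hu : Filter.Tendsto (fun n : ℕ => Real.log ((n : ℝ) + 1)) Filter.atTop Filter.atTop :=
    Real.tendsto_log_atTop.comp
      (Filter.tendsto_atTop_add_const_right _ _ tendsto_natCast_atTop_atTop)
  have hv : Filter.Tendsto (fun n : ℕ => Real.exp (-(Real.log ((n : ℝ) + 1) *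
      (Real.log ((n : ℝ) + 1) + -(k : ℝ))))) Filter.atTop (nhds 0) :=
    Real.tendsto_exp_neg_atTop_nhds_zero.comp
      (hu.atTop_mul_atTop₀ (Filter.tendsto_atTop_add_const_right _ _ hu))
  refine squeeze_zero (fun n => mul_nonneg (by positivity) (expNegLogSq_pos n).le) (fun n => ?_) hv
  have hn : (n : ℝ) ^ k ≤ Real.exp (k * Real.log (n + 1)) := by
    rw [Real.exp_nat_mul, Real.exp_log (by positivity)]
    gcongr
    linarith
  calc (n : ℝ) ^ k * expNegLogSq n
      ≤ Real.exp (k * Real.log (n + 1)) * Real.exp (-Real.log (n + 1) ^ 2) := by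
        unfold expNegLogSq
        gcongr
        exact div_le_self (Real.exp_pos _).le (by norm_num)
    _ = _ := by
        rw [← Real.exp_add]
        ring_nf

theorem one_le_log_mul_one_add_inv {n : ℕ} (hn : 0 < n) {ε : ℝ} (hε : 0 < ε) (hε1 : ε ≤ 1 / 10) :
    1 ≤ Real.log (2 * n * (1 + 1 / ε)) := by
  have hn1 : (1 : ℝ) ≤ n := by exact_mod_cast hn
  have h10 : 10 ≤ 1 / ε := by
    rw [le_div_iff₀ hε]
    linarith
  rw [Real.le_log_iff_exp_le (by positivity)]
  nlinarith [Real.exp_one_lt_d9]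

theorem log_mul_one_add_inv_expNegLogSq_le {n : ℕ} (hn : 0 < n) :
    Real.log (2 * n * (1 + 1 / expNegLogSq n)) ≤ 12 * Real.log (n + 1) ^ 2 := by
  have hn1 : (1 : ℝ) ≤ n := by exact_mod_cast hn
  set u := Real.log ((n : ℝ) + 1) with hu
  have hu2 : 0.69 ≤ u := by
    have h2 : Real.log 2 ≤ u := Real.log_le_log two_pos (by linarith)
    linarith [Real.log_two_gt_d9]
  have h22 : Real.log 32 = 5 * Real.log 2 := by
    rw [show (32 : ℝ) = 2 ^ 5 by norm_num, Real.log_pow]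
    norm_num
  have hE : 1 ≤ Real.exp (u ^ 2) := Real.one_le_exp (sq_nonneg u)
  have hinv : 1 / expNegLogSq n = 10 * Real.exp (u ^ 2) := by
    rw [expNegLogSq, ← hu, Real.exp_neg]
    field_simp
  have hn' : (n : ℝ) + 1 = Real.exp u := (Real.exp_log (by positivity)).symm
  calc Real.log (2 * n * (1 + 1 / expNegLogSq n))
      -- With E = exp(u²) ≥ 1 one has 2n(1 + 10E) ≤ 22nE ≤ 32(n + 1)E. The constant and the linear
      -- term are then absorbed in 12u², as u ≥ log 2.
      ≤ Real.log (32 * Real.exp (u + u ^ 2)) := by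
        have h0 := expNegLogSq_pos n
        refine Real.log_le_log (by positivity) ?_
        rw [hinv, Real.exp_add, ← hn']
        nlinarith
    _ = 5 * Real.log 2 + (u + u ^ 2) := by
        rw [Real.log_mul (by norm_num) (Real.exp_pos _).ne', Real.log_exp, h22]
    _ ≤ 12 * u ^ 2 := by nlinarith [Real.log_two_lt_d9]

theorem approxFactor_bounds {n : ℕ} (hn : 0 < n) {α : ℝ} (hα : 0 < α) (hα1 : α < 1) :
    1 ≤ 2 * √2 * (n / α) * √(Real.log (2 * n * (1 + 1 / expNegLogSq n)) / Real.pi) ∧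
    2 * √2 * (n / α) * √(Real.log (2 * n * (1 + 1 / expNegLogSq n)) / Real.pi) ≤
      6 * (n / α) * Real.log (n + 1) ^ 1 := by
  have hn1 : (1 : ℝ) ≤ n := by exact_mod_cast hn
  have hu : 0 ≤ Real.log ((n : ℝ) + 1) := Real.log_nonneg (by linarith)
  have h1 := one_le_log_mul_one_add_inv hn (expNegLogSq_pos n) (expNegLogSq_le n)
  have h2 := log_mul_one_add_inv_expNegLogSq_le hn
  have hq : 1 ≤ n / α := (one_le_div hα).mpr (hα1.le.trans hn1)
  have hs1 : 1 ≤ √2 := Real.one_le_sqrt.mpr one_le_two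
  have hs2 : √2 ≤ 3 / 2 := Real.sqrt_le_iff.mpr (by norm_num)
  have hlo : 1 / 2 ≤ √(Real.log (2 * n * (1 + 1 / expNegLogSq n)) / Real.pi) := by
    refine Real.le_sqrt_of_sq_le ?_
    rw [le_div_iff₀ Real.pi_pos]
    linarith [Real.pi_lt_four]
  have hhi : √(Real.log (2 * n * (1 + 1 / expNegLogSq n)) / Real.pi) ≤
      2 * Real.log (n + 1) := by
    refine Real.sqrt_le_iff.mpr ⟨by positivity, ?_⟩
    rw [div_le_iff₀ Real.pi_pos]
    nlinarith [Real.pi_gt_three, sq_nonneg (Real.log ((n : ℝ) + 1))]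
  constructor
  · calc (1 : ℝ) = 2 * 1 * 1 * (1 / 2) := by norm_num
      _ ≤ _ := by gcongr
  · calc 2 * √2 * (n / α) * √(Real.log (2 * n * (1 + 1 / expNegLogSq n)) / Real.pi)
        ≤ 2 * (3 / 2) * (n / α) * (2 * Real.log (n + 1)) := by gcongr
      _ = _ := by ring

/-! ### The main theorem -/

theorem mainTheorem9 :
    -- `GIVP_{2√n φ}` reduces to `DGS_φ`
    (∀ (ε : ℕ → ℝ) (φ : LatticeFun),
      (∀ n, 0 < ε n ∧ ε n ≤ 1 / 10) →
      (∀ (n : ℕ) (L : Submodule ℤ (Euc n)) [DiscreteTopology L] [IsZLattice ℝ L],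
        0 < n → √2 * smoothingParameter (ε n) L ≤ φ n L) →
      PolyTimeReducible (GIVP (fun n => 2 * √n) φ) (DGS φ)) ∧
    -- `SIVP_γ` reduces to `DGS_{√(2n) η_ε(L) / α}` for an explicit `γ`
    (∀ (ε α : ℕ → ℝ),
      (∀ n, 0 < ε n ∧ ε n ≤ 1 / 10) → (∀ n, 0 < α n ∧ α n < 1) →
      PolyTimeReducible
        (SIVP fun n =>
          2 * √2 * (n / α n) * √(Real.log (2 * n * (1 + 1 / ε n)) / Real.pi))
        (DGS fun n L => √(2 * n) * smoothingParameter (ε n) L / α n)) ∧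
    -- for a suitable negligible `ε`, this is `SIVP` with approximation factor `Õ(n / α)`
    (∃ ε : ℕ → ℝ, (∀ n, 0 < ε n ∧ ε n ≤ 1 / 10) ∧
      Asymptotics.SuperpolynomialDecay Filter.atTop (fun n : ℕ => (n : ℝ)) ε ∧
      ∃ (C : ℝ) (k : ℕ), ∀ α : ℕ → ℝ, (∀ n, 0 < α n ∧ α n < 1) →
        ∃ γ : ℕ → ℝ,
          (∀ n : ℕ, 0 < n →
            1 ≤ γ n ∧ γ n ≤ C * (n / α n) * Real.log (n + 1) ^ k) ∧
          PolyTimeReducible (SIVP γ)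
            (DGS fun n L => √(2 * n) * smoothingParameter (ε n) L / α n)) ∧
    -- the discrete Gaussian escapes every proper subspace with probability at least `1 / 10`
    (∀ (n : ℕ) (L : Submodule ℤ (Euc n)) [DiscreteTopology L] [IsZLattice ℝ L] (ε r : ℝ),
      0 < ε → ε ≤ 1 / 10 → √2 * smoothingParameter ε L ≤ r →
      ∀ H : Submodule ℝ (Euc n), Module.finrank ℝ H < n →
        1 / 10 ≤ ∑' x : {x : Euc n // x ∈ L ∧ x ∉ H}, discreteGaussian L r x) := by
  refine ⟨fun ε φ hε hφ => givp_polyTimeReducible ε φ hε hφ,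
    fun ε α hε hα => sivp_polyTimeReducible ε α hε hα,
    ⟨expNegLogSq, fun n => ⟨expNegLogSq_pos n, expNegLogSq_le n⟩,
      superpolynomialDecay_expNegLogSq, 6, 1, fun α hα => ⟨_, fun n hn =>
        approxFactor_bounds hn (hα n).1 (hα n).2, sivp_polyTimeReducible _ α
          (fun n => ⟨expNegLogSq_pos n, expNegLogSq_le n⟩) hα⟩⟩,
    fun n L _ _ ε r hε hε1 hr H hH => tsum_discreteGaussian_notMem_ge L hε hε1 hr H hH⟩

end
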